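/- **Theorem.** *Setting.* For a bi-degree sequence $(\mathbf d^-,\mathbf d^+)$ on $n$ nodes (nonnegative integers $d_r^-,d_r^+$, $1\le r\le n$, with $\sum_r d_r^-=\sum_r d_r^+=:L_n$) put $$g_n^\pm(t)=\frac1n\sum_{r=1}^n 1(d_r^\pm=t),\qquad f_n^\pm(t)=\frac1{L_n}\sum_{r=1}^n 1(d_r^\pm=t)\,d_r^\mp,\qquad t=0,1,2,\dots$$ Let $d_1(\rho_1,\rho_2)=\inf_\pi\int|x-y|\,d\pi(x,y)$, the infimum over all couplings $\pi$ of $\rho_1,\rho_2$, be the Kantorovich–Rubinstein distance of probability measures on $\mathbb R$. Let $g^+,g^-,f^+,f^-$ be probability mass functions on the nonnegative integers such that $g^+$ and $g^-$ have the same mean $\nu\in(0,\infty)$, and $f^+$ and $f^-$ have the same mean $\mu\in(1,\infty)$. Fix $\varepsilon>0$, $0<\kappa\le1$ and $K_\kappa<\infty$. For each $n\ge1$ let $(\mathbf D_n^-,\mathbf D_n^+)$ be a (possibly random) bi-degree sequence on $n$ nodes, and let $\Omega_n$ be the event that $$\max\{d_1(g_n^+,g^+),\,d_1(g_n^-,g^-),\,d_1(f_n^+,f^+),\,d_1(f_n^-,f^-)\}\le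 n^{-\varepsilon}\quad\text{and}\quad\sum_{r=1}^n\big((D_r^-)^\kappa+(D_r^+)^\kappa\big)D_r^+D_r^-\le K_\kappa n,$$ where $g_n^\pm,f_n^\pm$ are those of $(\mathbf D_n^-,\mathbf D_n^+)$ (a bi-degree sequence with $L_n=0$ is not in $\Omega_n$). Given the bi-degree sequence, the directed configuration model $\mathcal G_n$ attaches $D_r^-$ inbound and $D_r^+$ outbound half-edges to each node $r$ and matches the outbound with the inbound half-edges by a uniformly random bijection. Let $H_n\in\{0,1,\dots\}\cup\{\infty\}$ be the hopcount from the first to the second of two nodes that are chosen independently and uniformly at random, independently of $\mathcal G_n$: the length of a shortest directed path, $\infty$ if there is none. Let $(\hat Z_k^+)_{k\ge0}$ and $(\hat Z_k^-)_{k\ge0}$ be independent delayed Galton–Watson processes: $\hat Z_0^\pm=1$, the root has offspring distribution $g^\pm$, all other individuals have offspring distribution $f^\pm$, and all offspring numbers are independent. *Claim.* Suppose that $P(\Omega_n)\to1$ as $n\to\infty$. Then the martingale limits $W^\pm=\lim_{k\to\infty}\hat Z_k^\pm/(\nu\mu^{k-1})$ exist almost surely, $P(W^+W^->0)>0$, and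 there exist random variables $\{\mathcal H_n\}_{n\ge1}$ with $$P(\mathcal H_n\le x)=1-E\left[\exp\left\{-\frac{\nu}{\mu-1}\cdot\frac{\mu^{\lfloor\log_\mu n\rfloor+\lfloor x\rfloor}}{n}\,W^+W^-\right\}\,\middle|\,W^+W^->0\right],\qquad x\in\mathbb R,$$ such that for each fixed $t\in\mathbb Z$, $$\lim_{n\to\infty}\Big|P\big(H_n-\lfloor\log_\mu n\rfloor=t\,\big|\,H_n<\infty\big)-P(\mathcal H_n=t)\Big|=0.$$ -/

import Mathlib

open MeasureTheory ProbabilityTheory Filter Topology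
open scoped ENNReal

namespace DCM

/-! ### Bi-degree sequences and the directed configuration model -/

/-- A bi-degree sequence on the nodes `Fin n`: in-degrees and out-degrees with the same sum. -/
structure BiDegree (n : ℕ) where
  inDeg : Fin n → ℕ
  outDeg : Fin n → ℕ
  sum_eq : ∑ i, inDeg i = ∑ i, outDeg i

/-- The total number of edges `L_n` (the common value of the two degree sums). -/
def BiDegree.edges {n : ℕ} (d : BiDegree n) : ℕ := ∑ i, d.inDeg i

/-- The inbound half-edges: node `i` carries `inDeg i` of them. -/
abbrev BiDegree.InStub {n : ℕ} (d : BiDegree n) : Type := Σ i : Fin n, Fin (d.inDeg i)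

/-- The outbound half-edges: node `i` carries `outDeg i` of them. -/
abbrev BiDegree.OutStub {n : ℕ} (d : BiDegree n) : Type := Σ i : Fin n, Fin (d.outDeg i)

/-- A directed multigraph with labelled half-edges: a bi-degree sequence together with a complete
matching of its outbound half-edges with its inbound half-edges. -/
structure Graph (n : ℕ) where
  deg : BiDegree n
  pairing : deg.OutStub ≃ deg.InStub

/-- There are only countably many graphs on `n` nodes; they carry the discrete sigma-algebra. -/
instance {n : ℕ} : MeasurableSpace (Graph n) := ⊤

/-- There is a directed edge from `i` to `j`: some outbound half-edge of `i` is paired with an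
inbound half-edge of `j`. -/
def Graph.Edge {n : ℕ} (G : Graph n) (i j : Fin n) : Prop :=
  ∃ s : G.deg.OutStub, s.1 = i ∧ (G.pairing s).1 = j

/-- There is a directed path with exactly `k` edges from `i` to `j`. (Repeated nodes are allowed;
this does not affect the minimal length.) -/
def Graph.HasPath {n : ℕ} (G : Graph n) (k : ℕ) (i j : Fin n) : Prop :=
  ∃ p : ℕ → Fin n, p 0 = i ∧ p k = j ∧ ∀ m < k, G.Edge (p m) (p (m + 1))

/-- The hopcount from `i` to `j`: the length of a shortest directed path, `⊤` if there is none. -/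
noncomputable def Graph.hopcount {n : ℕ} (G : Graph n) (i j : Fin n) : ℕ∞ :=
  ⨅ (k : ℕ) (_ : G.HasPath k i j), (k : ℕ∞)

/-- `G` is a random graph generated through the directed configuration model from its (possibly
random) bi-degree sequence `(G ·).deg`, and `U`, `V` are two nodes sampled uniformly at random:
conditionally on the bi-degree sequence, the pairing is uniform among all pairings of outbound with
inbound half-edges, `U` and `V` are uniform on the `n` nodes, and the three are independent. -/
structure IsDCM {n : ℕ} {Ω : Type*} [MeasurableSpace Ω] (P : Measure Ω)
    (G : Ω → Graph n) (U V : Ω → Fin n) : Prop where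
  measurable_graph : Measurable G
  measurable_fst : Measurable U
  measurable_snd : Measurable V
  law : ∀ (g : Graph n) (u v : Fin n),
    P {ω | G ω = g ∧ U ω = u ∧ V ω = v} =
      P {ω | (G ω).deg = g.deg} *
        ((Nat.card (g.deg.OutStub ≃ g.deg.InStub) : ℝ≥0∞)⁻¹ * ((n : ℝ≥0∞)⁻¹ * (n : ℝ≥0∞)⁻¹))

/-! ### Empirical degree distributions and the Kantorovich-Rubinstein distance -/

/-- `g_n^+`: the out-degree distribution of a uniformly chosen node. -/
noncomputable def BiDegree.gPlus {n : ℕ} (d : BiDegree n) (t : ℕ) : ℝ≥0∞ :=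
  (∑ r, if d.outDeg r = t then 1 else 0) / (n : ℝ≥0∞)

/-- `g_n^-`: the in-degree distribution of a uniformly chosen node. -/
noncomputable def BiDegree.gMinus {n : ℕ} (d : BiDegree n) (t : ℕ) : ℝ≥0∞ :=
  (∑ r, if d.inDeg r = t then 1 else 0) / (n : ℝ≥0∞)

/-- `f_n^+`: the out-degree distribution size-biased by the in-degree. -/
noncomputable def BiDegree.fPlus {n : ℕ} (d : BiDegree n) (t : ℕ) : ℝ≥0∞ :=
  (∑ r, if d.outDeg r = t then (d.inDeg r : ℝ≥0∞) else 0) / (d.edges : ℝ≥0∞)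

/-- `f_n^-`: the in-degree distribution size-biased by the out-degree. -/
noncomputable def BiDegree.fMinus {n : ℕ} (d : BiDegree n) (t : ℕ) : ℝ≥0∞ :=
  (∑ r, if d.inDeg r = t then (d.outDeg r : ℝ≥0∞) else 0) / (d.edges : ℝ≥0∞)

/-- The measure on `ℝ` carried by the nonnegative integers with mass `p t` at `t`. -/
noncomputable def natLaw (p : ℕ → ℝ≥0∞) : Measure ℝ :=
  Measure.sum fun t : ℕ => p t • Measure.dirac (t : ℝ)

/-- The Kantorovich-Rubinstein (Wasserstein-1) distance: the infimum over all couplings of the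
expected distance. It is `⊤` if there is no coupling, that is, if one of the two measures is not a
probability measure (which for `f_n^±` happens exactly when the graph has no edge). -/
noncomputable def d1 (ρ₁ ρ₂ : Measure ℝ) : ℝ≥0∞ :=
  ⨅ (π : Measure (ℝ × ℝ))
    (_ : IsProbabilityMeasure π ∧ π.map Prod.fst = ρ₁ ∧ π.map Prod.snd = ρ₂),
    ∫⁻ z, ENNReal.ofReal |z.1 - z.2| ∂π

/-- The regularity condition on a bi-degree sequence that defines the event `Ω_n`: the degree
distributions and the size-biased degree distributions are within `n ^ (-ε)` of `g^±` and `f^±`, and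
a `(1 + κ)`-moment bound holds. -/
def BiDegree.Regular {n : ℕ} (d : BiDegree n) (gp gm fp fm : PMF ℕ) (ε κ K : ℝ) : Prop :=
  max (max (d1 (natLaw d.gPlus) (natLaw gp)) (d1 (natLaw d.gMinus) (natLaw gm)))
      (max (d1 (natLaw d.fPlus) (natLaw fp)) (d1 (natLaw d.fMinus) (natLaw fm)))
    ≤ ENNReal.ofReal ((n : ℝ) ^ (-ε)) ∧
  ∑ r, ((d.inDeg r : ℝ) ^ κ + (d.outDeg r : ℝ) ^ κ) * (d.outDeg r : ℝ) * (d.inDeg r : ℝ)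
    ≤ K * (n : ℝ)

/-! ### Delayed Galton-Watson processes -/

/-- The mean of a distribution on the nonnegative integers. -/
noncomputable def pmfMean (p : PMF ℕ) : ℝ≥0∞ := ∑' j : ℕ, (j : ℝ≥0∞) * p j

/-- The law of the family `χ (k, i)` of offspring numbers of the `i`-th individual of generation
`k`: they are independent, with law `g` in generation `0` (the root) and law `f` in all later
generations. -/
noncomputable def offspringLaw (g f : PMF ℕ) : Measure (ℕ × ℕ → ℕ) :=
  Measure.infinitePi fun p : ℕ × ℕ => (if p.1 = 0 then g else f).toMeasure

/-- The generation sizes of the tree with offspring numbers `χ`. Under `offspringLaw g f` this is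
the delayed Galton-Watson process with offspring distributions `(g, f)`. -/
def genSize (χ : ℕ × ℕ → ℕ) : ℕ → ℕ
  | 0 => 1
  | k + 1 => ∑ i ∈ Finset.range (genSize χ k), χ (k, i)

/-- The martingale `Z_{k+1} / (ν μ ^ k)`, `k ≥ 0`. -/
noncomputable def gwMartingale (ν μ : ℝ) (χ : ℕ × ℕ → ℕ) (k : ℕ) : ℝ :=
  (genSize χ (k + 1) : ℝ) / (ν * μ ^ k)

/-- The limit `W` of the martingale. -/
noncomputable def gwLimit (ν μ : ℝ) (χ : ℕ × ℕ → ℕ) : ℝ :=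
  limUnder atTop (gwMartingale ν μ χ)

end DCM

/-! There is a path of length at most `A + H` from `u` to `v` exactly when the ball of radius `A`
around `u`, followed along the edges, meets the ball of radius `H` around `v`, followed against
them. Both balls are grown by breadth-first search while the matching is revealed one half-edge at a
time. With radii close to half of `log_μ n` they contain of order `√n` half-edges, so each revealed
partner is almost a fresh sample from a size-biased law, and the generations behave like two
independent delayed Galton-Watson processes. The forward search leaves about `Z⁺_{A+1}` half-edges
unmatched. Each of the `Z⁻_1 + ... + Z⁻_H` half-edges revealed by the backward search avoids them
with probability about `exp(-Z⁺_{A+1} / L_n)`. Hence `P(H_n > A + H)` is close to `E exp(-Z⁺_{A+1}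
(Z⁻_1 + ... + Z⁻_H) / L_n)`, and `L_n ≈ ν n`, `Z⁺_{A+1} ≈ ν μ^A W⁺`, `Z⁻_1 + ... + Z⁻_H ≈ ν μ^H W⁻ /
(μ - 1)` turn the exponent into the claimed one.

No coupling of graph and trees is built. The transform of the branching process obeys a one-step
recursion. `NearLaw.abs_step_le` shows that averaging over the next partner obeys it up to an error
proportional to `δ (s + 1 - q)`; `exploration_bound` accumulates the errors, and
`NearLaw.two_phase_bound` concatenates the two searches. These bounds are uniform over regular
bi-degree sequences, so the randomness of the degrees enters only through total probability
(`IsDCM.measure_le`).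

Conditioning on `H_n < ∞` needs `P(H_n < ∞) → P(W⁺W⁻ > 0)`. The tail at `⌊log_μ n⌋ + k` with `k`
large bounds `P(H_n = ∞)` from above, and the early death of one of the searches bounds it from
below. The two bounds agree because the martingale limit vanishes only on extinction
(`tendsto_extinction`). This rests on a moment of order `1 + κ` of `f^±`, inherited from the degree
sequences (`sum_rpow_le`). The limiting variables come from a standard exponential variable
(`exists_gumbel_variables`). -/

namespace DCM

set_option linter.unusedSectionVars false

/-! ### Uniform matchings, partial matchings, and the state of a breadth-first search -/

section Exploration

variable {V α β : Type*} [Fintype α] [Fintype β] [DecidableEq V] [DecidableEq α] [DecidableEq β]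

/-- The bijections that extend the partial matching `p`. -/
def extensions (p : Finset (α × β)) : Finset (α ≃ β) :=
  Finset.univ.filter fun σ => ∀ x ∈ p, σ x.1 = x.2

/-- The mean of `X` over all bijections that extend `p`. -/
noncomputable def condMean (p : Finset (α × β)) (X : (α ≃ β) → ℝ) : ℝ :=
  (∑ σ ∈ extensions p, X σ) / ((extensions p).card : ℝ)

lemma mem_extensions {p : Finset (α × β)} {σ : α ≃ β} :
    σ ∈ extensions p ↔ ∀ x ∈ p, σ x.1 = x.2 := by
  simp [extensions]

lemma extensions_insert (p : Finset (α × β)) (s : α) (y : β) :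
    extensions (insert (s, y) p) = (extensions p).filter fun σ => σ s = y := by
  ext σ
  simp only [mem_extensions, Finset.mem_filter, Finset.forall_mem_insert]
  tauto

lemma snd_injOn_of_extensions {p : Finset (α × β)} (hp : (extensions p).Nonempty) :
    Set.InjOn Prod.snd (p : Set (α × β)) := by
  obtain ⟨σ, hσ⟩ := hp
  rw [mem_extensions] at hσ
  intro x hx y hy h
  have : x.1 = y.1 := σ.injective (by rw [hσ x hx, hσ y hy, h])
  exact Prod.ext this h

lemma card_image_snd_of_extensions {p : Finset (α × β)} (hp : (extensions p).Nonempty) :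
    (p.image Prod.snd).card = p.card :=
  Finset.card_image_of_injOn (snd_injOn_of_extensions hp)

lemma apply_notMem_image_snd {p : Finset (α × β)} {σ : α ≃ β} (hσ : σ ∈ extensions p) {s : α}
    (hs : s ∉ p.image Prod.fst) : σ s ∉ p.image Prod.snd := by
  rw [mem_extensions] at hσ
  intro h
  obtain ⟨x, hx, hxs⟩ := Finset.mem_image.1 h
  exact hs (Finset.mem_image.2 ⟨x, hx, σ.injective (by rw [hσ x hx, hxs])⟩)

/-- Composing with the transposition of `y` and `z` is a bijection between the two sets: it leaves
the pairs of `p` alone because neither `y` nor `z` is used there. So every free partner of `s` is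
equally likely. -/
lemma card_extensions_insert_eq {p : Finset (α × β)} {s : α}
    {y z : β} (hy : y ∉ p.image Prod.snd) (hz : z ∉ p.image Prod.snd) :
    (extensions (insert (s, y) p)).card = (extensions (insert (s, z) p)).card := by
  have key : ∀ {y z : β}, y ∉ p.image Prod.snd → z ∉ p.image Prod.snd →
      ∀ σ ∈ extensions (insert (s, y) p), σ.trans (Equiv.swap y z) ∈
        extensions (insert (s, z) p) := by
    intro y z hy hz σ hσ
    rw [extensions_insert, Finset.mem_filter, mem_extensions] at hσ ⊢
    refine ⟨fun x hx => ?_, by simp [hσ.2]⟩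
    have h1 : x.2 ≠ y := fun h => hy (h ▸ Finset.mem_image_of_mem _ hx)
    have h2 : x.2 ≠ z := fun h => hz (h ▸ Finset.mem_image_of_mem _ hx)
    simp [hσ.1 x hx, Equiv.swap_apply_of_ne_of_ne h1 h2]
  refine Finset.card_bij' (fun σ _ => σ.trans (Equiv.swap y z))
    (fun σ _ => σ.trans (Equiv.swap z y)) (key hy hz) (key hz hy) ?_ ?_
  · intro σ _
    ext x
    simp [Equiv.swap_comm z y]
  · intro σ _
    ext x
    simp [Equiv.swap_comm z y]

lemma sum_extensions_eq (p : Finset (α × β)) {s : α} (hs : s ∉ p.image Prod.fst)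
    (X : (α ≃ β) → ℝ) :
    ∑ σ ∈ extensions p, X σ =
      ∑ y ∈ Finset.univ \ p.image Prod.snd, ∑ σ ∈ extensions (insert (s, y) p), X σ := by
  rw [← Finset.sum_fiberwise_of_maps_to (s := extensions p)
    (t := Finset.univ \ p.image Prod.snd) (g := fun σ => σ s)]
  · simp_rw [extensions_insert]
  · intro σ hσ
    simpa using apply_notMem_image_snd hσ hs

lemma card_extensions_eq {p : Finset (α × β)} (hp : (extensions p).Nonempty) {s : α}
    (hs : s ∉ p.image Prod.fst) {y : β} (hy : y ∉ p.image Prod.snd) :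
    ((extensions p).card : ℝ) =
      ((Fintype.card β : ℝ) - p.card) * (extensions (insert (s, y) p)).card := by
  have h := sum_extensions_eq p hs (fun _ => 1)
  simp only [Finset.sum_const, nsmul_eq_mul, mul_one] at h
  rw [h, Finset.sum_congr rfl (g := fun _ => ((extensions (insert (s, y) p)).card : ℝ))]
  · rw [Finset.sum_const, nsmul_eq_mul, Finset.card_sdiff_of_subset (Finset.subset_univ _),
      card_image_snd_of_extensions hp, Finset.card_univ, Nat.cast_sub]
    rw [← card_image_snd_of_extensions hp]
    exact Finset.card_le_univ _
  · intro z hz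
    rw [card_extensions_insert_eq (by simpa using hz) hy]

lemma extensions_insert_nonempty {p : Finset (α × β)} (hp : (extensions p).Nonempty) {s : α}
    (hs : s ∉ p.image Prod.fst) {y : β} (hy : y ∉ p.image Prod.snd) :
    (extensions (insert (s, y) p)).Nonempty := by
  have h := card_extensions_eq hp hs hy
  rw [← Finset.card_pos] at hp ⊢
  rcases Nat.eq_zero_or_pos (extensions (insert (s, y) p)).card with h0 | h0
  · rw [h0, Nat.cast_zero, mul_zero] at h
    exact absurd (by exact_mod_cast h) hp.ne'
  · exact h0

/-- Revealing the partner of one more stub. -/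
lemma condMean_eq_average {p : Finset (α × β)} (hp : (extensions p).Nonempty) {s : α}
    (hs : s ∉ p.image Prod.fst) (X : (α ≃ β) → ℝ) :
    condMean p X = (∑ y ∈ Finset.univ \ p.image Prod.snd, condMean (insert (s, y) p) X) /
      ((Fintype.card β : ℝ) - p.card) := by
  rw [condMean, sum_extensions_eq p hs X, Finset.sum_div, Finset.sum_div]
  refine Finset.sum_congr rfl fun y hy => ?_
  rw [card_extensions_eq hp hs (y := y) (by simpa using hy), condMean, div_div, mul_comm]

lemma condMean_mono {p : Finset (α × β)} {X Y : (α ≃ β) → ℝ}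
    (h : ∀ σ ∈ extensions p, X σ ≤ Y σ) : condMean p X ≤ condMean p Y :=
  div_le_div_of_nonneg_right (Finset.sum_le_sum h) (Nat.cast_nonneg _)

lemma condMean_const {p : Finset (α × β)} (hp : (extensions p).Nonempty) (x : ℝ) :
    condMean p (fun _ => x) = x := by
  have : ((extensions p).card : ℝ) ≠ 0 := by
    exact_mod_cast (Finset.card_pos.2 hp).ne'
  simp [condMean, this]

lemma condMean_mul_left (p : Finset (α × β)) (c : ℝ) (X : (α ≃ β) → ℝ) :
    condMean p (fun σ => c * X σ) = c * condMean p X := by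
  simp [condMean, ← Finset.mul_sum, mul_div_assoc]

lemma condMean_sum {ι : Type*} (I : Finset ι) (p : Finset (α × β)) (X : ι → (α ≃ β) → ℝ) :
    condMean p (fun σ => ∑ i ∈ I, X i σ) = ∑ i ∈ I, condMean p (X i) := by
  simp only [condMean]
  rw [Finset.sum_comm, Finset.sum_div]

/-- The nodes at distance at most `j` from `v`, where stubs are joined to stubs by `σ`. -/
def ball (a : α → V) (b : β → V) (σ : α ≃ β) (v : V) : ℕ → Finset V
  | 0 => {v}
  | j + 1 => ball a b σ v j ∪
      (Finset.univ.filter fun s => a s ∈ ball a b σ v j).image fun s => b (σ s)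

lemma ball_mono (a : α → V) (b : β → V) (σ : α ≃ β) (v : V) : Monotone (ball a b σ v) :=
  monotone_nat_of_le_succ fun _ => Finset.subset_union_left

lemma self_mem_ball (a : α → V) (b : β → V) (σ : α ≃ β) (v : V) (j : ℕ) : v ∈ ball a b σ v j :=
  ball_mono a b σ v (Nat.zero_le j) (by simp [ball])

/-- The number of stubs at the node `r`. -/
def stubCount (a : α → V) (r : V) : ℕ := (Finset.univ.filter fun s => a s = r).card

/-- The nodes discovered by revealing the pairs in `p` that are not in `p₀`. -/
def seen (b : β → V) (p₀ : Finset (α × β)) (v : V) (p : Finset (α × β)) : Finset V :=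
  insert v ((p \ p₀).image fun x => b x.2)

/-- The stubs at nodes of `C` that are not matched by `p`. -/
def pending (a : α → V) (p : Finset (α × β)) (C : Finset V) : Finset α :=
  Finset.univ.filter fun s => a s ∈ C ∧ s ∉ p.image Prod.fst

/-- The number of stubs at nodes that have been discovered outside `C`. -/
def nextCount (a : α → V) (b : β → V) (p₀ : Finset (α × β)) (v : V) (p : Finset (α × β))
    (C : Finset V) : ℕ := ∑ r ∈ seen b p₀ v p \ C, stubCount a r

/-- In the breadth-first exploration from `v`, the partial matching `p ⊇ p₀` has been revealed; the
ball of radius `j` is known to be `C`, only stubs in `C` have been matched since `p₀`, and no node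
of `B` has been met. -/
structure Explored (a : α → V) (b : β → V) (p₀ : Finset (α × β)) (B : Finset V) (v : V)
    (p : Finset (α × β)) (C : Finset V) (j : ℕ) : Prop where
  nonempty : (extensions p).Nonempty
  sub : p₀ ⊆ p
  ball_eq : ∀ σ ∈ extensions p, ball a b σ v j = C
  dom_mem : ∀ x ∈ p \ p₀, a x.1 ∈ C
  seen_disjoint : ∀ r ∈ seen b p₀ v p, r ∉ B
  subset_seen : C ⊆ seen b p₀ v p

variable {a : α → V} {b : β → V} {p₀ : Finset (α × β)} {B : Finset V} {v : V}
  {p : Finset (α × β)} {C : Finset V} {j : ℕ}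

lemma explored_start (hp₀ : (extensions p₀).Nonempty) (hv : v ∉ B) :
    Explored a b p₀ B v p₀ {v} 0 where
  nonempty := hp₀
  sub := subset_rfl
  ball_eq _ _ := rfl
  dom_mem := by simp
  seen_disjoint := by simpa [seen] using hv
  subset_seen := by simp [seen]

/-- The earlier matching `p₀` only uses stubs at nodes of `B`, so a start outside `B` has all its
stubs free. -/
lemma card_pending_start (hB : ∀ x ∈ p₀, a x.1 ∈ B) (hv : v ∉ B) :
    (pending a p₀ {v}).card = stubCount a v := by
  unfold pending stubCount
  congr 1
  ext s
  simp only [Finset.mem_filter, Finset.mem_univ, true_and, Finset.mem_singleton,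
    and_iff_left_iff_imp]
  rintro rfl h
  obtain ⟨x, hx, rfl⟩ := Finset.mem_image.1 h
  exact hv (hB x hx)

end Exploration

/-! ### Steps of the search, and the general comparison with a recursion -/

section Exploration

variable {V α β : Type*} [Fintype α] [Fintype β] [DecidableEq V] [DecidableEq α] [DecidableEq β]
variable {a : α → V} {b : β → V} {p₀ : Finset (α × β)} {B : Finset V} {v : V}
  {p : Finset (α × β)} {C : Finset V} {j : ℕ}

lemma seen_insert {s : α} {y : β} (h : (s, y) ∉ p₀) :
    seen b p₀ v (insert (s, y) p) = insert (b y) (seen b p₀ v p) := by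
  unfold seen
  rw [Finset.insert_sdiff_of_notMem _ h, Finset.image_insert, Finset.insert_comm]

lemma Explored.insert_pair (h : Explored a b p₀ B v p C j) {s : α} (hs : s ∈ pending a p C) {y : β}
    (hy : y ∉ p.image Prod.snd) (hyB : b y ∉ B) :
    Explored a b p₀ B v (insert (s, y) p) C j := by
  simp only [pending, Finset.mem_filter, Finset.mem_univ, true_and] at hs
  have hsy : (s, y) ∉ p₀ := fun h' => hs.2 (Finset.mem_image.2 ⟨_, h.sub h', rfl⟩)
  refine ⟨extensions_insert_nonempty h.nonempty hs.2 hy, h.sub.trans (Finset.subset_insert _ _),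
    fun σ hσ => h.ball_eq σ ?_, ?_, ?_, ?_⟩
  · rw [extensions_insert] at hσ
    exact Finset.filter_subset _ _ hσ
  · intro x hx
    rw [Finset.mem_sdiff, Finset.mem_insert] at hx
    rcases hx with ⟨rfl | hx, hx0⟩
    · exact hs.1
    · exact h.dom_mem x (Finset.mem_sdiff.2 ⟨hx, hx0⟩)
  · rw [seen_insert hsy]
    intro r hr
    rcases Finset.mem_insert.1 hr with rfl | hr
    · exact hyB
    · exact h.seen_disjoint r hr
  · rw [seen_insert hsy]
    exact h.subset_seen.trans (Finset.subset_insert _ _)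

lemma card_pending_insert {s : α} (hs : s ∈ pending a p C) (y : β) :
    (pending a p C).card = (pending a (insert (s, y) p) C).card + 1 := by
  rw [← Finset.card_erase_add_one hs]
  congr 2
  ext x
  simp only [pending, Finset.mem_erase, Finset.mem_filter, Finset.mem_univ, true_and,
    Finset.image_insert, Finset.mem_insert]
  tauto

/-- A node that has been seen already brings no new stubs. Cycles inside the explored part are thus
the only deviation from a tree. -/
lemma Explored.nextCount_insert (h : Explored a b p₀ B v p C j) {s : α}
    (hs : s ∈ pending a p C) (y : β) :
    nextCount a b p₀ v (insert (s, y) p) C = nextCount a b p₀ v p C +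
      if b y ∈ seen b p₀ v p then 0 else stubCount a (b y) := by
  simp only [pending, Finset.mem_filter, Finset.mem_univ, true_and] at hs
  have hsy : (s, y) ∉ p₀ := fun h' => hs.2 (Finset.mem_image.2 ⟨_, h.sub h', rfl⟩)
  unfold nextCount
  rw [seen_insert hsy]
  split_ifs with hb
  · rw [Finset.insert_eq_self.2 hb, add_zero]
  · rw [Finset.insert_sdiff_of_notMem _ (fun h' => hb (h.subset_seen h')),
      Finset.sum_insert (fun h' => hb (Finset.mem_sdiff.1 h').1), add_comm]

lemma card_seen_le (p₀ p : Finset (α × β)) :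
    (seen b p₀ v p).card ≤ p.card + 1 :=
  (Finset.card_insert_le _ _).trans (Nat.add_le_add_right
    (Finset.card_image_le.trans (Finset.card_le_card Finset.sdiff_subset)) 1)

lemma mem_image_fst_of_pending_eq_empty (he : pending a p C = ∅) {s : α}
    (hs : a s ∈ C) : s ∈ p.image Prod.fst := by
  by_contra h'
  have : s ∈ pending a p C := Finset.mem_filter.2 ⟨Finset.mem_univ _, hs, h'⟩
  simp [he] at this

lemma Explored.notMem_of_mem (h : Explored a b p₀ B v p C j) {r : V} (hr : r ∈ C) : r ∉ B :=
  h.seen_disjoint r (h.subset_seen hr)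

/-- Once no stub at `C` is pending, every edge leaving the ball of radius `j` is known, so the next
ball consists of all nodes seen. A stub at `C` cannot have been matched by `p₀`, since `C` avoids
`B`. -/
lemma Explored.next (h : Explored a b p₀ B v p C j) (hB : ∀ x ∈ p₀, a x.1 ∈ B)
    (he : pending a p C = ∅) : Explored a b p₀ B v p (seen b p₀ v p) (j + 1) where
  nonempty := h.nonempty
  sub := h.sub
  ball_eq σ hσ := by
    have hball := h.ball_eq σ hσ
    rw [mem_extensions] at hσ
    apply Finset.Subset.antisymm
    · rw [ball, hball]
      refine Finset.union_subset h.subset_seen ?_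
      intro r hr
      obtain ⟨s, hs, rfl⟩ := Finset.mem_image.1 hr
      have hsC : a s ∈ C := by simpa using hs
      obtain ⟨x, hx, rfl⟩ := Finset.mem_image.1 (mem_image_fst_of_pending_eq_empty he hsC)
      refine Finset.mem_insert_of_mem (Finset.mem_image.2 ⟨x, Finset.mem_sdiff.2 ⟨hx, ?_⟩, ?_⟩)
      · exact fun hx0 => h.notMem_of_mem hsC (hB x hx0)
      · rw [hσ x hx]
    · intro r hr
      rcases Finset.mem_insert.1 hr with rfl | hr
      · exact self_mem_ball _ _ _ _ _
      · obtain ⟨x, hx, rfl⟩ := Finset.mem_image.1 hr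
        rw [ball]
        refine Finset.mem_union_right _ (Finset.mem_image.2 ⟨x.1, ?_, ?_⟩)
        · simpa [hball] using h.dom_mem x hx
        · rw [hσ x (Finset.mem_sdiff.1 hx).1]
  dom_mem x hx := h.subset_seen (h.dom_mem x hx)
  seen_disjoint := h.seen_disjoint
  subset_seen := subset_rfl

/-- The stubs at newly found nodes are all free: `p₀` matches only stubs at `B`, and the search has
matched only stubs at `C`. Hence the count of the coming generation becomes the count of pending
stubs. -/
lemma Explored.card_pending_next (h : Explored a b p₀ B v p C j) (hB : ∀ x ∈ p₀, a x.1 ∈ B)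
    (he : pending a p C = ∅) :
    (pending a p (seen b p₀ v p)).card = nextCount a b p₀ v p C := by
  have : pending a p (seen b p₀ v p) =
      Finset.univ.filter fun s => a s ∈ seen b p₀ v p \ C := by
    ext s
    simp only [pending, Finset.mem_filter, Finset.mem_univ, true_and, Finset.mem_sdiff]
    refine and_congr_right fun hs =>
      ⟨fun h1 h2 => h1 (mem_image_fst_of_pending_eq_empty he h2), fun h1 h2 => ?_⟩
    obtain ⟨x, hx, rfl⟩ := Finset.mem_image.1 h2
    by_cases hx0 : x ∈ p₀
    · exact h.seen_disjoint _ hs (hB x hx0)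
    · exact h1 (h.dom_mem x (Finset.mem_sdiff.2 ⟨hx, hx0⟩))
  rw [this, nextCount, Finset.card_eq_sum_card_fiberwise (f := a) (t := seen b p₀ v p \ C)]
  · refine Finset.sum_congr rfl fun r hr => ?_
    unfold stubCount
    congr 1
    ext s
    simp only [Finset.mem_filter, Finset.mem_univ, true_and, and_iff_right_iff_imp]
    rintro rfl
    exact hr
  · intro s hs
    simpa using hs

lemma nextCount_of_seen_subset (h : seen b p₀ v p ⊆ C) : nextCount a b p₀ v p C = 0 := by
  simp [nextCount, Finset.sdiff_eq_empty_iff_subset.2 h]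

lemma condMean_le_one {X : (α ≃ β) → ℝ} (hX : ∀ σ, X σ ≤ 1) (p : Finset (α × β)) :
    condMean p X ≤ 1 := by
  rcases (extensions p).eq_empty_or_nonempty with h | h
  · simp [condMean, h]
  · exact (condMean_mono fun σ _ => hX σ).trans_eq (condMean_const h 1)

lemma condMean_nonneg {X : (α ≃ β) → ℝ} (hX : ∀ σ, 0 ≤ X σ) (p : Finset (α × β)) :
    0 ≤ condMean p X :=
  div_nonneg (Finset.sum_nonneg fun σ _ => hX σ) (Nat.cast_nonneg _)

/-- The size of the next generation grows by `ξ` when the stub `y` is met. -/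
def gain (a : α → V) (b : β → V) (p₀ : Finset (α × β)) (v : V) (p : Finset (α × β)) (y : β) : ℕ :=
  if b y ∈ seen b p₀ v p then 0 else stubCount a (b y)

/-- Comparison of an exploration with a branching process: if the function `w` satisfies the
recursion of the branching process up to one-step errors `disc`, then it approximates the
conditional means of `X`. Upper and lower bounds are covered by the two signs `ς`. -/
theorem exploration_bound {ς : ℝ} (hς : ς = 1 ∨ ς = -1) {X : (α ≃ β) → ℝ}
    (hX0 : ∀ σ, 0 ≤ X σ) (hX1 : ∀ σ, X σ ≤ 1) {w : ℕ → ℕ → ℕ → ℝ}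
    (hw0 : ∀ g k c, 0 ≤ w g k c) (hw1 : ∀ g k c, w g k c ≤ 1)
    (hswitch : ∀ g c, w (g + 1) 0 c = w g c 0) {G : ℕ} {e disc : ℕ → ℝ} {t err mbar : ℝ}
    (he0 : ∀ g, 0 ≤ e g) (ht : 0 < t) (herr : 0 ≤ err) (htN : t ≤ Fintype.card β)
    (hB : ∀ x ∈ p₀, a x.1 ∈ B) (hp₀ : (extensions p₀).Nonempty) (hv : v ∉ B)
    (hkill : ∀ σ ∈ extensions p₀, (∃ r ∈ ball a b σ v G, r ∈ B) → 0 ≤ ς * X σ)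
    (hstep : ∀ g k c p C j, g < G → Explored a b p₀ B v p C j → (p.card : ℝ) < t →
      |(∑ y ∈ Finset.univ \ p.image Prod.snd,
          if b y ∈ B then 0 else w (g + 1) k (c + gain a b p₀ v p y)) /
            ((Fintype.card β : ℝ) - p.card) - w (g + 1) (k + 1) c| ≤ disc g)
    (hmean : ∀ p C j, Explored a b p₀ B v p C j → (p.card : ℝ) < t →
      (∑ y ∈ Finset.univ \ p.image Prod.snd, (gain a b p₀ v p y : ℝ)) /
            ((Fintype.card β : ℝ) - p.card) ≤ mbar)
    (he : ∀ g, disc g + mbar * e g + 1 / t ≤ e (g + 1))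
    (hterm : ∀ p C, Explored a b p₀ B v p C G → seen b p₀ v p = C →
      ς * w 0 (pending a p C).card 0 ≤
        ς * condMean p X + e 0 * (pending a p C).card + p.card / t + err) :
    ς * w G (stubCount a v) 0 ≤
      ς * condMean p₀ X + e G * stubCount a v + p₀.card / t + err := by
  -- Both quantities lie in `[0, 1]`; this suffices as soon as the error term has reached `1`.
  have trivial_bound : ∀ (p : Finset (α × β)) g k c, ς * w g k c ≤ ς * condMean p X + 1 := by
    intro p g k c
    have h1 := condMean_le_one hX1 p
    have h2 := condMean_nonneg hX0 p
    have h3 := hw0 g k c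
    have h4 := hw1 g k c
    rcases hς with rfl | rfl <;> linarith
  -- Outer induction on the number `g` of generations still to be explored; `seen = C` says that a
  -- new generation is about to start.
  have main : ∀ g p C j, j + g = G → Explored a b p₀ B v p C j → seen b p₀ v p = C →
      ς * w g (pending a p C).card 0 ≤
        ς * condMean p X + e g * (pending a p C).card + p.card / t + err := by
    intro g
    induction g with
    | zero =>
      intro p C j hj h hs
      obtain rfl : j = G := by omega
      exact hterm p C h hs
    | succ g ih =>
      have claim : ∀ k p C j, j + (g + 1) = G → Explored a b p₀ B v p C j →
          (pending a p C).card = k →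
          ς * w (g + 1) k (nextCount a b p₀ v p C) ≤ ς * condMean p X + e (g + 1) * k +
            e g * nextCount a b p₀ v p C + p.card / t + err := by
        intro k
        induction k with
        | zero =>
          intro p C j hj h hk
          have hk0 : pending a p C = ∅ := Finset.card_eq_zero.1 hk
          have := ih p _ (j + 1) (by omega) (h.next hB hk0) rfl
          rw [h.card_pending_next hB hk0] at this
          rw [hswitch]
          simpa using this
        | succ k ihk =>
          intro p C j hj h hk
          set c := nextCount a b p₀ v p C with hc
          -- A search that has matched `t` pairs is given up, since then `p.card / t ≥ 1` makes the
          -- bound trivial. This replaces a Markov inequality for the size of the search; each step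
          -- pays `1 / t` for it.
          rcases le_or_gt t (p.card : ℝ) with hpt | hpt
          · have h1 := trivial_bound p (g + 1) (k + 1) c
            have h2 : 1 ≤ (p.card : ℝ) / t := (one_le_div ht).2 hpt
            have h3 := mul_nonneg (he0 (g + 1)) (Nat.cast_nonneg (α := ℝ) (k + 1))
            have h4 := mul_nonneg (he0 g) (Nat.cast_nonneg (α := ℝ) c)
            linarith
          obtain ⟨s, hs⟩ : (pending a p C).Nonempty := by
            rw [← Finset.card_pos, hk]; omega
          have hs' : a s ∈ C ∧ s ∉ p.image Prod.fst := by
            simpa only [pending, Finset.mem_filter, Finset.mem_univ, true_and] using hs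
          set M : ℝ := (Fintype.card β : ℝ) - p.card with hM
          have hMpos : 0 < M := by rw [hM]; linarith
          have hcard : ((Finset.univ \ p.image Prod.snd).card : ℝ) = M := by
            rw [Finset.card_sdiff_of_subset (Finset.subset_univ _),
              card_image_snd_of_extensions h.nonempty, Finset.card_univ, Nat.cast_sub]
            rw [← card_image_snd_of_extensions h.nonempty]
            exact Finset.card_le_univ _
          have hone := h.nonempty
          have hst := hstep g k c p C j (by omega) h hpt
          have hme := hmean p C j h hpt
          have hterms : ∀ y ∈ Finset.univ \ p.image Prod.snd,
              ς * (if b y ∈ B then 0 else w (g + 1) k (c + gain a b p₀ v p y)) ≤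
                ς * condMean (insert (s, y) p) X + (e (g + 1) * k + e g * c + (p.card + 1) / t + err)
                  + e g * gain a b p₀ v p y := by
            intro y hy
            have hy' : y ∉ p.image Prod.snd := by simpa using hy
            have hn1 := mul_nonneg (he0 (g + 1)) (Nat.cast_nonneg (α := ℝ) k)
            have hn2 := mul_nonneg (he0 g) (Nat.cast_nonneg (α := ℝ) c)
            have hn3 := mul_nonneg (he0 g) (Nat.cast_nonneg (α := ℝ) (gain a b p₀ v p y))
            have hn4 : 0 ≤ ((p.card : ℝ) + 1) / t := by positivity
            split_ifs with hyB
            -- A partner at a node of `B` puts that node into the ball of radius `j + 1 ≤ G`, so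
            -- `hkill` applies to all matchings that extend the new one.
            · have : 0 ≤ ς * condMean (insert (s, y) p) X := by
                rw [← condMean_mul_left]
                refine (condMean_const (extensions_insert_nonempty h.nonempty hs'.2 hy') 0).symm.le.trans
                  (condMean_mono fun σ hσ => ?_)
                rw [extensions_insert, Finset.mem_filter] at hσ
                refine hkill σ ?_ ⟨b y, ?_, hyB⟩
                · have := hσ.1
                  rw [mem_extensions] at this ⊢
                  exact fun x hx => this x (h.sub hx)
                · refine ball_mono a b σ v (show j + 1 ≤ G by omega) ?_
                  rw [ball, h.ball_eq σ hσ.1]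
                  refine Finset.mem_union_right _ (Finset.mem_image.2 ⟨s, by simpa using hs'.1, ?_⟩)
                  rw [hσ.2]
              simp only [mul_zero]
              linarith
            · have := ihk _ C j hj (h.insert_pair hs hy' hyB)
                (by have := card_pending_insert hs y; omega)
              rw [h.nextCount_insert hs y, Finset.card_insert_of_notMem] at this
              · rw [← hc] at this
                simp only [gain] at *
                push_cast at this ⊢
                linarith
              · exact fun h' => hs'.2 (Finset.mem_image.2 ⟨_, h', rfl⟩)
          have hsum := Finset.sum_le_sum hterms
          rw [Finset.sum_add_distrib, Finset.sum_add_distrib, ← Finset.mul_sum, ← Finset.mul_sum,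
            ← Finset.mul_sum, Finset.sum_const, nsmul_eq_mul, hcard] at hsum
          rw [condMean_eq_average h.nonempty hs'.2 X, ← hM]
          set S1 := ∑ y ∈ Finset.univ \ p.image Prod.snd,
            (if b y ∈ B then 0 else w (g + 1) k (c + gain a b p₀ v p y)) with hS1
          set S2 := ∑ y ∈ Finset.univ \ p.image Prod.snd, condMean (insert (s, y) p) X with hS2
          set S3 := ∑ y ∈ Finset.univ \ p.image Prod.snd, (gain a b p₀ v p y : ℝ) with hS3
          have hdiv : ς * (S1 / M) ≤ ς * (S2 / M) +
              (e (g + 1) * k + e g * c + (p.card + 1) / t + err) + e g * (S3 / M) := by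
            have := div_le_div_of_nonneg_right hsum hMpos.le
            rw [add_div, add_div, mul_div_cancel_left₀ _ hMpos.ne', mul_div_assoc, mul_div_assoc,
              mul_div_assoc] at this
            exact this
          have hd : ς * w (g + 1) (k + 1) c ≤ ς * (S1 / M) + disc g := by
            rw [abs_le] at hst
            rcases hς with rfl | rfl <;> linarith [hst.1, hst.2]
          have hm := mul_le_mul_of_nonneg_left hme (he0 g)
          have heg := he g
          have : ((p.card : ℝ) + 1) / t = p.card / t + 1 / t := add_div _ _ _
          push_cast
          rw [this] at hdiv
          linarith
      intro p C j hj h hs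
      have := claim _ p C j hj h rfl
      rw [nextCount_of_seen_subset hs.subset] at this
      simpa using this
  have := main G p₀ {v} 0 (by omega) (explored_start hp₀ hv) (by simp [seen])
  rwa [card_pending_start hB hv] at this

end Exploration

/-! ### Generating functions and the recursion with killing -/

section GenFun

/-- The probability generating function. -/
noncomputable def genFun (f : PMF ℕ) (q : ℝ) : ℝ := ∑' j, (f j).toReal * q ^ j

variable {f : PMF ℕ} {μ q r : ℝ}

lemma hasSum_toReal (f : PMF ℕ) : HasSum (fun j => (f j).toReal) 1 := by
  have h := f.tsum_coe
  have hs : Summable fun j => (f j).toReal :=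
    ENNReal.summable_toReal (by rw [h]; exact ENNReal.one_ne_top)
  have := ENNReal.tsum_toReal_eq (f := fun j => f j) fun j => f.apply_ne_top j
  rw [h, ENNReal.toReal_one] at this
  rw [this]
  exact hs.hasSum

lemma hasSum_mean (hμ : 0 ≤ μ) (hf : pmfMean f = ENNReal.ofReal μ) :
    HasSum (fun j => (f j).toReal * (j : ℝ)) μ := by
  have hs : Summable fun j : ℕ => ((j : ℝ≥0∞) * f j).toReal :=
    ENNReal.summable_toReal (by change pmfMean f ≠ _; rw [hf]; exact ENNReal.ofReal_ne_top)
  have h := ENNReal.tsum_toReal_eq (f := fun j : ℕ => (j : ℝ≥0∞) * f j)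
    fun j => ENNReal.mul_ne_top (by simp) (f.apply_ne_top j)
  have h2 : (pmfMean f).toReal = μ := by rw [hf, ENNReal.toReal_ofReal hμ]
  rw [pmfMean, h] at h2
  have := hs.hasSum
  rw [h2] at this
  simpa [mul_comm] using this

lemma summable_genFun (f : PMF ℕ) (h0 : 0 ≤ q) (h1 : q ≤ 1) :
    Summable fun j => (f j).toReal * q ^ j :=
  Summable.of_nonneg_of_le (fun j => mul_nonneg ENNReal.toReal_nonneg (pow_nonneg h0 j))
    (fun j => mul_le_of_le_one_right ENNReal.toReal_nonneg (pow_le_one₀ h0 h1))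
    (hasSum_toReal f).summable

lemma genFun_nonneg (f : PMF ℕ) (h0 : 0 ≤ q) : 0 ≤ genFun f q :=
  tsum_nonneg fun j => mul_nonneg ENNReal.toReal_nonneg (pow_nonneg h0 j)

lemma genFun_one (f : PMF ℕ) : genFun f 1 = 1 := by
  simpa [genFun] using (hasSum_toReal f).tsum_eq

lemma genFun_mono (f : PMF ℕ) (h0 : 0 ≤ q) (hqr : q ≤ r) (h1 : r ≤ 1) :
    genFun f q ≤ genFun f r :=
  (summable_genFun f h0 (hqr.trans h1)).tsum_le_tsum
    (fun j => mul_le_mul_of_nonneg_left (pow_le_pow_left₀ h0 hqr j) ENNReal.toReal_nonneg)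
    (summable_genFun f (h0.trans hqr) h1)

lemma genFun_le_one (f : PMF ℕ) (h0 : 0 ≤ q) (h1 : q ≤ 1) : genFun f q ≤ 1 :=
  (genFun_mono f h0 h1 le_rfl).trans_eq (genFun_one f)

lemma pow_sub_pow_le (h0 : 0 ≤ q) (hqr : q ≤ r) (h1 : r ≤ 1) (j : ℕ) :
    r ^ j - q ^ j ≤ j * (r - q) := by
  induction j with
  | zero => simp
  | succ j ih =>
    have h2 : r ^ (j + 1) - q ^ (j + 1) = r * (r ^ j - q ^ j) + (r - q) * q ^ j := by ring
    have h3 : 0 ≤ r ^ j - q ^ j := sub_nonneg.2 (pow_le_pow_left₀ h0 hqr j)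
    have h4 : q ^ j ≤ 1 := pow_le_one₀ h0 (hqr.trans h1)
    rw [h2]
    push_cast
    nlinarith [sub_nonneg.2 hqr]

lemma genFun_sub_le (hμ : 0 ≤ μ) (hf : pmfMean f = ENNReal.ofReal μ) (h0 : 0 ≤ q) (hqr : q ≤ r)
    (h1 : r ≤ 1) : genFun f r - genFun f q ≤ μ * (r - q) := by
  unfold genFun
  rw [← (summable_genFun f (h0.trans hqr) h1).tsum_sub (summable_genFun f h0 (hqr.trans h1))]
  have hm := (hasSum_mean hμ hf).mul_right (r - q)
  rw [← hm.tsum_eq]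
  refine Summable.tsum_le_tsum (fun j => ?_) ((summable_genFun f (h0.trans hqr) h1).sub
    (summable_genFun f h0 (hqr.trans h1))) hm.summable
  rw [← mul_sub, mul_assoc]
  exact mul_le_mul_of_nonneg_left (pow_sub_pow_le h0 hqr h1 j) ENNReal.toReal_nonneg

lemma abs_genFun_sub_le (hμ : 0 ≤ μ) (hf : pmfMean f = ENNReal.ofReal μ)
    (hq : q ∈ Set.Icc (0 : ℝ) 1) (hr : r ∈ Set.Icc (0 : ℝ) 1) :
    |genFun f q - genFun f r| ≤ μ * |q - r| := by
  rcases le_total q r with h | h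
  · rw [abs_sub_comm, abs_sub_comm q, abs_of_nonneg (sub_nonneg.2 h),
      abs_of_nonneg (sub_nonneg.2 (genFun_mono f hq.1 h hr.2))]
    exact genFun_sub_le hμ hf hq.1 h hr.2
  · rw [abs_of_nonneg (sub_nonneg.2 h),
      abs_of_nonneg (sub_nonneg.2 (genFun_mono f hr.1 h hq.2))]
    exact genFun_sub_le hμ hf hr.1 h hq.2

lemma one_sub_genFun_le (hμ : 0 ≤ μ) (hf : pmfMean f = ENNReal.ofReal μ)
    (hq : q ∈ Set.Icc (0 : ℝ) 1) : 1 - genFun f q ≤ μ * (1 - q) := by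
  simpa [genFun_one] using genFun_sub_le hμ hf hq.1 hq.2 le_rfl

/-- One generation backwards in the recursion for the joint transform of the generation size and
the total progeny. -/
noncomputable def genStep (f : PMF ℕ) (s q : ℝ) : ℝ := Real.exp (-s) * genFun f q

lemma genStep_mem (f : PMF ℕ) {s : ℝ} (hs : 0 ≤ s) (hq : q ∈ Set.Icc (0 : ℝ) 1) :
    genStep f s q ∈ Set.Icc (0 : ℝ) 1 :=
  ⟨mul_nonneg (Real.exp_nonneg _) (genFun_nonneg f hq.1),
    mul_le_one₀ (Real.exp_le_one_iff.2 (by linarith)) (genFun_nonneg f hq.1)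
      (genFun_le_one f hq.1 hq.2)⟩

lemma genStep_iterate_mem (f : PMF ℕ) {s : ℝ} (hs : 0 ≤ s) (hq : q ∈ Set.Icc (0 : ℝ) 1) (g : ℕ) :
    (genStep f s)^[g] q ∈ Set.Icc (0 : ℝ) 1 := by
  induction g with
  | zero => exact hq
  | succ g ih => rw [Function.iterate_succ_apply']; exact genStep_mem f hs ih

lemma one_sub_genStep_le (hμ : 0 ≤ μ) (hf : pmfMean f = ENNReal.ofReal μ) {s : ℝ} (hs : 0 ≤ s)
    (hq : q ∈ Set.Icc (0 : ℝ) 1) :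
    1 - genStep f s q ≤ s + μ * (1 - q) := by
  have h1 := one_sub_genFun_le hμ hf hq
  have h2 := Real.add_one_le_exp (-s)
  have h3 := genFun_nonneg f hq.1
  have h4 := genFun_le_one f hq.1 hq.2
  unfold genStep
  nlinarith

/-- The defect `x = 1 - q` satisfies `x_{g+1} ≤ s + μ x_g`; solving this linear recursion gives a
geometric sum. -/
lemma one_sub_genStep_iterate_le (hμ : 1 < μ) (hf : pmfMean f = ENNReal.ofReal μ) {s : ℝ}
    (hs : 0 ≤ s) (hq : q ∈ Set.Icc (0 : ℝ) 1) (g : ℕ) :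
    1 - (genStep f s)^[g] q ≤ μ ^ g * ((1 - q) + s / (μ - 1)) := by
  -- The exact solution of the recursion is needed for the induction to close.
  suffices h : 1 - (genStep f s)^[g] q ≤ μ ^ g * (1 - q) + s * ((μ ^ g - 1) / (μ - 1)) by
    refine h.trans ?_
    have h1 : 0 < μ - 1 := by linarith
    have h2 : s * ((μ ^ g - 1) / (μ - 1)) = μ ^ g * (s / (μ - 1)) - s / (μ - 1) := by
      field_simp
    have h3 : 0 ≤ s / (μ - 1) := by positivity
    rw [h2]
    linarith
  induction g with
  | zero => simp
  | succ g ih =>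
    rw [Function.iterate_succ_apply']
    have h1 := one_sub_genStep_le (by linarith : (0 : ℝ) ≤ μ) hf hs
      (genStep_iterate_mem f hs hq g)
    have h2 : s + μ * (s * ((μ ^ g - 1) / (μ - 1))) = s * ((μ ^ (g + 1) - 1) / (μ - 1)) := by
      have : μ - 1 ≠ 0 := by linarith
      field_simp
      ring
    have h3 := mul_le_mul_of_nonneg_left ih (by linarith : (0 : ℝ) ≤ μ)
    rw [pow_succ] at *
    nlinarith

end GenFun

/-! ### One revealed half-edge: the error against the branching recursion -/

section Phase

variable {V α β : Type*} [Fintype α] [Fintype β] [DecidableEq V] [DecidableEq α] [DecidableEq β]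

/-- The stubs `β` are attached to nodes in such a way that the number of stubs `α` found at the node
of a uniformly chosen stub of `β` has nearly the law `f`, and few nodes carry a small part of the
mass only. -/
structure NearLaw (a : α → V) (b : β → V) (f : PMF ℕ) (μ δ t : ℝ) : Prop where
  delta_nonneg : 0 ≤ δ
  delta_le : δ ≤ 1 / 2
  t_pos : 0 < t
  t_le : t ≤ δ * Fintype.card β
  gen : ∀ q ∈ Set.Icc (0 : ℝ) 1,
    |∑ y : β, q ^ stubCount a (b y) - Fintype.card β * genFun f q| ≤ δ * (1 - q) * Fintype.card β
  mean : ∑ y : β, (stubCount a (b y) : ℝ) ≤ (μ + δ) * Fintype.card β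
  light : ∀ Q : Finset V, (Q.card : ℝ) ≤ t + 2 →
    ∑ y ∈ Finset.univ.filter (fun y => b y ∈ Q), (stubCount a (b y) : ℝ) ≤ δ * Fintype.card β

variable {a : α → V} {b : β → V} {p₀ : Finset (α × β)} {B : Finset V} {v : V}
  {p : Finset (α × β)} {C : Finset V} {j : ℕ} {f : PMF ℕ} {μ δ t : ℝ}

/-- The number of unmatched stubs of `β` at nodes of `B`. -/
def hitCount (b : β → V) (p₀ : Finset (α × β)) (B : Finset V) : ℕ :=
  (Finset.univ.filter fun y => b y ∈ B ∧ y ∉ p₀.image Prod.snd).card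

lemma one_sub_pow_le' {q : ℝ} (h0 : 0 ≤ q) (h1 : q ≤ 1) (j : ℕ) : 1 - q ^ j ≤ j * (1 - q) := by
  simpa using pow_sub_pow_le h0 h1 le_rfl j

/-- The arithmetic behind `NearLaw.abs_step_le`. There `N` counts all stubs and `M` the free ones,
`F = genFun f q`, `x = 1 - q`, `g = exp(-s) F`. The defect `M - S` consists of the hits `s N` and
the part `T` due to new nodes. Replacing `M` by `N` costs a relative error of order `δ`. -/
lemma abs_div_sub_le_of_bounds {μ M N x s δ F S T g : ℝ} (hμ : 1 < μ) (hM : 0 < M) (hx : 0 ≤ x)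
    (hs : 0 ≤ s) (hδ : 0 ≤ δ) (hF1 : F ≤ 1) (hF2 : 1 - F ≤ μ * x) (hNM : N * (1 - δ) ≤ M)
    (hMN : M ≤ N) (hδ2 : δ ≤ 1 / 2) (hS : S = M - s * N - T) (hTu : T ≤ N * (1 - F) + δ * N * x)
    (hTl : N * (1 - F) - 2 * (δ * N * x) ≤ T) (hg1 : 1 - g ≤ s + (1 - F))
    (hg2 : s + (1 - F) - δ * s - δ * (μ * x) ≤ 1 - g) :
    |S / M - g| ≤ (3 * μ + 4) * δ * (s + x) := by
  have hN2 : N ≤ 2 * M := by nlinarith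
  have hN3 : N ≤ M + 2 * δ * M := by nlinarith
  have hδx : 0 ≤ δ * x := mul_nonneg hδ hx
  have h1 := mul_le_mul_of_nonneg_left hg1 hM.le
  have h2 := mul_le_mul_of_nonneg_left hg2 hM.le
  have h3 : δ * x * N ≤ δ * x * (2 * M) := mul_le_mul_of_nonneg_left hN2 hδx
  have h4 : s * N ≤ s * (M + 2 * δ * M) := mul_le_mul_of_nonneg_left hN3 hs
  have h5 : (1 - F) * N ≤ (1 - F) * (M + 2 * δ * M) :=
    mul_le_mul_of_nonneg_left hN3 (by linarith)
  have h6 : (1 - F) * (δ * M) ≤ μ * x * (δ * M) :=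
    mul_le_mul_of_nonneg_right hF2 (mul_nonneg hδ hM.le)
  have h7 : s * M ≤ s * N := mul_le_mul_of_nonneg_left hMN hs
  have h8 : (1 - F) * M ≤ (1 - F) * N := mul_le_mul_of_nonneg_left hMN (by linarith)
  have z1 : 0 ≤ δ * s * M := mul_nonneg (mul_nonneg hδ hs) hM.le
  have z2 : 0 ≤ δ * x * M := mul_nonneg hδx hM.le
  have z3 : 0 ≤ μ * (δ * s * M) := mul_nonneg (by linarith) z1
  have z4 : 0 ≤ μ * (δ * x * M) := mul_nonneg (by linarith) z2
  rw [div_sub' hM.ne', abs_div, abs_of_pos hM, div_le_iff₀ hM, abs_le]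
  constructor <;> linarith

lemma NearLaw.card_pos (h : NearLaw a b f μ δ t) : (0 : ℝ) < Fintype.card β := by
  rcases (Nat.cast_nonneg (α := ℝ) (Fintype.card β)).eq_or_lt with h0 | h0
  · have := h.t_le
    rw [← h0, mul_zero] at this
    linarith [h.t_pos]
  · exact h0

lemma card_sdiff_image_snd (hp : (extensions p).Nonempty) :
    (((Finset.univ \ p.image Prod.snd).card : ℕ) : ℝ) = (Fintype.card β : ℝ) - p.card := by
  rw [Finset.card_sdiff_of_subset (Finset.subset_univ _),
    card_image_snd_of_extensions hp, Finset.card_univ, Nat.cast_sub]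
  rw [← card_image_snd_of_extensions hp]
  exact Finset.card_le_univ _

lemma NearLaw.mean_gain_le (h : NearLaw a b f μ δ t) (hμ : 1 < μ) (hpt : (p.card : ℝ) < t) :
    (∑ y ∈ Finset.univ \ p.image Prod.snd, (gain a b p₀ v p y : ℝ)) /
      ((Fintype.card β : ℝ) - p.card) ≤ μ + (3 * μ + 4) * δ := by
  have hN := h.card_pos
  have hd := h.delta_nonneg
  have hd2 := h.delta_le
  have ht := h.t_le
  have hM : 0 < (Fintype.card β : ℝ) - p.card := by nlinarith
  rw [div_le_iff₀ hM]
  have h1 : ∑ y ∈ Finset.univ \ p.image Prod.snd, (gain a b p₀ v p y : ℝ) ≤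
      ∑ y : β, (stubCount a (b y) : ℝ) := by
    refine (Finset.sum_le_sum (g := fun y => (stubCount a (b y) : ℝ)) fun y _ => ?_).trans
      (Finset.sum_le_sum_of_subset_of_nonneg (Finset.subset_univ _) fun _ _ _ => Nat.cast_nonneg _)
    unfold gain
    split_ifs <;> simp
  refine h1.trans (h.mean.trans ?_)
  have h3 : (1 - δ) * Fintype.card β ≤ (Fintype.card β : ℝ) - p.card := by linarith
  have h4 : (μ + δ) * Fintype.card β ≤ (μ + (3 * μ + 4) * δ) * ((1 - δ) * Fintype.card β) := by
    rw [← mul_assoc]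
    refine mul_le_mul_of_nonneg_right ?_ hN.le
    nlinarith [mul_nonneg hd (by linarith : 0 ≤ μ), mul_nonneg hd (by linarith : 0 ≤ 1 / 2 - δ),
      mul_nonneg (mul_nonneg hd (by linarith : 0 ≤ μ)) (by linarith : 0 ≤ 1 / 2 - δ)]
  refine h4.trans (mul_le_mul_of_nonneg_left h3 ?_)
  nlinarith [mul_nonneg hd (by linarith : 0 ≤ μ)]

/-- The one-step estimate: the conditional transform of the number of new stubs, on the event that
no node of `B` is met, given the explored part of the graph. -/
lemma NearLaw.abs_step_le (h : NearLaw a b f μ δ t) (hμ : 1 < μ)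
    (hf : pmfMean f = ENNReal.ofReal μ) (hE : Explored a b p₀ B v p C j)
    (hB2 : ∀ x ∈ p₀, b x.2 ∈ B) (hBcard : B.card ≤ p₀.card + 1) (hpt : (p.card : ℝ) < t)
    {s : ℝ} (hs : s * Fintype.card β = hitCount b p₀ B) (hsδ : s ≤ δ)
    {q : ℝ} (hq : q ∈ Set.Icc (0 : ℝ) 1) :
    |(∑ y ∈ Finset.univ \ p.image Prod.snd, if b y ∈ B then 0 else q ^ gain a b p₀ v p y) /
      ((Fintype.card β : ℝ) - p.card) - genStep f s q| ≤ (3 * μ + 4) * δ * (s + (1 - q)) := by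
  have hN := h.card_pos
  have hd := h.delta_nonneg
  have hd2 := h.delta_le
  have ht := h.t_le
  have hs0 : 0 ≤ s := by
    have : 0 ≤ s * Fintype.card β := hs ▸ Nat.cast_nonneg _
    exact nonneg_of_mul_nonneg_left this hN
  set N : ℝ := (Fintype.card β : ℝ) with hNdef
  set M : ℝ := N - p.card with hM
  have hMpos : 0 < M := by nlinarith
  set x := 1 - q with hx
  have hx0 : 0 ≤ x := by linarith [hq.2]
  set F := genFun f q with hF
  have hF1 : F ≤ 1 := genFun_le_one f hq.1 hq.2
  have hF2 : 1 - F ≤ μ * x := one_sub_genFun_le (by linarith) hf hq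
  -- the complementary sum
  set S := ∑ y ∈ Finset.univ \ p.image Prod.snd, (if b y ∈ B then 0 else q ^ gain a b p₀ v p y)
    with hS
  have hcomp : M - S = ∑ y ∈ Finset.univ \ p.image Prod.snd,
      (if b y ∈ B then 1 else 1 - q ^ gain a b p₀ v p y) := by
    rw [hM, ← card_sdiff_image_snd hE.nonempty, Finset.cast_card, hS, ← Finset.sum_sub_distrib]
    refine Finset.sum_congr rfl fun y _ => ?_
    split_ifs <;> simp
  have hran : ∀ y ∈ p.image Prod.snd, b y ∈ B ∪ seen b p₀ v p := by
    intro y hy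
    obtain ⟨z, hz, rfl⟩ := Finset.mem_image.1 hy
    rw [Finset.mem_union]
    by_cases hz0 : z ∈ p₀
    · exact Or.inl (hB2 z hz0)
    · exact Or.inr (Finset.mem_insert_of_mem
        (Finset.mem_image_of_mem _ (Finset.mem_sdiff.2 ⟨hz, hz0⟩)))
  set Q := B ∪ seen b p₀ v p with hQ
  have hsplit : ∑ y ∈ Finset.univ \ p.image Prod.snd,
      (if b y ∈ B then (1 : ℝ) else 1 - q ^ gain a b p₀ v p y) =
      hitCount b p₀ B + ∑ y ∈ Finset.univ.filter (fun y => b y ∉ Q),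
        (1 - q ^ stubCount a (b y)) := by
    have e1 : (hitCount b p₀ B : ℝ) =
        ∑ y ∈ Finset.univ \ p.image Prod.snd, if b y ∈ B then (1 : ℝ) else 0 := by
      rw [Finset.sum_boole, hitCount]
      congr 2
      ext y
      simp only [Finset.mem_filter, Finset.mem_univ, true_and, Finset.mem_sdiff]
      refine ⟨fun ⟨h1, h2⟩ => ⟨fun h3 => ?_, h1⟩, fun ⟨h1, h2⟩ => ⟨h2, fun h3 => h1
        (Finset.image_subset_image hE.sub h3)⟩⟩
      obtain ⟨z, hz, rfl⟩ := Finset.mem_image.1 h3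
      by_cases hz0 : z ∈ p₀
      · exact h2 (Finset.mem_image_of_mem _ hz0)
      · exact hE.seen_disjoint _ (Finset.mem_insert_of_mem
          (Finset.mem_image_of_mem _ (Finset.mem_sdiff.2 ⟨hz, hz0⟩))) h1
    have e2 : ∑ y ∈ Finset.univ.filter (fun y => b y ∉ Q), (1 - q ^ stubCount a (b y)) =
        ∑ y ∈ Finset.univ \ p.image Prod.snd,
          if b y ∈ Q then (0 : ℝ) else 1 - q ^ stubCount a (b y) := by
      rw [Finset.sum_filter]
      symm
      simp_rw [ite_not]
      refine Finset.sum_subset (Finset.subset_univ _) fun y _ hy => ?_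
      have : y ∈ p.image Prod.snd := by
        simpa only [Finset.mem_sdiff, Finset.mem_univ, true_and, not_not] using hy
      rw [if_pos (hran y this)]
    rw [e1, e2, ← Finset.sum_add_distrib]
    refine Finset.sum_congr rfl fun y _ => ?_
    by_cases h1 : b y ∈ B
    · simp [h1, hQ]
    · by_cases h2 : b y ∈ seen b p₀ v p
      · simp [h1, h2, hQ, gain]
      · simp [h1, h2, hQ, gain]
  have hall : ∑ y : β, (1 - q ^ stubCount a (b y)) =
      ∑ y ∈ Finset.univ.filter (fun y => b y ∈ Q), (1 - q ^ stubCount a (b y)) +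
      ∑ y ∈ Finset.univ.filter (fun y => b y ∉ Q), (1 - q ^ stubCount a (b y)) :=
    (Finset.sum_filter_add_sum_filter_not _ _ _).symm
  -- The two start nodes, one for each search, are the reason for `t + 2` in `NearLaw.light`.
  have hQcard : (Q.card : ℝ) ≤ t + 2 := by
    have h1 : Q.card ≤ B.card + (seen b p₀ v p).card := Finset.card_union_le _ _
    have h2 : (seen b p₀ v p).card ≤ (p \ p₀).card + 1 :=
      (Finset.card_insert_le _ _).trans (Nat.add_le_add_right Finset.card_image_le 1)
    have h3 : (p \ p₀).card + p₀.card = p.card := Finset.card_sdiff_add_card_eq_card hE.sub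
    have h4 : Q.card ≤ p.card + 2 := by omega
    have h5 : (Q.card : ℝ) ≤ p.card + 2 := by exact_mod_cast h4
    linarith
  have hlight : ∑ y ∈ Finset.univ.filter (fun y => b y ∈ Q), (1 - q ^ stubCount a (b y)) ≤
      δ * N * x := by
    refine (Finset.sum_le_sum fun y _ => one_sub_pow_le' hq.1 hq.2 _).trans ?_
    rw [← Finset.sum_mul]
    exact mul_le_mul_of_nonneg_right (h.light Q hQcard) hx0
  have hlight0 : 0 ≤ ∑ y ∈ Finset.univ.filter (fun y => b y ∈ Q), (1 - q ^ stubCount a (b y)) :=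
    Finset.sum_nonneg fun y _ => sub_nonneg.2 (pow_le_one₀ hq.1 hq.2)
  have hgen := h.gen q hq
  have hsum1 : ∑ y : β, (1 - q ^ stubCount a (b y)) = N - ∑ y : β, q ^ stubCount a (b y) := by
    simp [hNdef]
  rw [← hNdef, ← hx, ← hF, abs_le] at hgen
  have hMS : M - S = s * N + ∑ y ∈ Finset.univ.filter (fun y => b y ∉ Q),
        (1 - q ^ stubCount a (b y)) := by rw [hcomp, hsplit, hs]
  set T := ∑ y ∈ Finset.univ.filter (fun y => b y ∉ Q), (1 - q ^ stubCount a (b y)) with hT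
  have hTu : T ≤ N * (1 - F) + δ * N * x := by nlinarith
  have hTl : N * (1 - F) - 2 * (δ * N * x) ≤ T := by nlinarith
  have hexp1 := Real.add_one_le_exp (-s)
  -- The hitting probability `s` acts as `exp(-s)` in the recursion; the difference is at most `s ^
  -- 2 ≤ δ s`.
  have hexp2 : Real.exp (-s) ≤ 1 - s + s * s := by
    have := Real.abs_exp_sub_one_sub_id_le (x := -s) (by rw [abs_neg, abs_of_nonneg hs0]; linarith)
    rw [abs_le] at this
    nlinarith [this.2]
  have hexp3 : Real.exp (-s) ≤ 1 := Real.exp_le_one_iff.2 (by linarith)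
  have hF0 : 0 ≤ F := genFun_nonneg f hq.1
  have hss : s * s ≤ δ * s := mul_le_mul_of_nonneg_right hsδ hs0
  have hsF : s * (1 - F) ≤ δ * (μ * x) := by
    refine mul_le_mul hsδ hF2 (by linarith) hd
  have hNM : N * (1 - δ) ≤ M := by rw [hM]; linarith
  have hpc : (0 : ℝ) ≤ p.card := Nat.cast_nonneg _
  have hMN : M ≤ N := by linarith
  have hE1 : (1 - Real.exp (-s)) * (1 - F) ≤ δ * (μ * x) := by
    refine le_trans (mul_le_mul_of_nonneg_right (by linarith) (by linarith)) hsF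
  have hE0 : 0 ≤ (1 - Real.exp (-s)) * (1 - F) := mul_nonneg (by linarith) (by linarith)
  have hG : 1 - genStep f s q =
      (1 - Real.exp (-s)) + (1 - F) - (1 - Real.exp (-s)) * (1 - F) := by
    unfold genStep; rw [← hF]; ring
  have hG1 : 1 - genStep f s q ≤ s + (1 - F) := by
    rw [hG]; linarith
  have hG2 : s + (1 - F) - δ * s - δ * (μ * x) ≤ 1 - genStep f s q := by
    rw [hG]; linarith
  exact abs_div_sub_le_of_bounds hμ hMpos hx0 hs0 hd hF1 hF2 hNM hMN hd2
    (by linarith : S = M - s * N - T) hTu hTl hG1 hG2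

end Phase

/-! ### A complete search from one node -/

section Phase

variable {V α β : Type*} [Fintype α] [Fintype β] [DecidableEq V] [DecidableEq α] [DecidableEq β]
variable {a : α → V} {b : β → V} {p₀ : Finset (α × β)} {B : Finset V} {v : V}
  {p : Finset (α × β)} {C : Finset V} {j : ℕ} {f : PMF ℕ} {μ δ t : ℝ}

lemma integrable_of_mem_Icc {ρ : Measure ℕ} [IsProbabilityMeasure ρ] {φ : ℕ → ℝ}
    (hφ : ∀ i, φ i ∈ Set.Icc (0 : ℝ) 1) : Integrable φ ρ := by
  refine Integrable.of_bound (C := 1) (Measurable.of_discrete).aestronglyMeasurable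
    (ae_of_all _ fun i => ?_)
  rw [Real.norm_eq_abs, abs_of_nonneg (hφ i).1]
  exact (hφ i).2

lemma pow_mul_pow_mem {q r : ℝ} (hq : q ∈ Set.Icc (0 : ℝ) 1) (hr : r ∈ Set.Icc (0 : ℝ) 1)
    (k c : ℕ) : q ^ k * r ^ c ∈ Set.Icc (0 : ℝ) 1 :=
  ⟨mul_nonneg (pow_nonneg hq.1 _) (pow_nonneg hr.1 _),
    mul_le_one₀ (pow_le_one₀ hq.1 hq.2) (pow_nonneg hr.1 _) (pow_le_one₀ hr.1 hr.2)⟩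

lemma integral_mem_Icc {ρ : Measure ℕ} [IsProbabilityMeasure ρ] {φ : ℕ → ℝ}
    (hφ : ∀ i, φ i ∈ Set.Icc (0 : ℝ) 1) : ∫ i, φ i ∂ρ ∈ Set.Icc (0 : ℝ) 1 := by
  refine ⟨integral_nonneg fun i => (hφ i).1, ?_⟩
  have := integral_mono (integrable_of_mem_Icc (ρ := ρ) hφ) (integrable_const (1 : ℝ))
    fun i => (hφ i).2
  simpa using this

/-- The mean of the conditional transforms of the exploration, when the parameter of the transform
is random with law `ρ`. -/
noncomputable def mixTransform (f : PMF ℕ) (s : ℝ) (ρ : Measure ℕ) (q : ℕ → ℝ) (g k c : ℕ) : ℝ :=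
  ∫ i, ((genStep f s)^[g] (q i)) ^ k * ((genStep f s)^[g - 1] (q i)) ^ c ∂ρ

/-- The coefficient of the number of pending stubs in the error bound after `G` generations. -/
noncomputable def slope (μ δ t s e₀ x₀ : ℝ) (G : ℕ) : ℝ :=
  (μ + (3 * μ + 4) * δ) ^ G *
    (e₀ + G * ((3 * μ + 4) * δ * (x₀ + s * (1 + 1 / (μ - 1))) + 1 / t))

lemma slope_nonneg (hμ : 1 < μ) (hδ : 0 ≤ δ) (ht : 0 ≤ t) {s e₀ x₀ : ℝ} (hs : 0 ≤ s)
    (he₀ : 0 ≤ e₀) (hx₀ : 0 ≤ x₀) (G : ℕ) : 0 ≤ slope μ δ t s e₀ x₀ G := by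
  have : 0 < μ - 1 := by linarith
  unfold slope
  positivity

/-- The exploration process compared with a branching process, from the start. -/
theorem NearLaw.phase_bound (h : NearLaw a b f μ δ t) (hμ : 1 < μ)
    (hf : pmfMean f = ENNReal.ofReal μ) {ς : ℝ} (hς : ς = 1 ∨ ς = -1) {X : (α ≃ β) → ℝ}
    (hX0 : ∀ σ, 0 ≤ X σ) (hX1 : ∀ σ, X σ ≤ 1) (ρ : Measure ℕ) [IsProbabilityMeasure ρ]
    {q : ℕ → ℝ} (hq : ∀ i, q i ∈ Set.Icc (0 : ℝ) 1) {G : ℕ} {s e₀ err x₀ : ℝ}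
    (hs : s * Fintype.card β = hitCount b p₀ B) (hsδ : s ≤ δ)
    (hB : ∀ x ∈ p₀, a x.1 ∈ B) (hB2 : ∀ x ∈ p₀, b x.2 ∈ B) (hBcard : B.card ≤ p₀.card + 1)
    (hp₀ : (extensions p₀).Nonempty) (hv : v ∉ B)
    (hkill : ∀ σ ∈ extensions p₀, (∃ r ∈ ball a b σ v G, r ∈ B) → 0 ≤ ς * X σ)
    (he₀ : 0 ≤ e₀) (herr : 0 ≤ err) (hx₀ : ∫ i, (1 - q i) ∂ρ ≤ x₀)
    (hterm : ∀ p C, Explored a b p₀ B v p C G → seen b p₀ v p = C →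
      ς * ∫ i, q i ^ (pending a p C).card ∂ρ ≤
        ς * condMean p X + e₀ * (pending a p C).card + p.card / t + err) :
    ς * ∫ i, ((genStep f s)^[G] (q i)) ^ stubCount a v ∂ρ ≤
      ς * condMean p₀ X + slope μ δ t s e₀ x₀ G * stubCount a v + p₀.card / t + err := by
  have hN := h.card_pos
  have hs0 : 0 ≤ s := nonneg_of_mul_nonneg_left (hs ▸ Nat.cast_nonneg _) hN
  have hqg : ∀ g i, (genStep f s)^[g] (q i) ∈ Set.Icc (0 : ℝ) 1 :=
    fun g i => genStep_iterate_mem f hs0 (hq i) g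
  have hwm : ∀ g k c, mixTransform f s ρ q g k c ∈ Set.Icc (0 : ℝ) 1 := fun g k c =>
    integral_mem_Icc fun i => pow_mul_pow_mem (hqg g i) (hqg (g - 1) i) k c
  have hx00 : 0 ≤ x₀ := (integral_nonneg fun i => sub_nonneg.2 (hq i).2).trans hx₀
  have hδ := h.delta_nonneg
  have hμ1 : 0 < μ - 1 := by linarith
  have hpos : ∀ g, 0 ≤ slope μ δ t s e₀ x₀ g := slope_nonneg hμ hδ h.t_pos.le hs0 he₀ hx00
  have hcoef : 0 ≤ (3 * μ + 4) * δ := by positivity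
  have hint : ∀ g, Integrable (fun i => 1 - (genStep f s)^[g] (q i)) ρ := fun g =>
    integrable_of_mem_Icc fun i => ⟨by linarith [(hqg g i).2], by linarith [(hqg g i).1]⟩
  have hxg : ∀ g, ∫ i, (1 - (genStep f s)^[g] (q i)) ∂ρ ≤ μ ^ g * (x₀ + s / (μ - 1)) := by
    intro g
    have h1 : ∫ i, (1 - (genStep f s)^[g] (q i)) ∂ρ ≤
        ∫ i, μ ^ g * ((1 - q i) + s / (μ - 1)) ∂ρ :=
      integral_mono (hint g) (((hint 0).add (integrable_const _)).const_mul _)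
        fun i => one_sub_genStep_iterate_le hμ hf hs0 (hq i) g
    refine h1.trans ?_
    have h2 : ∫ i, ((1 - q i) + s / (μ - 1)) ∂ρ = ∫ i, (1 - q i) ∂ρ + ∫ _, s / (μ - 1) ∂ρ :=
      integral_add (hint 0) (integrable_const _)
    rw [integral_const_mul, h2]
    simp only [integral_const, probReal_univ, one_smul]
    gcongr
  have key := exploration_bound (a := a) (b := b) (p₀ := p₀) (B := B) (v := v) hς hX0 hX1
    (w := mixTransform f s ρ q) (fun g k c => (hwm g k c).1) (fun g k c => (hwm g k c).2)
    (fun g c => by simp [mixTransform]) (G := G) (e := slope μ δ t s e₀ x₀)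
    (disc := fun g => (3 * μ + 4) * δ * (s + μ ^ g * (x₀ + s / (μ - 1)))) (t := t) (err := err)
    (mbar := μ + (3 * μ + 4) * δ) hpos h.t_pos herr
    (h.t_le.trans (by nlinarith [h.delta_le])) hB hp₀ hv hkill ?_ ?_ ?_ ?_
  · simpa [mixTransform] using key
  · intro g k c p C j _ hE hpt
    have hM : 0 < (Fintype.card β : ℝ) - p.card := by nlinarith [h.t_le, h.delta_le]
    have e1 : (∑ y ∈ Finset.univ \ p.image Prod.snd,
          if b y ∈ B then 0 else mixTransform f s ρ q (g + 1) k (c + gain a b p₀ v p y)) /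
            ((Fintype.card β : ℝ) - p.card) - mixTransform f s ρ q (g + 1) (k + 1) c =
        ∫ i, ((genStep f s)^[g + 1] (q i)) ^ k * ((genStep f s)^[g] (q i)) ^ c *
          ((∑ y ∈ Finset.univ \ p.image Prod.snd, if b y ∈ B then 0 else
            ((genStep f s)^[g] (q i)) ^ gain a b p₀ v p y) / ((Fintype.card β : ℝ) - p.card)
              - genStep f s ((genStep f s)^[g] (q i))) ∂ρ := by
      have e2 : ∀ y, (if b y ∈ B then 0 else
          mixTransform f s ρ q (g + 1) k (c + gain a b p₀ v p y)) =
          ∫ i, (if b y ∈ B then 0 else ((genStep f s)^[g + 1] (q i)) ^ k *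
            ((genStep f s)^[g] (q i)) ^ (c + gain a b p₀ v p y)) ∂ρ := by
        intro y
        split_ifs
        · simp
        · rfl
      have i1 : ∀ y, Integrable (fun i => (if b y ∈ B then 0 else
          ((genStep f s)^[g + 1] (q i)) ^ k *
            ((genStep f s)^[g] (q i)) ^ (c + gain a b p₀ v p y))) ρ := by
        intro y
        refine integrable_of_mem_Icc fun i => ?_
        split_ifs
        · simp
        · exact pow_mul_pow_mem (hqg _ i) (hqg _ i) _ _
      simp_rw [e2]
      rw [← integral_finsetSum _ fun y _ => i1 y, ← integral_div, mixTransform,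
        ← integral_sub]
      · refine integral_congr_ae (ae_of_all _ fun i => ?_)
        simp only [Nat.add_sub_cancel]
        rw [mul_sub, ← mul_div_assoc, Finset.mul_sum]
        congr 1
        · congr 1
          refine Finset.sum_congr rfl fun y _ => ?_
          split_ifs
          · simp
          · rw [pow_add, mul_assoc]
        · rw [pow_succ, Function.iterate_succ_apply']
          ring
      · exact (integrable_finsetSum _ fun y _ => i1 y).div_const _
      · exact integrable_of_mem_Icc fun i => pow_mul_pow_mem (hqg _ i) (hqg _ i) _ _
    rw [e1]
    have hle : ∀ i, ‖((genStep f s)^[g + 1] (q i)) ^ k * ((genStep f s)^[g] (q i)) ^ c *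
          ((∑ y ∈ Finset.univ \ p.image Prod.snd, if b y ∈ B then 0 else
            ((genStep f s)^[g] (q i)) ^ gain a b p₀ v p y) / ((Fintype.card β : ℝ) - p.card)
              - genStep f s ((genStep f s)^[g] (q i)))‖ ≤
        (3 * μ + 4) * δ * (s + (1 - (genStep f s)^[g] (q i))) := by
      intro i
      have h1 := pow_mul_pow_mem (hqg (g + 1) i) (hqg g i) k c
      have h2 := h.abs_step_le hμ hf hE hB2 hBcard hpt hs hsδ (hqg g i)
      rw [norm_mul, Real.norm_eq_abs, Real.norm_eq_abs, abs_of_nonneg h1.1]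
      exact (mul_le_of_le_one_left (abs_nonneg _) h1.2).trans h2
    rw [← Real.norm_eq_abs]
    refine (norm_integral_le_of_norm_le (((integrable_const s).add (hint g)).const_mul _)
      (ae_of_all _ hle)).trans ?_
    rw [integral_const_mul]
    refine mul_le_mul_of_nonneg_left ?_ hcoef
    have h2 : ∫ i, (s + (1 - (genStep f s)^[g] (q i))) ∂ρ =
        ∫ _, s ∂ρ + ∫ i, (1 - (genStep f s)^[g] (q i)) ∂ρ :=
      integral_add (integrable_const s) (hint g)
    refine h2.trans_le ?_
    simp only [integral_const, probReal_univ, one_smul]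
    linarith [hxg g]
  · intro p C j _ hpt
    exact h.mean_gain_le hμ hpt
  -- `slope` is a closed form that dominates the recursion for the coefficients: `1` and `μ ^ g` are
  -- both at most `m ^ (g + 1)`, so every one-step error can be put under this common factor.
  · intro g
    set m := μ + (3 * μ + 4) * δ with hm
    have hm1 : 1 ≤ m := by linarith
    have hmg : μ ^ g ≤ m ^ g := pow_le_pow_left₀ (by linarith) (by linarith) g
    have hm1g : 1 ≤ m ^ g := one_le_pow₀ hm1
    have hm2 : m ^ g ≤ m ^ (g + 1) := pow_le_pow_right₀ hm1 (Nat.le_succ g)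
    have hA : s + μ ^ g * (x₀ + s / (μ - 1)) ≤ m ^ (g + 1) * (x₀ + s * (1 + 1 / (μ - 1))) := by
      have e : x₀ + s * (1 + 1 / (μ - 1)) = s + (x₀ + s / (μ - 1)) := by ring
      have : 0 ≤ x₀ + s / (μ - 1) := by positivity
      rw [e, mul_add (m ^ (g + 1))]
      exact add_le_add (le_mul_of_one_le_left hs0 (hm1g.trans hm2))
        (mul_le_mul_of_nonneg_right (hmg.trans hm2) this)
    have hA' := mul_le_mul_of_nonneg_left hA hcoef
    have hT : 1 / t ≤ m ^ (g + 1) * (1 / t) :=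
      le_mul_of_one_le_left (by have := h.t_pos; positivity) (hm1g.trans hm2)
    unfold slope
    rw [← hm]
    push_cast
    have : m ^ (g + 1) * (e₀ + (g + 1) * ((3 * μ + 4) * δ * (x₀ + s * (1 + 1 / (μ - 1))) + 1 / t)) =
        m * (m ^ g * (e₀ + g * ((3 * μ + 4) * δ * (x₀ + s * (1 + 1 / (μ - 1))) + 1 / t))) +
        (3 * μ + 4) * δ * (m ^ (g + 1) * (x₀ + s * (1 + 1 / (μ - 1)))) + m ^ (g + 1) * (1 / t) := by
      ring
    rw [this]
    linarith
  · intro p C hE hseen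
    have h1 := hterm p C hE hseen
    have h0 : slope μ δ t s e₀ x₀ 0 = e₀ := by simp [slope]
    rw [h0]
    simpa [mixTransform] using h1

end Phase

/-! ### The forward search followed by the backward search -/

section TwoPhases

variable {V α β : Type*} [Fintype V] [Fintype α] [Fintype β] [DecidableEq V] [DecidableEq α]
  [DecidableEq β]
variable {a : α → V} {b : β → V} {p₀ : Finset (α × β)} {B : Finset V} {v : V}
  {p : Finset (α × β)} {C : Finset V} {j : ℕ} {f : PMF ℕ} {μ δ t : ℝ}

/-- The backward search is a forward search of the inverse matching, started from what the first
search has revealed. -/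
lemma symm_mem_extensions {p : Finset (α × β)} {σ : β ≃ α} :
    σ.symm ∈ extensions p ↔ σ ∈ extensions (p.image Prod.swap) := by
  simp only [mem_extensions, Finset.mem_image, forall_exists_index, and_imp]
  constructor
  · rintro h _ x hx rfl
    rw [Prod.fst_swap, Prod.snd_swap, ← h x hx, Equiv.apply_symm_apply]
  · intro h x hx
    have := h _ x hx rfl
    rw [Prod.fst_swap, Prod.snd_swap] at this
    rw [← this, Equiv.symm_apply_apply]

lemma condMean_swap (p : Finset (α × β)) (X : (α ≃ β) → ℝ) :
    condMean (p.image Prod.swap) (fun σ => X σ.symm) = condMean p X := by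
  unfold condMean
  have hc : (extensions (p.image Prod.swap)).card = (extensions p).card := by
    refine Finset.card_bij' (fun σ _ => σ.symm) (fun σ _ => σ.symm)
      (fun σ hσ => symm_mem_extensions.2 hσ) (fun σ hσ => ?_) (fun _ _ => rfl) (fun _ _ => rfl)
    exact symm_mem_extensions.1 (by simpa using hσ)
  rw [hc]
  congr 1
  refine Finset.sum_bij' (fun σ _ => σ.symm) (fun σ _ => σ.symm)
      (fun σ hσ => symm_mem_extensions.2 hσ) (fun σ hσ => ?_) (fun _ _ => rfl) (fun _ _ => rfl)
      (fun _ _ => rfl)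
  exact symm_mem_extensions.1 (by simpa using hσ)

lemma sum_stubCount (a : α → V) : ∑ r, stubCount a r = Fintype.card α := by
  unfold stubCount
  rw [← Finset.card_univ, Finset.card_eq_sum_card_fiberwise (f := a) (t := Finset.univ)
    (fun _ _ => Finset.mem_coe.2 (Finset.mem_univ _))]

lemma NearLaw.mono {t' : ℝ} (h : NearLaw a b f μ δ t) (ht' : 0 < t') (htt : t' ≤ t) :
    NearLaw a b f μ δ t' where
  delta_nonneg := h.delta_nonneg
  delta_le := h.delta_le
  t_pos := ht'
  t_le := htt.trans h.t_le
  gen := h.gen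
  mean := h.mean
  light Q hQ := h.light Q (by linarith)

/-- The dependence of `slope` on the number of nodes to be avoided, as a fraction of `N`. -/
noncomputable def slopeRate (μ δ N : ℝ) (G : ℕ) : ℝ :=
  (μ + (3 * μ + 4) * δ) ^ G * (G * ((3 * μ + 4) * δ * (1 / N * (1 + 1 / (μ - 1)))))

lemma slopeRate_nonneg {N : ℝ} (hμ : 1 < μ) (hδ : 0 ≤ δ) (hN : 0 ≤ N) (G : ℕ) :
    0 ≤ slopeRate μ δ N G := by
  have : 0 < μ - 1 := by linarith
  unfold slopeRate
  positivity

/-- The transform of the degree of a uniformly chosen node is close to that of `g`. -/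
def NearRoot (a : α → V) (g : PMF ℕ) (δ : ℝ) : Prop :=
  ∀ q ∈ Set.Icc (0 : ℝ) 1,
    |∑ r, q ^ stubCount a r - Fintype.card V * genFun g q| ≤ δ * Fintype.card V

/-- Bound for the second of the two explorations, averaged over the target node. -/
lemma NearLaw.backward_bound (h : NearLaw b a f μ δ t) (hμ : 1 < μ)
    (hf : pmfMean f = ENNReal.ofReal μ) {g : PMF ℕ} (hg : NearRoot b g δ)
    {ς : ℝ} (hς : ς = 1 ∨ ς = -1) {X : V → (α ≃ β) → ℝ}
    (hX0 : ∀ v σ, 0 ≤ X v σ) (hX1 : ∀ v σ, X v σ ≤ 1) {n R : ℝ} (hn : n = Fintype.card V)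
    (hn0 : 0 < n) (hR : (Fintype.card β : ℝ) ≤ R * n) {u : V} {A H : ℕ}
    (hE : Explored a b ∅ ∅ u p C A) (hseen : seen b ∅ u p = C) {r x₀ : ℝ}
    (hr : r ∈ Set.Icc (0 : ℝ) 1) (hx₀ : 1 - r ≤ x₀) {s : ℝ}
    (hs : s * Fintype.card α = (pending a p C).card) (hsδ : s ≤ δ)
    (hkill : ∀ v σ, σ ∈ extensions p → (∃ w ∈ ball b a σ.symm v H, w ∈ C) → 0 ≤ ς * X v σ)
    (hterm : ∀ v p' C', Explored b a (p.image Prod.swap) C v p' C' H →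
      seen a (p.image Prod.swap) v p' = C' →
      ∀ σ ∈ extensions p', ς * r ^ (pending b p' C').card ≤ ς * X v σ.symm) :
    ς * genFun g ((genStep f s)^[H] r) ≤ ς * condMean p (fun σ => (∑ v, X v σ) / n) +
      R * slope μ δ t s 0 x₀ H + p.card / t + (p.card + 1) / n + δ := by
  have hN := h.card_pos
  have hs0 : 0 ≤ s := nonneg_of_mul_nonneg_left (hs ▸ Nat.cast_nonneg _) hN
  have hx00 : 0 ≤ x₀ := by linarith [hr.2]
  set Q := (genStep f s)^[H] r with hQ
  have hQm : Q ∈ Set.Icc (0 : ℝ) 1 := genStep_iterate_mem f hs0 hr H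
  have hslope := slope_nonneg hμ h.delta_nonneg h.t_pos.le hs0 le_rfl hx00 H
  have hpC : ∀ x ∈ p.image Prod.swap, b x.1 ∈ C ∧ a x.2 ∈ C := by
    intro x hx
    obtain ⟨z, hz, rfl⟩ := Finset.mem_image.1 hx
    refine ⟨?_, hE.dom_mem z (by simpa using hz)⟩
    rw [← hseen]
    exact Finset.mem_insert_of_mem (Finset.mem_image_of_mem (fun x : α × β => b x.2)
      (by simpa using hz : z ∈ p \ ∅))
  have hcardp : (p.image Prod.swap).card = p.card :=
    Finset.card_image_of_injective _ Prod.swap_injective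
  have hCcard : C.card ≤ p.card + 1 := by
    rw [← hseen]; exact card_seen_le _ _
  have hnode : ∀ v, ς * Q ^ stubCount b v ≤ ς * condMean p (X v) +
      (slope μ δ t s 0 x₀ H * stubCount b v + p.card / t) + if v ∈ C then 1 else 0 := by
    intro v
    -- A target inside the forward ball is estimated trivially. There are at most `p.card + 1` of
    -- them, which gives the term `(p.card + 1) / n`.
    split_ifs with hvC
    · have h1 := condMean_nonneg (hX0 v) p
      have h2 := condMean_le_one (hX1 v) p
      have h3 : 0 ≤ Q ^ stubCount b v := pow_nonneg hQm.1 _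
      have h4 : Q ^ stubCount b v ≤ 1 := pow_le_one₀ hQm.1 hQm.2
      have h5 : 0 ≤ slope μ δ t s 0 x₀ H * stubCount b v := by positivity
      have h6 : 0 ≤ (p.card : ℝ) / t := by have := h.t_pos; positivity
      rcases hς with rfl | rfl <;> linarith
    · have key := h.phase_bound hμ hf hς (X := fun σ => X v σ.symm) (fun σ => hX0 v _)
        (fun σ => hX1 v _) (Measure.dirac 0) (q := fun _ => r) (fun _ => hr) (G := H)
        (p₀ := p.image Prod.swap) (B := C) (v := v) (s := s) (e₀ := 0) (err := 0) (x₀ := x₀)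
        (by
          rw [hs, hitCount, pending]
          congr 2
          ext y
          simp [Finset.image_image])
        hsδ (fun x hx => (hpC x hx).1) (fun x hx => (hpC x hx).2)
        (by rw [hcardp]; exact hCcard)
        (by
          obtain ⟨σ, hσ⟩ := hE.nonempty
          exact ⟨σ.symm, symm_mem_extensions.1 (by simpa using hσ)⟩) hvC
        (fun σ hσ hk => hkill v σ.symm (symm_mem_extensions.2 hσ) (by simpa using hk)) le_rfl le_rfl
        (by simpa using hx₀)
        (by
          intro p' C' hE' hs'
          have h1 : ς * r ^ (pending b p' C').card ≤ ς * condMean p' fun σ => X v σ.symm := by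
            rw [← condMean_mul_left, ← condMean_const hE'.nonempty (ς * _)]
            exact condMean_mono (hterm v p' C' hE' hs')
          have h2 : 0 ≤ (p'.card : ℝ) / t := by have := h.t_pos; positivity
          simp only [integral_const, probReal_univ, one_smul, zero_mul, add_zero]
          linarith)
      rw [condMean_swap, hcardp] at key
      simp only [integral_const, probReal_univ, one_smul, add_zero] at key
      linarith
  have hsum := Finset.sum_le_sum fun v (_ : v ∈ Finset.univ) => hnode v
  rw [← Finset.mul_sum, Finset.sum_add_distrib, Finset.sum_add_distrib, Finset.sum_add_distrib,
    ← Finset.mul_sum, ← Finset.mul_sum, ← Nat.cast_sum, sum_stubCount, Finset.sum_const,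
    Finset.card_univ, nsmul_eq_mul, ← hn, Finset.sum_boole, Finset.filter_univ_mem] at hsum
  have hmean : condMean p (fun σ => (∑ v, X v σ) / n) = (∑ v, condMean p (X v)) / n := by
    simp_rw [div_eq_inv_mul]
    rw [condMean_mul_left, condMean_sum]
  have hroot := hg Q hQm
  rw [← hn, abs_le] at hroot
  have h1 : ς * (n * genFun g Q) ≤ ς * ∑ v, Q ^ stubCount b v + δ * n := by
    rcases hς with rfl | rfl <;> linarith [hroot.1, hroot.2]
  have hC' : (C.card : ℝ) ≤ p.card + 1 := by exact_mod_cast hCcard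
  have h2 : slope μ δ t s 0 x₀ H * Fintype.card β ≤ slope μ δ t s 0 x₀ H * (R * n) :=
    mul_le_mul_of_nonneg_left hR hslope
  rw [hmean]
  have h3 : n * (ς * genFun g Q) ≤ n * (ς * ((∑ v, condMean p (X v)) / n) +
      R * slope μ δ t s 0 x₀ H + p.card / t + (p.card + 1) / n + δ) := by
    have e : n * (ς * ((∑ v, condMean p (X v)) / n) +
      R * slope μ δ t s 0 x₀ H + p.card / t + (p.card + 1) / n + δ) =
      ς * (∑ v, condMean p (X v)) + slope μ δ t s 0 x₀ H * (R * n) + n * (p.card / t) +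
        (p.card + 1) + δ * n := by
      field_simp
    rw [e]
    linarith
  exact le_of_mul_le_mul_left h3 hn0

/-- The two explorations together: the mean of a functional `X u v` of the random matching over
all nodes `u` and `v`. -/
theorem NearLaw.two_phase_bound {fp fm gp gm : PMF ℕ} (hF : NearLaw a b fp μ δ t)
    (hB : NearLaw b a fm μ δ t) (hμ : 1 < μ)
    (hfp : pmfMean fp = ENNReal.ofReal μ) (hfm : pmfMean fm = ENNReal.ofReal μ)
    (hgp : NearRoot a gp δ) (hgm : NearRoot b gm δ)
    {ς : ℝ} (hς : ς = 1 ∨ ς = -1) {X : V → V → (α ≃ β) → ℝ}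
    (hX0 : ∀ u v σ, 0 ≤ X u v σ) (hX1 : ∀ u v σ, X u v σ ≤ 1) {n N R : ℝ}
    (hn : n = Fintype.card V) (hn0 : 0 < n) (htn : t ≤ n) (hNa : N = Fintype.card α)
    (hNb : N = Fintype.card β) (hR : N ≤ R * n) {A H : ℕ}
    {r : ℕ → ℝ} {x₁ : ℝ} (hr : ∀ k, r k ∈ Set.Icc (0 : ℝ) 1) (hx₁ : ∀ k, 1 - r k ≤ x₁)
    (ρ : Measure ℕ) [IsProbabilityMeasure ρ] {q : ℕ → ℝ} (hq : ∀ i, q i ∈ Set.Icc (0 : ℝ) 1)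
    {x₀ ψ : ℝ} (hx₀ : ∫ i, (1 - q i) ∂ρ ≤ x₀) (hψ0 : 0 ≤ ψ)
    (hψ : ∀ k : ℕ, |genFun gm ((genStep fm (k / N))^[H] (r k)) - ∫ i, q i ^ k ∂ρ| ≤ ψ * k)
    (hkill : ∀ u v σ, (∃ w ∈ ball b a σ.symm v H, w ∈ ball a b σ u A) → 0 ≤ ς * X u v σ)
    (hterm : ∀ u p C, Explored a b ∅ ∅ u p C A → seen b ∅ u p = C →
      ∀ v p' C', Explored b a (p.image Prod.swap) C v p' C' H →
      seen a (p.image Prod.swap) v p' = C' → ∀ σ ∈ extensions p',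
        ς * r (pending a p C).card ^ (pending b p' C').card ≤ ς * X u v σ.symm) :
    ς * ∫ i, genFun gp ((genStep fp 0)^[A] (q i)) ∂ρ ≤
      ς * ((∑ u, ∑ v, condMean ∅ (X u v)) / n / n) +
      R * slope μ δ (t / 2) 0 (ψ + 1 / (N * δ) +
        R * slopeRate μ δ N H) x₀ A +
      (R * slope μ δ t 0 0 x₁ H + 1 / n + 2 * δ) := by
  have ht := hF.t_pos
  have hδ0 := hF.delta_nonneg
  have hNpos : 0 < N := by rw [hNb]; exact hF.card_pos
  have hδ : 0 < δ := by
    rcases hδ0.eq_or_lt with h | h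
    · have := hF.t_le
      rw [← h, zero_mul] at this
      linarith
    · exact h
  have hx₁0 : 0 ≤ x₁ := by linarith [hx₁ 0, (hr 0).2]
  have hx₀0 : 0 ≤ x₀ := (integral_nonneg fun i => sub_nonneg.2 (hq i).2).trans hx₀
  have hR0 : 0 ≤ R := by
    by_contra h
    push Not at h
    nlinarith
  have hF' := hF.mono (t' := t / 2) (by linarith) (by linarith)
  have hsl1 := slopeRate_nonneg hμ hδ0 hNpos.le H
  have hsl2 := slope_nonneg hμ hδ0 ht.le (s := 0) le_rfl le_rfl hx₁0 H (e₀ := 0)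
  set e₀ := ψ + 1 / (N * δ) + R * slopeRate μ δ N H with he₀
  have he₀0 : 0 ≤ e₀ := by positivity
  set err := R * slope μ δ t 0 0 x₁ H + 1 / n + δ with herr
  have herr0 : 0 ≤ err := by positivity
  have hsl3 := slope_nonneg hμ hδ0 (by linarith : 0 ≤ t / 2) (s := 0) le_rfl he₀0 hx₀0 A
  have hslope : ∀ k : ℕ, slope μ δ t (k / N) 0 x₁ H =
      slope μ δ t 0 0 x₁ H + slopeRate μ δ N H * k := by
    intro k
    unfold slope slopeRate
    ring
  have hnode : ∀ u, ς * ∫ i, ((genStep fp 0)^[A] (q i)) ^ stubCount a u ∂ρ ≤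
      ς * condMean ∅ (fun σ => (∑ v, X u v σ) / n) +
        slope μ δ (t / 2) 0 e₀ x₀ A * stubCount a u + err := by
    intro u
    have hXm : ∀ σ, 0 ≤ (∑ v, X u v σ) / n ∧ (∑ v, X u v σ) / n ≤ 1 := by
      intro σ
      refine ⟨div_nonneg (Finset.sum_nonneg fun v _ => hX0 u v σ) hn0.le, ?_⟩
      rw [div_le_one hn0, hn]
      refine (Finset.sum_le_sum fun v _ => hX1 u v σ).trans ?_
      simp
    have key := hF'.phase_bound hμ hfp hς (X := fun σ => (∑ v, X u v σ) / n)
      (fun σ => (hXm σ).1) (fun σ => (hXm σ).2) ρ hq (G := A) (p₀ := ∅) (B := ∅) (v := u) (s := 0)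
      (e₀ := e₀) (err := err) (x₀ := x₀) (by simp [hitCount]) hδ0 (by simp) (by simp) (by simp)
      (by
        have : Fintype.card α = Fintype.card β := by
          have : (Fintype.card α : ℝ) = Fintype.card β := by rw [← hNa, ← hNb]
          exact_mod_cast this
        obtain ⟨σ⟩ := Fintype.card_eq.1 this
        exact ⟨σ, by simp [mem_extensions]⟩)
      (by simp) (by simp) he₀0 herr0 hx₀
      (by
        intro p C hE hseen
        set k := (pending a p C).card with hk
        have hpt : (p.card : ℝ) / (t / 2) = p.card / t + p.card / t := by field_simp; ring
        have hpn : (p.card : ℝ) / n ≤ p.card / t :=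
          div_le_div_of_nonneg_left (Nat.cast_nonneg _) ht htn
        have hψk := hψ k
        rw [abs_le] at hψk
        have hp0 : 0 ≤ (p.card : ℝ) / t := by positivity
        -- If the forward generation is too large for the one-step estimate, then `k / (N δ) > 1`
        -- and the trivial bound is covered by the summand `1 / (N δ)` of `e₀`.
        rcases le_or_gt ((k : ℝ) / N) δ with hsδ | hsδ
        · have hb := hB.backward_bound hμ hfm hgm hς (X := X u) (hX0 u) (hX1 u) hn hn0
            (hNb ▸ hR) hE hseen (hr k) (hx₁ k) (s := k / N)
            (by rw [← hNa, ← hk]; field_simp) hsδ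
            (fun v σ hσ hw => hkill u v σ (by rwa [hE.ball_eq σ hσ]))
            (fun v p' C' hE' hs' σ hσ => hterm u p C hE hseen v p' C' hE' hs' σ hσ)
          have h1 : ς * ∫ i, q i ^ k ∂ρ ≤ ς * genFun gm ((genStep fm (k / N))^[H] (r k)) +
              ψ * k := by
            rcases hς with rfl | rfl <;> linarith [hψk.1, hψk.2]
          have h2 := mul_le_mul_of_nonneg_left (hslope k).le hR0
          have h3 : ((p.card : ℝ) + 1) / n = p.card / n + 1 / n := add_div _ _ _
          have h4 : 0 ≤ 1 / (N * δ) * k := by positivity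
          rw [h3] at hb
          rw [hpt, he₀, herr]
          linarith
        · have h1 : 1 ≤ 1 / (N * δ) * k := by
            rw [lt_div_iff₀ hNpos] at hsδ
            rw [one_div, inv_mul_eq_div, le_div_iff₀ (by positivity)]
            linarith
          have h2 := integral_mem_Icc (ρ := ρ) (φ := fun i => q i ^ k)
            fun i => ⟨pow_nonneg (hq i).1 _, pow_le_one₀ (hq i).1 (hq i).2⟩
          have h3 := condMean_nonneg (fun σ => (hXm σ).1) p
          have h4 := condMean_le_one (fun σ => (hXm σ).2) p
          have h5 : 1 / (N * δ) * k ≤ e₀ * k := by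
            refine mul_le_mul_of_nonneg_right ?_ (Nat.cast_nonneg _)
            have : 0 ≤ R * slopeRate μ δ N H := mul_nonneg hR0 hsl1
            linarith
          rw [hpt]
          rcases hς with rfl | rfl <;> linarith [h2.1, h2.2])
    simpa using key
  have hsum := Finset.sum_le_sum fun u (_ : u ∈ Finset.univ) => hnode u
  have hqA : ∀ i, (genStep fp 0)^[A] (q i) ∈ Set.Icc (0 : ℝ) 1 :=
    fun i => genStep_iterate_mem fp le_rfl (hq i) A
  rw [← Finset.mul_sum, Finset.sum_add_distrib, Finset.sum_add_distrib, ← Finset.mul_sum,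
    ← Finset.mul_sum, ← Nat.cast_sum, sum_stubCount, Finset.sum_const, Finset.card_univ,
    nsmul_eq_mul, ← hn, ← hNa] at hsum
  have hint1 : ∀ u : V, Integrable (fun i => ((genStep fp 0)^[A] (q i)) ^ stubCount a u) ρ :=
    fun u => integrable_of_mem_Icc fun i =>
      ⟨pow_nonneg (hqA i).1 _, pow_le_one₀ (hqA i).1 (hqA i).2⟩
  have hint2 : Integrable (fun i => genFun gp ((genStep fp 0)^[A] (q i))) ρ :=
    integrable_of_mem_Icc fun i => ⟨genFun_nonneg gp (hqA i).1, genFun_le_one gp (hqA i).1 (hqA i).2⟩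
  rw [← integral_finsetSum _ fun u _ => hint1 u] at hsum
  have hroot : |∫ i, ∑ u, ((genStep fp 0)^[A] (q i)) ^ stubCount a u ∂ρ -
      n * ∫ i, genFun gp ((genStep fp 0)^[A] (q i)) ∂ρ| ≤ δ * n := by
    rw [← integral_const_mul, ← integral_sub (integrable_finsetSum _ fun u _ => hint1 u)
      (hint2.const_mul _), ← Real.norm_eq_abs]
    refine (norm_integral_le_of_norm_le_const (C := δ * n) (ae_of_all _ fun i => ?_)).trans_eq
      (by simp)
    rw [Real.norm_eq_abs, hn]
    exact hgp _ (hqA i)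
  have hmean : ∀ u, condMean ∅ (fun σ => (∑ v, X u v σ) / n) = (∑ v, condMean ∅ (X u v)) / n := by
    intro u
    simp_rw [div_eq_inv_mul]
    rw [condMean_mul_left, condMean_sum]
  simp_rw [hmean] at hsum
  rw [← Finset.sum_div] at hsum
  rw [abs_le] at hroot
  have h1 : ς * (n * ∫ i, genFun gp ((genStep fp 0)^[A] (q i)) ∂ρ) ≤
      ς * ∫ i, ∑ u, ((genStep fp 0)^[A] (q i)) ^ stubCount a u ∂ρ + δ * n := by
    rcases hς with rfl | rfl <;> linarith [hroot.1, hroot.2]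
  have h2 := mul_le_mul_of_nonneg_left hR hsl3
  refine le_of_mul_le_mul_left (a := n) ?_ hn0
  have e : n * (ς * ((∑ u, ∑ v, condMean ∅ (X u v)) / n / n) +
      R * slope μ δ (t / 2) 0 e₀ x₀ A + (R * slope μ δ t 0 0 x₁ H + 1 / n + 2 * δ)) =
      ς * ((∑ u, ∑ v, condMean ∅ (X u v)) / n) + slope μ δ (t / 2) 0 e₀ x₀ A * (R * n) +
        n * err + δ * n := by
    rw [herr]
    field_simp
    ring
  rw [e]
  linarith

end TwoPhases

/-! ### Directed paths, balls and the hopcount -/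

section Paths

variable {n : ℕ} (G : Graph n) {i j m : Fin n} {k l : ℕ}

lemma Graph.hasPath_zero : G.HasPath 0 i j ↔ i = j :=
  ⟨fun ⟨_, h0, h1, _⟩ => h0.symm.trans h1, fun h => ⟨fun _ => i, rfl, h, by simp⟩⟩

lemma Graph.HasPath.add {G : Graph n} (h : G.HasPath k i m) (h' : G.HasPath l m j) :
    G.HasPath (k + l) i j := by
  obtain ⟨p, hp0, hpk, hp⟩ := h
  obtain ⟨q, hq0, hql, hq⟩ := h'
  refine ⟨fun x => if x ≤ k then p x else q (x - k), by simpa using hp0, ?_, ?_⟩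
  · by_cases hl : l = 0
    · subst hl
      simp [hpk, ← hq0, hql]
    · simp [hl, hql]
  · intro x hx
    rcases lt_trichotomy x k with h | h | h
    · simpa [h.le, Nat.succ_le_of_lt h] using hp x h
    · subst h
      have := hq 0 (by omega)
      simpa [hpk, hq0] using this
    · have := hq (x - k) (by omega)
      rw [show x - k + 1 = x + 1 - k by omega] at this
      simpa [h.not_ge, (show ¬ x + 1 ≤ k by omega)] using this

lemma Graph.HasPath.split {G : Graph n} (h : G.HasPath (k + l) i j) :
    ∃ m, G.HasPath k i m ∧ G.HasPath l m j := by
  obtain ⟨p, hp0, hpk, hp⟩ := h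
  refine ⟨p k, ⟨p, hp0, rfl, fun x hx => hp x (by omega)⟩, fun x => p (k + x), rfl, hpk,
    fun x hx => hp (k + x) (by omega)⟩

lemma Graph.hasPath_one : G.HasPath 1 i j ↔ G.Edge i j := by
  constructor
  · rintro ⟨p, rfl, rfl, hp⟩
    exact hp 0 one_pos
  · intro h
    refine ⟨fun x => if x = 0 then i else j, by simp, by simp, fun x hx => ?_⟩
    obtain rfl : x = 0 := by omega
    simpa using h

lemma Graph.mem_ball : j ∈ ball (V := Fin n) Sigma.fst Sigma.fst G.pairing i l ↔
    ∃ k ≤ l, G.HasPath k i j := by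
  induction l generalizing j with
  | zero => simp [ball, Graph.hasPath_zero, eq_comm]
  | succ l ih =>
    rw [ball, Finset.mem_union, ih, Finset.mem_image]
    constructor
    · rintro (⟨k, hk, h⟩ | ⟨s, hs, rfl⟩)
      · exact ⟨k, by omega, h⟩
      · rw [Finset.mem_filter, ih] at hs
        obtain ⟨-, k, hk, h⟩ := hs
        exact ⟨k + 1, by omega, h.add (G.hasPath_one.2 ⟨s, rfl, rfl⟩)⟩
    · rintro ⟨k, hk, h⟩
      rcases Nat.lt_or_ge k (l + 1) with hlt | hge
      · exact Or.inl ⟨k, by omega, h⟩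
      · obtain rfl : k = l + 1 := by omega
        obtain ⟨m, h1, h2⟩ := h.split
        obtain ⟨s, rfl, rfl⟩ := G.hasPath_one.1 h2
        exact Or.inr ⟨s, by rw [Finset.mem_filter, ih]; exact ⟨Finset.mem_univ _, l, le_rfl, h1⟩, rfl⟩

lemma Graph.mem_ball_symm : i ∈ ball (V := Fin n) Sigma.fst Sigma.fst G.pairing.symm j l ↔
    ∃ k ≤ l, G.HasPath k i j := by
  induction l generalizing i with
  | zero => simp [ball, Graph.hasPath_zero]
  | succ l ih =>
    rw [ball, Finset.mem_union, ih, Finset.mem_image]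
    constructor
    · rintro (⟨k, hk, h⟩ | ⟨s, hs, rfl⟩)
      · exact ⟨k, by omega, h⟩
      · rw [Finset.mem_filter, ih] at hs
        obtain ⟨-, k, hk, h⟩ := hs
        exact ⟨1 + k, by omega, Graph.HasPath.add (G.hasPath_one.2 ⟨_, rfl, by simp⟩) h⟩
    · rintro ⟨k, hk, h⟩
      rcases Nat.lt_or_ge k (l + 1) with hlt | hge
      · exact Or.inl ⟨k, by omega, h⟩
      · obtain rfl : k = 1 + l := by omega
        obtain ⟨m, h1, h2⟩ := h.split
        obtain ⟨s, rfl, rfl⟩ := G.hasPath_one.1 h1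
        refine Or.inr ⟨G.pairing s, ?_, by simp⟩
        rw [Finset.mem_filter, ih]
        exact ⟨Finset.mem_univ _, l, le_rfl, h2⟩

lemma Graph.hopcount_eq_top_iff : G.hopcount i j = ⊤ ↔ ∀ k, ¬ G.HasPath k i j := by
  simp [Graph.hopcount, iInf_eq_top]

lemma Graph.hopcount_le_iff : G.hopcount i j ≤ (l : ℕ∞) ↔ ∃ k ≤ l, G.HasPath k i j := by
  constructor
  · intro h
    by_contra! hc
    have : ((l + 1 : ℕ) : ℕ∞) ≤ G.hopcount i j := by
      refine le_iInf₂ fun k hk => ?_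
      by_contra hlt
      push Not at hlt
      have : k < l + 1 := by exact_mod_cast hlt
      exact hc k (by omega) hk
    have h2 := this.trans h
    have : l + 1 ≤ l := by exact_mod_cast h2
    omega
  · rintro ⟨k, hk, h⟩
    exact (iInf₂_le k h).trans (by exact_mod_cast hk)

end Paths

/-! ### The two-search bound applied to the hopcount -/

section Hopcount

variable {n : ℕ} {d : BiDegree n} {μ δ t : ℝ}

lemma BiDegree.stubCount_out (d : BiDegree n) (r : Fin n) :
    stubCount (Sigma.fst : d.OutStub → Fin n) r = d.outDeg r := by
  classical
  unfold stubCount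
  have : (Finset.univ.filter fun s : d.OutStub => s.1 = r) =
      (Finset.univ : Finset (Fin (d.outDeg r))).map ⟨Sigma.mk r, sigma_mk_injective⟩ := by
    ext ⟨i, x⟩
    simp only [Finset.mem_filter, Finset.mem_univ, true_and, Finset.mem_map,
      Function.Embedding.coeFn_mk]
    constructor
    · rintro rfl; exact ⟨x, rfl⟩
    · rintro ⟨y, hy⟩; exact (congrArg Sigma.fst hy).symm
  rw [this, Finset.card_map, Finset.card_univ, Fintype.card_fin]

lemma BiDegree.card_inStub (d : BiDegree n) : Fintype.card d.InStub = d.edges := by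
  simp [BiDegree.edges]

lemma BiDegree.card_outStub (d : BiDegree n) : Fintype.card d.OutStub = d.edges := by
  simp [BiDegree.edges, d.sum_eq]

/-- A bi-degree sequence whose empirical laws are close to the given ones. -/
structure BiDegree.Near (d : BiDegree n) (gp gm fp fm : PMF ℕ) (μ δ t R : ℝ) : Prop where
  forward : NearLaw (V := Fin n) (Sigma.fst : d.OutStub → Fin n)
    (Sigma.fst : d.InStub → Fin n) fp μ δ t
  backward : NearLaw (V := Fin n) (Sigma.fst : d.InStub → Fin n)
    (Sigma.fst : d.OutStub → Fin n) fm μ δ t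
  root_out : NearRoot (V := Fin n) (Sigma.fst : d.OutStub → Fin n) gp δ
  root_in : NearRoot (V := Fin n) (Sigma.fst : d.InStub → Fin n) gm δ
  pos : 0 < n
  le_size : t ≤ n
  edges_le : (d.edges : ℝ) ≤ R * n

open Classical in
/-- The probability of a property of two uniformly chosen nodes in the configuration model with the
bi-degree sequence `d`. -/
noncomputable def BiDegree.prob (d : BiDegree n) (E : Graph n → Fin n → Fin n → Prop) : ℝ :=
  (∑ u, ∑ v, condMean ∅ fun σ : d.OutStub ≃ d.InStub => if E ⟨d, σ⟩ u v then (1 : ℝ) else 0) / n / n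

variable {gp gm fp fm : PMF ℕ} {R : ℝ}

/-- A path of length `k ≤ A + H`, cut after `min k A` steps, passes through a node of both balls;
but the backward search has met no node of the forward ball. -/
lemma not_hasPath_of_explored {u v : Fin n} {A H : ℕ} {p : Finset (d.OutStub × d.InStub)}
    {C : Finset (Fin n)} (hE : Explored Sigma.fst Sigma.fst ∅ ∅ u p C A)
    {p' : Finset (d.InStub × d.OutStub)} {C' : Finset (Fin n)}
    (hE' : Explored Sigma.fst Sigma.fst (p.image Prod.swap) C v p' C' H)
    {σ : d.InStub ≃ d.OutStub} (hσ : σ ∈ extensions p') {k : ℕ} (hk : k ≤ A + H) :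
    ¬ (Graph.mk d σ.symm).HasPath k u v := by
  intro hpath
  have hσp : σ.symm ∈ extensions p := by
    rw [symm_mem_extensions]
    rw [mem_extensions] at hσ ⊢
    exact fun x hx => hσ x (hE'.sub hx)
  rw [show k = min k A + (k - min k A) by omega] at hpath
  obtain ⟨m, h1, h2⟩ := hpath.split
  have hm : m ∈ C := by
    rw [← hE.ball_eq _ hσp]
    exact (Graph.mem_ball ⟨d, σ.symm⟩).2 ⟨_, min_le_right _ _, h1⟩
  have hm' : m ∈ C' := by
    rw [← hE'.ball_eq _ hσ]
    exact (Graph.mem_ball_symm ⟨d, σ.symm⟩).2 ⟨_, by omega, h2⟩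
  exact hE'.notMem_of_mem hm' hm

theorem BiDegree.Near.prob_hopcount_gt (h : d.Near gp gm fp fm μ δ t R) (hμ : 1 < μ)
    (hfp : pmfMean fp = ENNReal.ofReal μ) (hfm : pmfMean fm = ENNReal.ofReal μ) (A H : ℕ)
    (ρ : Measure ℕ) [IsProbabilityMeasure ρ] {q : ℕ → ℝ} (hq : ∀ i, q i ∈ Set.Icc (0 : ℝ) 1)
    {x₀ : ℝ} (hx₀ : ∫ i, (1 - q i) ∂ρ ≤ x₀)
    (hψ : ∀ k : ℕ, genFun gm ((genStep fm (k / d.edges))^[H] 1) = ∫ i, q i ^ k ∂ρ) :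
    |∫ i, genFun gp ((genStep fp 0)^[A] (q i)) ∂ρ -
      d.prob fun G u v => ((A + H : ℕ) : ℕ∞) < G.hopcount u v| ≤
      R * slope μ δ (t / 2) 0 (1 / (d.edges * δ) +
        R * slopeRate μ δ d.edges H) x₀ A + (R * slope μ δ t 0 0 0 H + 1 / n + 2 * δ) := by
  classical
  have key : ∀ ς : ℝ, ς = 1 ∨ ς = -1 → ς * ∫ i, genFun gp ((genStep fp 0)^[A] (q i)) ∂ρ ≤
      ς * (d.prob fun G u v => ((A + H : ℕ) : ℕ∞) < G.hopcount u v) +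
      R * slope μ δ (t / 2) 0 (1 / (d.edges * δ) +
        R * slopeRate μ δ d.edges H) x₀ A +
        (R * slope μ δ t 0 0 0 H + 1 / n + 2 * δ) := by
    intro ς hς
    have := h.forward.two_phase_bound h.backward hμ hfp hfm h.root_out h.root_in hς
      (X := fun u v σ => if ((A + H : ℕ) : ℕ∞) < (Graph.mk d σ).hopcount u v then (1 : ℝ) else 0)
      (fun u v σ => by split_ifs <;> simp) (fun u v σ => by split_ifs <;> simp)
      (n := n) (N := d.edges) (R := R) (by simp) (by exact_mod_cast h.pos) h.le_size
      (by rw [BiDegree.card_outStub]) (by rw [BiDegree.card_inStub]) h.edges_le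
      (A := A) (H := H) (r := fun _ => 1) (x₁ := 0) (fun _ => by simp) (fun _ => by simp) ρ hq
      (x₀ := x₀) (ψ := 0) hx₀ le_rfl (fun k => by simp [hψ k])
      (by
        rintro u v σ ⟨w, hw1, hw2⟩
        obtain ⟨k, hk, h1⟩ := (Graph.mem_ball ⟨d, σ⟩).1 hw2
        obtain ⟨l, hl, h2⟩ := (Graph.mem_ball_symm ⟨d, σ⟩).1 hw1
        rw [if_neg, mul_zero]
        rw [not_lt, Graph.hopcount_le_iff]
        exact ⟨k + l, by omega, h1.add h2⟩)
      (by
        intro u p C hE _ v p' C' hE' _ σ hσ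
        rw [if_pos]
        · simp
        · rw [← not_le, Graph.hopcount_le_iff]
          rintro ⟨k, hk, hpath⟩
          exact not_hasPath_of_explored hE hE' hσ hk hpath)
    simpa [BiDegree.prob] using this
  rw [abs_le]
  have h1 := key 1 (Or.inl rfl)
  have h2 := key (-1) (Or.inr rfl)
  constructor <;> linarith

/-- An exploration without pending stubs has found everything that can be reached. -/
lemma Explored.apply_mem {V α β : Type*} [Fintype α] [Fintype β] [DecidableEq V] [DecidableEq α]
    [DecidableEq β] {a : α → V} {b : β → V} {p₀ : Finset (α × β)} {B : Finset V} {v : V}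
    {p : Finset (α × β)} {C : Finset V} {j : ℕ} (h : Explored a b p₀ B v p C j)
    (hB : ∀ x ∈ p₀, a x.1 ∈ B) (he : pending a p C = ∅) (hs : seen b p₀ v p = C)
    {σ : α ≃ β} (hσ : σ ∈ extensions p) {s : α} (hsC : a s ∈ C) : b (σ s) ∈ C := by
  have h1 := (h.next hB he).ball_eq σ hσ
  rw [hs, ball, h.ball_eq σ hσ] at h1
  rw [← h1]
  exact Finset.mem_union_right _ (Finset.mem_image.2 ⟨s, by simpa using hsC, rfl⟩)

lemma Graph.HasPath.mem_of_closed {G : Graph n} {C : Finset (Fin n)}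
    (hC : ∀ i j, G.Edge i j → i ∈ C → j ∈ C) {k : ℕ} {i j : Fin n} (h : G.HasPath k i j)
    (hi : i ∈ C) : j ∈ C := by
  obtain ⟨p, rfl, rfl, hp⟩ := h
  suffices ∀ m ≤ k, p m ∈ C from this k le_rfl
  intro m
  induction m with
  | zero => exact fun _ => hi
  | succ m ih => exact fun hm => hC _ _ (hp m (by omega)) (ih (by omega))

lemma Graph.HasPath.mem_of_closed' {G : Graph n} {C : Finset (Fin n)}
    (hC : ∀ i j, G.Edge i j → j ∈ C → i ∈ C) {k : ℕ} {i j : Fin n} (h : G.HasPath k i j)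
    (hj : j ∈ C) : i ∈ C := by
  by_contra hi
  have := h.mem_of_closed (C := Cᶜ) (fun i j hij hi => by
    rw [Finset.mem_compl] at hi ⊢
    exact fun hj => hi (hC i j hij hj)) (by simpa using hi)
  simp [hj] at this

theorem BiDegree.Near.prob_hopcount_eq_top (h : d.Near gp gm fp fm μ δ t R) (hμ : 1 < μ)
    (hfp : pmfMean fp = ENNReal.ofReal μ) (hfm : pmfMean fm = ENNReal.ofReal μ) (A H : ℕ)
    (ρ : Measure ℕ) [IsProbabilityMeasure ρ] {ψ : ℝ} (hψ0 : 0 ≤ ψ)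
    (hψ : ∀ k : ℕ, |genFun gm ((genStep fm (k / d.edges))^[H] (0 ^ k)) -
      ∫ i : ℕ, ((0 : ℝ) ^ i) ^ k ∂ρ| ≤ ψ * k) :
    ∫ i : ℕ, genFun gp ((genStep fp 0)^[A] (0 ^ i)) ∂ρ ≤
      (d.prob fun G u v => G.hopcount u v = ⊤) +
      (R * slope μ δ (t / 2) 0 (ψ + 1 / (d.edges * δ) +
        R * slopeRate μ δ d.edges H) 1 A +
        (R * slope μ δ t 0 0 1 H + 1 / n + 2 * δ)) := by
  classical
  have hpow : ∀ k : ℕ, (0 : ℝ) ^ k ∈ Set.Icc (0 : ℝ) 1 := fun k =>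
    ⟨by positivity, pow_le_one₀ le_rfl zero_le_one⟩
  have := h.forward.two_phase_bound h.backward hμ hfp hfm h.root_out h.root_in (Or.inl rfl)
      (X := fun u v σ => if (Graph.mk d σ).hopcount u v = ⊤ then (1 : ℝ) else 0)
      (fun u v σ => by split_ifs <;> simp) (fun u v σ => by split_ifs <;> simp)
      (n := n) (N := d.edges) (R := R) (by simp) (by exact_mod_cast h.pos) h.le_size
      (by rw [BiDegree.card_outStub]) (by rw [BiDegree.card_inStub]) h.edges_le
      -- With `0 ^ 0 = 1` the value `(0 ^ k) ^ k'` is the indicator that the forward or the backward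
      -- search has died out. Either event excludes a path, since a dead search has found everything
      -- that can be reached. Only the sign `+1` is available, as survival of both does not ensure a
      -- path.
      (A := A) (H := H) (r := fun k => 0 ^ k) (x₁ := 1) hpow (fun k => by linarith [(hpow k).1]) ρ
      (q := fun i => 0 ^ i) hpow (x₀ := 1) (ψ := ψ)
      ((integral_mono (integrable_of_mem_Icc fun i => ⟨by linarith [(hpow i).2],
        by linarith [(hpow i).1]⟩) (integrable_const (1 : ℝ))
          (fun i => by have := (hpow i).1; simp only; linarith)).trans_eq (by simp))
      hψ0 hψ
      (by
        intro u v σ _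
        split_ifs <;> simp)
      (by
        intro u p C hE hs v p' C' hE' hs' σ hσ
        have hσp : σ.symm ∈ extensions p := by
          rw [symm_mem_extensions]
          rw [mem_extensions] at hσ ⊢
          exact fun x hx => hσ x (hE'.sub hx)
        have huC : u ∈ C := hs ▸ Finset.mem_insert_self _ _
        have hvC' : v ∈ C' := hs' ▸ Finset.mem_insert_self _ _
        have hBp : ∀ x ∈ p.image Prod.swap, x.1.1 ∈ C := by
          intro x hx
          obtain ⟨z, hz, rfl⟩ := Finset.mem_image.1 hx
          rw [← hs]
          exact Finset.mem_insert_of_mem (Finset.mem_image_of_mem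
            (fun x : d.OutStub × d.InStub => x.2.1) (by simpa using hz : z ∈ p \ ∅))
        rcases Finset.eq_empty_or_nonempty (pending Sigma.fst p C) with hk | hk
        · rw [if_pos, hk]
          · simp
          rw [Graph.hopcount_eq_top_iff]
          intro k hpath
          refine hE'.notMem_of_mem hvC' (hpath.mem_of_closed ?_ huC)
          rintro i j ⟨s, rfl, rfl⟩ hi
          exact hE.apply_mem (by simp) hk hs hσp hi
        · have hk0 := (Finset.card_pos.2 hk).ne'
          rw [zero_pow hk0]
          rcases Finset.eq_empty_or_nonempty (pending Sigma.fst p' C') with hk' | hk'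
          · rw [if_pos, hk']
            · simp
            rw [Graph.hopcount_eq_top_iff]
            intro k hpath
            refine hE'.notMem_of_mem (hpath.mem_of_closed' ?_ hvC') huC
            rintro i j ⟨s, rfl, rfl⟩ hj
            have := hE'.apply_mem hBp hk' hs' hσ hj
            simpa using this
          · rw [zero_pow (Finset.card_pos.2 hk').ne']
            split_ifs <;> simp)
  rw [one_mul, one_mul, add_assoc] at this
  unfold BiDegree.prob
  convert this

end Hopcount

/-! ### From the Kantorovich-Rubinstein distance to transforms and means -/

section Kantorovich

/-- The floor serves as a measurable left inverse of the embedding of `ℕ` into `ℝ`. -/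
lemma lintegral_natLaw (p : ℕ → ℝ≥0∞) (h : ℕ → ℝ≥0∞) :
    ∫⁻ x, h ⌊x⌋₊ ∂(natLaw p) = ∑' i, p i * h i := by
  rw [natLaw, lintegral_sum_measure]
  refine tsum_congr fun i => ?_
  have hm : Measurable fun x : ℝ => h ⌊x⌋₊ :=
    (Measurable.of_discrete (f := h)).comp Nat.measurable_floor
  rw [lintegral_smul_measure, lintegral_dirac' _ hm, Nat.floor_natCast, smul_eq_mul]

lemma ae_natLaw (p : ℕ → ℝ≥0∞) : ∀ᵐ x ∂(natLaw p), x = (⌊x⌋₊ : ℝ) := by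
  have hm : MeasurableSet {x : ℝ | x = (⌊x⌋₊ : ℝ)} :=
    measurableSet_eq_fun measurable_id
      ((Measurable.of_discrete (f := fun n : ℕ => (n : ℝ))).comp Nat.measurable_floor)
  rw [natLaw, Measure.ae_sum_iff' hm]
  intro i
  refine Measure.ae_smul_measure ?_ _
  rw [ae_dirac_iff hm]
  simp

/-- A coupling of cost at most `c` of two laws on the nonnegative integers. -/
def Coupled (p q : ℕ → ℝ≥0∞) (c : ℝ≥0∞) : Prop :=
  ∃ π : Measure (ℝ × ℝ), π.map Prod.fst = natLaw p ∧ π.map Prod.snd = natLaw q ∧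
    ∫⁻ z, ENNReal.ofReal |z.1 - z.2| ∂π ≤ c

lemma coupled_of_d1_lt {p q : ℕ → ℝ≥0∞} {c : ℝ≥0∞} (h : d1 (natLaw p) (natLaw q) < c) :
    Coupled p q c := by
  unfold d1 at h
  simp only [iInf_lt_iff] at h
  obtain ⟨π, ⟨_, h1, h2⟩, h3⟩ := h
  exact ⟨π, h1, h2, h3.le⟩

lemma Coupled.symm {p q : ℕ → ℝ≥0∞} {c : ℝ≥0∞} (h : Coupled p q c) : Coupled q p c := by
  obtain ⟨π, h1, h2, h3⟩ := h
  refine ⟨π.map Prod.swap, ?_, ?_, ?_⟩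
  · rw [Measure.map_map measurable_fst measurable_swap]
    exact h2
  · rw [Measure.map_map measurable_snd measurable_swap]
    exact h1
  · rw [lintegral_map (by fun_prop) measurable_swap]
    simpa [abs_sub_comm] using h3

/-- Functions with Lipschitz constant `L` have nearly the same means. -/
lemma Coupled.tsum_le {p q : ℕ → ℝ≥0∞} {c : ℝ≥0∞} (h : Coupled p q c) {g : ℕ → ℝ≥0∞} {L : ℝ≥0∞}
    (hg : ∀ i j : ℕ, g i ≤ g j + L * ENNReal.ofReal |(i : ℝ) - j|) :
    ∑' i, p i * g i ≤ ∑' i, q i * g i + L * c := by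
  obtain ⟨π, h1, h2, h3⟩ := h
  have hgm : Measurable fun x : ℝ => g ⌊x⌋₊ :=
    (Measurable.of_discrete (f := g)).comp Nat.measurable_floor
  rw [← lintegral_natLaw, ← lintegral_natLaw, ← h1, ← h2, lintegral_map hgm measurable_fst,
    lintegral_map hgm measurable_snd]
  have e1 : ∀ᵐ z ∂π, z.1 = (⌊z.1⌋₊ : ℝ) := by
    have := ae_natLaw p
    rw [← h1] at this
    exact ae_of_ae_map measurable_fst.aemeasurable this
  have e2 : ∀ᵐ z ∂π, z.2 = (⌊z.2⌋₊ : ℝ) := by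
    have := ae_natLaw q
    rw [← h2] at this
    exact ae_of_ae_map measurable_snd.aemeasurable this
  calc ∫⁻ z, g ⌊z.1⌋₊ ∂π ≤ ∫⁻ z, (g ⌊z.2⌋₊ + L * ENNReal.ofReal |z.1 - z.2|) ∂π := by
        refine lintegral_mono_ae ?_
        filter_upwards [e1, e2] with z hz1 hz2
        have := hg ⌊z.1⌋₊ ⌊z.2⌋₊
        rwa [← hz1, ← hz2] at this
    _ = ∫⁻ z, g ⌊z.2⌋₊ ∂π + L * ∫⁻ z, ENNReal.ofReal |z.1 - z.2| ∂π := by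
        have hgm2 : Measurable fun z : ℝ × ℝ => g ⌊z.2⌋₊ := hgm.comp measurable_snd
        rw [lintegral_add_left hgm2, lintegral_const_mul _ (by fun_prop)]
    _ ≤ _ := by gcongr

lemma tsum_empirical {n : ℕ} (x c : Fin n → ℕ) (M : ℝ≥0∞) (h : ℕ → ℝ≥0∞) :
    ∑' t, ((∑ r, if x r = t then (c r : ℝ≥0∞) else 0) / M) * h t =
      (∑ r, (c r : ℝ≥0∞) * h (x r)) / M := by
  have e : ∀ t, ((∑ r, if x r = t then (c r : ℝ≥0∞) else 0) / M) * h t =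
      ∑ r, if x r = t then (c r : ℝ≥0∞) * h (x r) / M else 0 := by
    intro t
    rw [ENNReal.div_eq_inv_mul, mul_assoc, Finset.sum_mul, Finset.mul_sum]
    refine Finset.sum_congr rfl fun r _ => ?_
    split_ifs with hr
    · rw [hr, ENNReal.div_eq_inv_mul]
    · simp
  simp_rw [e]
  rw [Summable.tsum_finsetSum fun _ _ => ENNReal.summable, ENNReal.div_eq_inv_mul, Finset.mul_sum]
  refine Finset.sum_congr rfl fun r _ => ?_
  rw [tsum_eq_single (x r) (fun t ht => if_neg (Ne.symm ht)), if_pos rfl, ENNReal.div_eq_inv_mul]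

lemma tsum_ofReal_pow (f : PMF ℕ) {q : ℝ} (hq : q ∈ Set.Icc (0 : ℝ) 1) :
    ∑' i, f i * ENNReal.ofReal (q ^ i) = ENNReal.ofReal (genFun f q) := by
  rw [genFun, ENNReal.ofReal_tsum_of_nonneg (fun i => mul_nonneg ENNReal.toReal_nonneg
    (pow_nonneg hq.1 i)) (summable_genFun f hq.1 hq.2)]
  refine tsum_congr fun i => ?_
  rw [ENNReal.ofReal_mul ENNReal.toReal_nonneg, ENNReal.ofReal_toReal (f.apply_ne_top i)]

/-- The Lipschitz constant `1 - q`, rather than a mere bound by `1`, makes the transform errors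
proportional to `1 - q`. Since `1 - q` is small in early generations of a long search, the errors
remain summable. -/
lemma ofReal_pow_lipschitz {q : ℝ} (hq : q ∈ Set.Icc (0 : ℝ) 1) (i j : ℕ) :
    ENNReal.ofReal (q ^ i) ≤
      ENNReal.ofReal (q ^ j) + ENNReal.ofReal (1 - q) * ENNReal.ofReal |(i : ℝ) - j| := by
  have h1 : 0 ≤ 1 - q := by linarith [hq.2]
  rw [← ENNReal.ofReal_mul h1, ← ENNReal.ofReal_add (pow_nonneg hq.1 j) (by positivity)]
  refine ENNReal.ofReal_le_ofReal ?_
  rcases le_total j i with hij | hij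
  · have := pow_le_pow_of_le_one hq.1 hq.2 hij
    have h2 : 0 ≤ (1 - q) * |(i : ℝ) - j| := by positivity
    linarith
  · obtain ⟨m, rfl⟩ := Nat.exists_eq_add_of_le hij
    have h2 := one_sub_pow_le' hq.1 hq.2 m
    have h3 : q ^ i ≤ 1 := pow_le_one₀ hq.1 hq.2
    have h4 : 0 ≤ q ^ i := pow_nonneg hq.1 i
    have h5 : 0 ≤ 1 - q ^ m := sub_nonneg.2 (pow_le_one₀ hq.1 hq.2)
    push_cast
    rw [show (i : ℝ) - (i + m) = -m by ring, abs_neg, Nat.abs_cast, pow_add]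
    nlinarith

/-- The transform of a law which is close to `f`. -/
lemma Coupled.abs_sub_genFun_le {n : ℕ} {x c : Fin n → ℕ} {M : ℝ} {f : PMF ℕ} {e : ℝ} (hM : 0 < M)
    (he : 0 ≤ e)
    (h : Coupled (fun t => (∑ r, if x r = t then (c r : ℝ≥0∞) else 0) / ENNReal.ofReal M) f
      (ENNReal.ofReal e)) {q : ℝ} (hq : q ∈ Set.Icc (0 : ℝ) 1) :
    |∑ r, (c r : ℝ) * q ^ x r - M * genFun f q| ≤ e * (1 - q) * M := by
  have h1 := h.tsum_le (ofReal_pow_lipschitz hq)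
  have h2 := h.symm.tsum_le (ofReal_pow_lipschitz hq)
  have hq1 : 0 ≤ 1 - q := by linarith [hq.2]
  have hnn : 0 ≤ ∑ r, (c r : ℝ) * q ^ x r :=
    Finset.sum_nonneg fun r _ => mul_nonneg (Nat.cast_nonneg _) (pow_nonneg hq.1 _)
  have e1 : (∑ r, (c r : ℝ≥0∞) * ENNReal.ofReal (q ^ x r)) / ENNReal.ofReal M =
      ENNReal.ofReal ((∑ r, (c r : ℝ) * q ^ x r) / M) := by
    rw [ENNReal.ofReal_div_of_pos hM, ENNReal.ofReal_sum_of_nonneg fun r _ =>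
      mul_nonneg (Nat.cast_nonneg _) (pow_nonneg hq.1 _)]
    congr 1
    refine Finset.sum_congr rfl fun r _ => ?_
    rw [ENNReal.ofReal_mul (Nat.cast_nonneg _), ENNReal.ofReal_natCast]
  have hF := genFun_nonneg f hq.1
  rw [tsum_empirical, tsum_ofReal_pow f hq, e1, ← ENNReal.ofReal_mul hq1,
    ← ENNReal.ofReal_add (by positivity) (by positivity),
    ENNReal.ofReal_le_ofReal_iff (by positivity)] at h1 h2
  rw [div_le_iff₀ hM] at h1
  rw [div_add' _ _ _ hM.ne', le_div_iff₀ hM] at h2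
  rw [abs_le]
  constructor <;> linarith

lemma Coupled.abs_sub_mean_le {n : ℕ} {x c : Fin n → ℕ} {M : ℝ} {f : PMF ℕ} {e μ : ℝ} (hM : 0 < M)
    (he : 0 ≤ e) (hμ : 0 ≤ μ) (hf : pmfMean f = ENNReal.ofReal μ)
    (h : Coupled (fun t => (∑ r, if x r = t then (c r : ℝ≥0∞) else 0) / ENNReal.ofReal M) f
      (ENNReal.ofReal e)) :
    |∑ r, (c r : ℝ) * x r - M * μ| ≤ e * M := by
  have hl : ∀ i j : ℕ, (i : ℝ≥0∞) ≤ j + 1 * ENNReal.ofReal |(i : ℝ) - j| := by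
    intro i j
    rw [one_mul, ← ENNReal.ofReal_natCast, ← ENNReal.ofReal_natCast,
      ← ENNReal.ofReal_add (Nat.cast_nonneg _) (abs_nonneg _)]
    exact ENNReal.ofReal_le_ofReal (by linarith [le_abs_self ((i : ℝ) - j)])
  have h1 := h.tsum_le hl
  have h2 := h.symm.tsum_le hl
  have hnn : 0 ≤ ∑ r, (c r : ℝ) * x r := Finset.sum_nonneg fun r _ => by positivity
  have e1 : (∑ r, (c r : ℝ≥0∞) * (x r : ℝ≥0∞)) / ENNReal.ofReal M =
      ENNReal.ofReal ((∑ r, (c r : ℝ) * x r) / M) := by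
    rw [ENNReal.ofReal_div_of_pos hM, ENNReal.ofReal_sum_of_nonneg fun r _ => by positivity]
    congr 1
    refine Finset.sum_congr rfl fun r _ => ?_
    rw [ENNReal.ofReal_mul (Nat.cast_nonneg _), ENNReal.ofReal_natCast, ENNReal.ofReal_natCast]
  have e2 : ∑' i : ℕ, f i * (i : ℝ≥0∞) = ENNReal.ofReal μ := by
    rw [← hf, pmfMean]
    exact tsum_congr fun i => mul_comm _ _
  rw [tsum_empirical, e2, e1, one_mul, ← ENNReal.ofReal_add (by positivity) (by positivity),
    ENNReal.ofReal_le_ofReal_iff (by positivity)] at h1 h2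
  rw [div_le_iff₀ hM] at h1
  rw [div_add' _ _ _ hM.ne', le_div_iff₀ hM] at h2
  rw [abs_le]
  constructor <;> linarith

end Kantorovich

/-! ### Regular bi-degree sequences satisfy the one-step hypotheses -/

section Regular

variable {n : ℕ} {d : BiDegree n} {gp gm fp fm : PMF ℕ} {ε κ K μ ν : ℝ}

/-- The sequence with the roles of in-degrees and out-degrees exchanged. -/
def BiDegree.reverse (d : BiDegree n) : BiDegree n := ⟨d.outDeg, d.inDeg, d.sum_eq.symm⟩

lemma BiDegree.edges_reverse (d : BiDegree n) : d.reverse.edges = d.edges := d.sum_eq.symm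

/-- The strict inequality for `e` produces couplings without knowing that the infimum in `d1` is
attained. -/
lemma BiDegree.Regular.coupled (h : d.Regular gp gm fp fm ε κ K) {e : ℝ} (hn : 0 < n)
    (he : (n : ℝ) ^ (-ε) < e) :
    Coupled d.gPlus gp (ENNReal.ofReal e) ∧ Coupled d.gMinus gm (ENNReal.ofReal e) ∧
    Coupled d.fPlus fp (ENNReal.ofReal e) ∧ Coupled d.fMinus fm (ENNReal.ofReal e) := by
  have hlt : ENNReal.ofReal ((n : ℝ) ^ (-ε)) < ENNReal.ofReal e := by
    have : 0 < (n : ℝ) ^ (-ε) := Real.rpow_pos_of_pos (by exact_mod_cast hn) _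
    exact (ENNReal.ofReal_lt_ofReal_iff (this.trans he)).2 he
  have h1 := h.1.trans_lt hlt
  simp only [max_lt_iff] at h1
  exact ⟨coupled_of_d1_lt h1.1.1, coupled_of_d1_lt h1.1.2, coupled_of_d1_lt h1.2.1,
    coupled_of_d1_lt h1.2.2⟩

lemma BiDegree.gPlus_eq (d : BiDegree n) : d.gPlus = fun t =>
    (∑ r, if d.outDeg r = t then (((fun _ => 1 : Fin n → ℕ) r : ℕ) : ℝ≥0∞) else 0) /
      ENNReal.ofReal (n : ℝ) := by
  funext t
  simp [BiDegree.gPlus]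

lemma BiDegree.fPlus_eq (d : BiDegree n) : d.fPlus = fun t =>
    (∑ r, if d.outDeg r = t then (d.inDeg r : ℝ≥0∞) else 0) / ENNReal.ofReal (d.edges : ℝ) := by
  funext t
  simp [BiDegree.fPlus]

lemma BiDegree.gPlus_reverse (d : BiDegree n) : d.reverse.gPlus = d.gMinus := rfl

lemma BiDegree.fPlus_reverse (d : BiDegree n) : d.reverse.fPlus = d.fMinus := by
  funext t
  simp only [BiDegree.fPlus, BiDegree.edges_reverse]
  rfl

/-- Truncation at level `A`: if both numbers are at most `A`, the product is at most `A ^ 2`;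
otherwise `x ^ κ + y ^ κ ≥ A ^ κ`. -/
lemma mul_le_add_moment {x y A κ : ℝ} (hx : 0 ≤ x) (hy : 0 ≤ y) (hA : 0 < A) (hκ : 0 < κ) :
    x * y ≤ A ^ 2 + A ^ (-κ) * ((x ^ κ + y ^ κ) * y * x) := by
  have hAκ : 0 < A ^ (-κ) := Real.rpow_pos_of_pos hA _
  have hxκ : 0 ≤ x ^ κ := Real.rpow_nonneg hx _
  have hyκ : 0 ≤ y ^ κ := Real.rpow_nonneg hy _
  have hnn : 0 ≤ A ^ (-κ) * ((x ^ κ + y ^ κ) * y * x) := by positivity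
  have hA1 : A ^ (-κ) * A ^ κ = 1 := by rw [← Real.rpow_add hA]; simp
  have hxy : 0 ≤ x * y := mul_nonneg hx hy
  by_cases hxA : A < x
  · have h1 : 1 ≤ A ^ (-κ) * (x ^ κ + y ^ κ) := by
      rw [← hA1]
      have := Real.rpow_le_rpow hA.le hxA.le hκ.le
      exact mul_le_mul_of_nonneg_left (by linarith) hAκ.le
    nlinarith [sq_nonneg A]
  by_cases hyA : A < y
  · have h1 : 1 ≤ A ^ (-κ) * (x ^ κ + y ^ κ) := by
      rw [← hA1]
      have := Real.rpow_le_rpow hA.le hyA.le hκ.le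
      exact mul_le_mul_of_nonneg_left (by linarith) hAκ.le
    nlinarith [sq_nonneg A]
  push Not at hxA hyA
  nlinarith [mul_le_mul hxA hyA hy hA.le]

lemma BiDegree.sum_mul_le (d : BiDegree n) (hκ : 0 < κ)
    (hm : ∑ r, ((d.inDeg r : ℝ) ^ κ + (d.outDeg r : ℝ) ^ κ) * (d.outDeg r : ℝ) * (d.inDeg r : ℝ)
      ≤ K * (n : ℝ)) {A : ℝ} (hA : 0 < A) (Q : Finset (Fin n)) :
    ∑ r ∈ Q, (d.inDeg r : ℝ) * d.outDeg r ≤ Q.card * A ^ 2 + A ^ (-κ) * (K * n) := by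
  refine (Finset.sum_le_sum fun r _ => mul_le_add_moment (Nat.cast_nonneg (d.inDeg r))
    (Nat.cast_nonneg (d.outDeg r)) hA hκ).trans ?_
  rw [Finset.sum_add_distrib, Finset.sum_const, nsmul_eq_mul, ← Finset.mul_sum]
  refine add_le_add le_rfl (mul_le_mul_of_nonneg_left ?_ (Real.rpow_nonneg hA.le _))
  exact (Finset.sum_le_sum_of_subset_of_nonneg (Finset.subset_univ _)
    fun r _ _ => by positivity).trans hm

lemma BiDegree.nearLaw (d : BiDegree n) {f : PMF ℕ} {N e δ t A : ℝ} (hN : (d.edges : ℝ) = N)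
    (hN0 : 0 < N) (he0 : 0 ≤ e) (heδ : e ≤ δ) (hδ : δ ≤ 1 / 2) (ht : 0 < t) (hA : 0 < A)
    (hκ : 0 < κ) (hμ : 0 ≤ μ) (hf : pmfMean f = ENNReal.ofReal μ)
    (hc : Coupled d.fPlus f (ENNReal.ofReal e))
    (hm : ∑ r, ((d.inDeg r : ℝ) ^ κ + (d.outDeg r : ℝ) ^ κ) * (d.outDeg r : ℝ) * (d.inDeg r : ℝ)
      ≤ K * (n : ℝ)) (h1 : t ≤ δ * N) (h2 : (t + 2) * A ^ 2 + A ^ (-κ) * (K * n) ≤ δ * N) :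
    NearLaw (V := Fin n) (Sigma.fst : d.OutStub → Fin n) (Sigma.fst : d.InStub → Fin n) f μ δ t := by
  rw [BiDegree.fPlus_eq, hN] at hc
  refine ⟨he0.trans heδ, hδ, ht, ?_, ?_, ?_, ?_⟩
  · rw [BiDegree.card_inStub, hN]; exact h1
  · intro q hq
    rw [BiDegree.card_inStub, hN, Fintype.sum_sigma]
    simp only [BiDegree.stubCount_out, Finset.sum_const, Finset.card_univ, Fintype.card_fin,
      nsmul_eq_mul]
    refine (hc.abs_sub_genFun_le hN0 he0 hq).trans ?_
    have : 0 ≤ 1 - q := by linarith [hq.2]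
    gcongr
  · rw [BiDegree.card_inStub, hN, Fintype.sum_sigma]
    simp only [BiDegree.stubCount_out, Finset.sum_const, Finset.card_univ, Fintype.card_fin,
      nsmul_eq_mul]
    have := abs_le.1 (hc.abs_sub_mean_le hN0 he0 hμ hf)
    have h3 : e * N ≤ δ * N := mul_le_mul_of_nonneg_right heδ hN0.le
    linarith [this.2]
  · intro Q hQ
    rw [BiDegree.card_inStub, hN, Finset.sum_filter, Fintype.sum_sigma]
    simp only [BiDegree.stubCount_out, Finset.sum_const, Finset.card_univ, Fintype.card_fin,
      nsmul_eq_mul, mul_ite, mul_zero]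
    rw [← Finset.sum_filter, Finset.filter_univ_mem]
    refine (d.sum_mul_le hκ hm hA Q).trans (le_trans ?_ h2)
    have := mul_le_mul_of_nonneg_right hQ (sq_nonneg A)
    linarith

lemma BiDegree.nearRoot (d : BiDegree n) {g : PMF ℕ} {e : ℝ} (hn : 0 < n) (he : 0 ≤ e)
    (hc : Coupled d.gPlus g (ENNReal.ofReal e)) :
    NearRoot (V := Fin n) (Sigma.fst : d.OutStub → Fin n) g e := by
  intro q hq
  rw [BiDegree.gPlus_eq] at hc
  have hn' : (0 : ℝ) < n := by exact_mod_cast hn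
  have := hc.abs_sub_genFun_le hn' he hq
  simp only [Nat.cast_one, one_mul] at this
  simp only [BiDegree.stubCount_out, Fintype.card_fin]
  refine this.trans (mul_le_mul_of_nonneg_right ?_ hn'.le)
  exact mul_le_of_le_one_right he (by linarith [hq.1])

lemma NearRoot.mono {V α : Type*} [Fintype V] [Fintype α] [DecidableEq V]
    {a : α → V} {g : PMF ℕ} {e δ : ℝ} (h : NearRoot a g e) (hle : e ≤ δ) : NearRoot a g δ :=
  fun q hq => (h q hq).trans (mul_le_mul_of_nonneg_right hle (Nat.cast_nonneg _))

/-- The number of edges is `n` times the mean of `gMinus`, and the identity is 1-Lipschitz. -/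
lemma BiDegree.Regular.abs_edges_sub_le (h : d.Regular gp gm fp fm ε κ K) (hn : 0 < n)
    (hν : 0 < ν) (hgm : pmfMean gm = ENNReal.ofReal ν) {e : ℝ} (he : (n : ℝ) ^ (-ε) < e) :
    |(d.edges : ℝ) - n * ν| ≤ e * n := by
  have hn' : (0 : ℝ) < n := by exact_mod_cast hn
  have he0 : 0 ≤ e := (Real.rpow_nonneg hn'.le _).trans he.le
  obtain ⟨-, hc, -, -⟩ := h.coupled hn he
  rw [← BiDegree.gPlus_reverse, BiDegree.gPlus_eq] at hc
  have := hc.abs_sub_mean_le hn' he0 hν.le hgm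
  simp only [Nat.cast_one, one_mul] at this
  simpa [BiDegree.edges, BiDegree.reverse] using this

theorem BiDegree.Regular.near (h : d.Regular gp gm fp fm ε κ K) (hn : 0 < n)
    (hν : 0 < ν) (hμ : 1 < μ) (hgm : pmfMean gm = ENNReal.ofReal ν)
    (hfp : pmfMean fp = ENNReal.ofReal μ) (hfm : pmfMean fm = ENNReal.ofReal μ) (hκ : 0 < κ)
    {e δ t A : ℝ} (he : (n : ℝ) ^ (-ε) < e) (heν : e ≤ ν / 2) (heδ : e ≤ δ) (hδ : δ ≤ 1 / 2)
    (ht : 0 < t) (htn : t ≤ n) (hA : 0 < A) (h1 : t ≤ δ * (ν / 2 * n))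
    (h2 : (t + 2) * A ^ 2 + A ^ (-κ) * (K * n) ≤ δ * (ν / 2 * n)) :
    d.Near gp gm fp fm μ δ t (2 * ν) := by
  have hn' : (0 : ℝ) < n := by exact_mod_cast hn
  have he0 : 0 ≤ e := (Real.rpow_nonneg hn'.le _).trans he.le
  have hN := abs_le.1 (h.abs_edges_sub_le hn hν hgm he)
  have hen : e * n ≤ ν / 2 * n := mul_le_mul_of_nonneg_right heν hn'.le
  have hNl : ν / 2 * n ≤ d.edges := by linarith [hN.1]
  have hNu : (d.edges : ℝ) ≤ 2 * ν * n := by nlinarith [hN.2]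
  have hN0 : (0 : ℝ) < d.edges := lt_of_lt_of_le (by positivity) hNl
  have hδ0 : 0 ≤ δ := he0.trans heδ
  have hδN : δ * (ν / 2 * n) ≤ δ * d.edges := mul_le_mul_of_nonneg_left hNl hδ0
  obtain ⟨c1, c2, c3, c4⟩ := h.coupled hn he
  refine ⟨d.nearLaw rfl hN0 he0 heδ hδ ht hA hκ (by linarith) hfp c3 h.2 (h1.trans hδN)
    (h2.trans hδN), ?_, (d.nearRoot hn he0 c1).mono heδ, ?_, hn, htn, hNu⟩
  · rw [← BiDegree.fPlus_reverse] at c4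
    refine d.reverse.nearLaw (by rw [BiDegree.edges_reverse]) hN0 he0 heδ hδ ht hA hκ
      (by linarith) hfm c4 (le_trans (le_of_eq ?_) h.2) (h1.trans hδN) (h2.trans hδN)
    refine Finset.sum_congr rfl fun r _ => ?_
    simp only [BiDegree.reverse]
    ring
  · rw [← BiDegree.gPlus_reverse] at c2
    exact (d.reverse.nearRoot hn he0 c2).mono heδ

/-- The rates that are used for the one-step errors and for the number of exploration steps. -/
theorem eventually_near (hν : 0 < ν) (hμ : 1 < μ) (hgm : pmfMean gm = ENNReal.ofReal ν)
    (hfp : pmfMean fp = ENNReal.ofReal μ) (hfm : pmfMean fm = ENNReal.ofReal μ) (hε : 0 < ε)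
    (hκ : 0 < κ) (hκ1 : κ ≤ 1) : ∃ c C : ℝ, 0 < c ∧ c ≤ 1 / 8 ∧ 0 < C ∧ ∀ᶠ n : ℕ in atTop,
      ∀ d : BiDegree n, d.Regular gp gm fp fm ε κ K →
        d.Near gp gm fp fm μ (C * (n : ℝ) ^ (-c)) ((n : ℝ) ^ (5 / 8 : ℝ)) (2 * ν) ∧
        |(d.edges : ℝ) - n * ν| ≤ 2 * (n : ℝ) ^ (-c) * n := by
  -- With `t = n ^ (5/8)`, which exceeds the size `√n` of the searches, and truncation at `A = n ^
  -- (1/8)`, the mass on few nodes is of order `t A ^ 2 = n ^ (7/8)` plus `A ^ (-κ) n = n ^ (1 -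
  -- κ/8)`. Both are at most `n ^ (1 - c)`.
  set c := min ε (κ / 8) with hc
  have hc0 : 0 < c := lt_min hε (by linarith)
  have hc8 : c ≤ 1 / 8 := (min_le_right _ _).trans (by linarith)
  -- The summand `2` gives `2 n ^ (-c) ≤ δ`; the rest makes `δ (ν / 2) n` exceed `(3 + max K 0) n ^
  -- (1 - c)`, which bounds the mass on few nodes.
  set C := 2 + 2 / ν * (3 + max K 0) with hC
  have hC0 : 2 < C := by
    have : 0 ≤ max K 0 := le_max_right _ _
    have : 0 < 2 / ν * (3 + max K 0) := by positivity
    linarith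
  refine ⟨c, C, hc0, hc8, by linarith, ?_⟩
  have hlim : Tendsto (fun n : ℕ => (n : ℝ) ^ (-c)) atTop (𝓝 0) :=
    (tendsto_rpow_neg_atTop hc0).comp tendsto_natCast_atTop_atTop
  have hsmall : ∀ᶠ n : ℕ in atTop, (n : ℝ) ^ (-c) < min (ν / 4) (1 / (2 * C)) :=
    hlim.eventually_lt_const (by positivity)
  filter_upwards [hsmall, eventually_ge_atTop 1] with n hn hn1 d hd
  have hn' : (1 : ℝ) ≤ n := by exact_mod_cast hn1
  have hn0 : (0 : ℝ) < n := by linarith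
  set x := (n : ℝ) ^ (-c) with hx
  have hx0 : 0 < x := Real.rpow_pos_of_pos hn0 _
  have hxε : (n : ℝ) ^ (-ε) ≤ x :=
    Real.rpow_le_rpow_of_exponent_le hn' (neg_le_neg (min_le_left _ _))
  have hx1 : x < ν / 4 := hn.trans_le (min_le_left _ _)
  have hx2 : x < 1 / (2 * C) := hn.trans_le (min_le_right _ _)
  have he : (n : ℝ) ^ (-ε) < 2 * x := by linarith
  refine ⟨hd.near hn1 hν hμ hgm hfp hfm hκ (e := 2 * x) (A := (n : ℝ) ^ (1 / 8 : ℝ)) he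
    (by linarith) (by nlinarith) ?_ (by positivity) ?_ (by positivity) ?_ ?_,
    hd.abs_edges_sub_le hn1 hν hgm he⟩
  · rw [lt_div_iff₀ (by linarith)] at hx2
    linarith
  · calc (n : ℝ) ^ (5 / 8 : ℝ) ≤ (n : ℝ) ^ (1 : ℝ) :=
        Real.rpow_le_rpow_of_exponent_le hn' (by norm_num)
      _ = n := Real.rpow_one _
  all_goals
    have hxn : x * n = (n : ℝ) ^ (1 - c) := by
      rw [hx]
      nth_rewrite 2 [← Real.rpow_one (n : ℝ)]
      rw [← Real.rpow_add hn0]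
      ring_nf
    have hCν : C * (ν / 2) = ν + (3 + max K 0) := by
      rw [hC]; field_simp
    have hrhs : C * x * (ν / 2 * n) = (ν + (3 + max K 0)) * (n : ℝ) ^ (1 - c) := by
      rw [← hxn, ← hCν]; ring
    rw [hrhs]
    have hp : 0 < (n : ℝ) ^ (1 - c) := by positivity
    have hK0 : 0 ≤ max K 0 := le_max_right _ _
    have h58 : (n : ℝ) ^ (5 / 8 : ℝ) ≤ (n : ℝ) ^ (1 - c) :=
      Real.rpow_le_rpow_of_exponent_le hn' (by linarith)
  · nlinarith
  · have e1 : ((n : ℝ) ^ (1 / 8 : ℝ)) ^ 2 = (n : ℝ) ^ (1 / 4 : ℝ) := by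
      rw [← Real.rpow_natCast, ← Real.rpow_mul hn0.le]
      norm_num
    have e2 : ((n : ℝ) ^ (1 / 8 : ℝ)) ^ (-κ) = (n : ℝ) ^ (-(κ / 8)) := by
      rw [← Real.rpow_mul hn0.le]
      ring_nf
    have e3 : (n : ℝ) ^ (5 / 8 : ℝ) * (n : ℝ) ^ (1 / 4 : ℝ) ≤ (n : ℝ) ^ (1 - c) := by
      rw [← Real.rpow_add hn0]
      exact Real.rpow_le_rpow_of_exponent_le hn' (by linarith)
    have e4 : (n : ℝ) ^ (1 / 4 : ℝ) ≤ (n : ℝ) ^ (1 - c) :=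
      Real.rpow_le_rpow_of_exponent_le hn' (by linarith)
    have e5 : (n : ℝ) ^ (-(κ / 8)) * n ≤ (n : ℝ) ^ (1 - c) := by
      nth_rewrite 2 [← Real.rpow_one (n : ℝ)]
      rw [← Real.rpow_add hn0]
      exact Real.rpow_le_rpow_of_exponent_le hn' (by linarith [min_le_right ε (κ / 8)])
    have e6 : (n : ℝ) ^ (-(κ / 8)) * (K * n) ≤ max K 0 * (n : ℝ) ^ (1 - c) := by
      calc (n : ℝ) ^ (-(κ / 8)) * (K * n) = K * ((n : ℝ) ^ (-(κ / 8)) * n) := by ring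
        _ ≤ max K 0 * ((n : ℝ) ^ (-(κ / 8)) * n) :=
          mul_le_mul_of_nonneg_right (le_max_left _ _) (by positivity)
        _ ≤ _ := mul_le_mul_of_nonneg_left e5 hK0
    rw [e1, e2]
    nlinarith

end Regular

/-! ### Delayed Galton-Watson processes: independence of generations and transforms -/

section Branching

lemma measurable_sum_range {Ω : Type*} {m : MeasurableSpace Ω} {Z : Ω → ℕ} (hZ : Measurable Z)
    {Y : ℕ → Ω → ℕ} (hY : ∀ i, Measurable (Y i)) :
    Measurable fun ω => ∑ i ∈ Finset.range (Z ω), Y i ω := by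
  have h : Measurable fun x : ℕ × Ω => ∑ i ∈ Finset.range x.1, Y i x.2 :=
    measurable_from_prod_countable_right fun z => by
      simpa using Finset.measurable_fun_sum (Finset.range z) fun i _ => hY i
  exact h.comp (hZ.prodMk measurable_id)

/-- The sigma-algebra generated by the offspring numbers of the generations before `k`. -/
def rowFiltration : Filtration ℕ (inferInstance : MeasurableSpace (ℕ × ℕ → ℕ)) where
  seq k := ⨆ p ∈ {p : ℕ × ℕ | p.1 < k}, MeasurableSpace.comap (fun χ => χ p) ⊤
  mono' _ _ hkl := iSup₂_le fun p hp =>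
    le_iSup₂_of_le p (lt_of_lt_of_le (by exact hp) hkl) le_rfl
  le' k := iSup₂_le fun p _ => (measurable_pi_apply p).comap_le

/-- The sigma-algebra generated by the offspring numbers of generation `k`. -/
abbrev rowSigma (k : ℕ) : MeasurableSpace (ℕ × ℕ → ℕ) :=
  ⨆ p ∈ {p : ℕ × ℕ | p.1 = k}, MeasurableSpace.comap (fun χ => χ p) ⊤

lemma rowSigma_le (k : ℕ) : rowSigma k ≤ inferInstanceAs (MeasurableSpace (ℕ × ℕ → ℕ)) :=
  iSup₂_le fun p _ => (measurable_pi_apply p).comap_le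

lemma measurable_apply_rowFiltration {p : ℕ × ℕ} {k : ℕ} (h : p.1 < k) :
    Measurable[rowFiltration k] fun χ : ℕ × ℕ → ℕ => χ p :=
  Measurable.of_comap_le (le_iSup₂_of_le (f := fun (p : ℕ × ℕ) (_ : p ∈ {p : ℕ × ℕ | p.1 < k}) =>
    MeasurableSpace.comap (fun χ : ℕ × ℕ → ℕ => χ p) ⊤) p h le_rfl)

lemma measurable_apply_rowSigma {p : ℕ × ℕ} {k : ℕ} (h : p.1 = k) :
    Measurable[rowSigma k] fun χ : ℕ × ℕ → ℕ => χ p :=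
  Measurable.of_comap_le (le_iSup₂_of_le (f := fun (p : ℕ × ℕ) (_ : p ∈ {p : ℕ × ℕ | p.1 = k}) =>
    MeasurableSpace.comap (fun χ : ℕ × ℕ → ℕ => χ p) ⊤) p h le_rfl)

lemma measurable_genSize_rowFiltration (k : ℕ) :
    Measurable[rowFiltration k] fun χ => genSize χ k := by
  induction k with
  | zero => exact measurable_const
  | succ k ih =>
    exact measurable_sum_range (m := rowFiltration (k + 1))
      (ih.mono (rowFiltration.mono (Nat.le_succ k)) le_rfl)
      fun i => measurable_apply_rowFiltration (Nat.lt_succ_self k)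

lemma measurable_genSize (k : ℕ) : Measurable fun χ => genSize χ k :=
  (measurable_genSize_rowFiltration k).mono (rowFiltration.le k) le_rfl

variable (g f : PMF ℕ)

/-- The offspring law in generation `k`. -/
noncomputable def rowLaw (k : ℕ) : PMF ℕ := if k = 0 then g else f

instance : IsProbabilityMeasure (offspringLaw g f) := by
  unfold offspringLaw
  infer_instance

lemma iIndepFun_offspring : iIndepFun (fun (p : ℕ × ℕ) (χ : ℕ × ℕ → ℕ) => χ p)
    (offspringLaw g f) :=
  iIndepFun_infinitePi (X := fun _ x => x) fun _ => measurable_id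

lemma lintegral_offspring (p : ℕ × ℕ) (φ : ℕ → ℝ≥0∞) :
    ∫⁻ χ, φ (χ p) ∂(offspringLaw g f) = ∑' j, rowLaw g f p.1 j * φ j := by
  have h : (offspringLaw g f).map (fun χ => χ p) = (rowLaw g f p.1).toMeasure :=
    Measure.infinitePi_map_eval _ p
  rw [← lintegral_map (f := φ) (g := fun χ : ℕ × ℕ → ℕ => χ p) Measurable.of_discrete
    (measurable_pi_apply p), h, lintegral_countable']
  refine tsum_congr fun j => ?_
  rw [PMF.toMeasure_apply_singleton _ _ (measurableSet_singleton j), mul_comm]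

lemma indep_rows (k : ℕ) : Indep (rowFiltration k) (rowSigma k) (offspringLaw g f) := by
  refine indep_iSup_of_disjoint (fun p => (measurable_pi_apply p).comap_le)
    (iIndepFun_offspring g f) ?_
  rw [Set.disjoint_left]
  intro p (h1 : p.1 < k) (h2 : p.1 = k)
  omega

variable {g f}

/-- Decomposition according to the size of generation `k`, where the next generation is independent
of the past. -/
lemma lintegral_mul_genSize {k : ℕ} {h : (ℕ × ℕ → ℕ) → ℝ≥0∞} (hh : Measurable[rowFiltration k] h)
    {Ψ : ℕ → (ℕ × ℕ → ℕ) → ℝ≥0∞} (hΨ : ∀ z, Measurable[rowSigma k] (Ψ z)) :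
    ∫⁻ χ, h χ * Ψ (genSize χ k) χ ∂(offspringLaw g f) =
      ∫⁻ χ, h χ * (∫⁻ χ', Ψ (genSize χ k) χ' ∂(offspringLaw g f)) ∂(offspringLaw g f) := by
  -- On the event that generation `k` has size `z` the random index is frozen, and `Ψ z` is
  -- independent of the past.
  set I : ℕ → (ℕ × ℕ → ℕ) → ℝ≥0∞ := fun z χ => if genSize χ k = z then 1 else 0 with hI
  have hIm : ∀ z, Measurable[rowFiltration k] (I z) := fun z =>
    Measurable.ite (measurable_genSize_rowFiltration k (measurableSet_singleton z))
      measurable_const measurable_const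
  have hhI : ∀ z, Measurable[rowFiltration k] fun χ => h χ * I z χ := fun z => hh.mul (hIm z)
  have e1 : ∀ χ, h χ * Ψ (genSize χ k) χ = ∑' z, (h χ * I z χ) * Ψ z χ := by
    intro χ
    rw [tsum_eq_single (genSize χ k)]
    · simp [hI]
    · intro z hz
      simp [hI, hz.symm]
  have e2 : ∀ χ, h χ * (∫⁻ χ', Ψ (genSize χ k) χ' ∂(offspringLaw g f)) =
      ∑' z, (h χ * I z χ) * (∫⁻ χ', Ψ z χ' ∂(offspringLaw g f)) := by
    intro χ
    rw [tsum_eq_single (genSize χ k)]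
    · simp [hI]
    · intro z hz
      simp [hI, hz.symm]
  have hm1 : ∀ z, Measurable fun χ => h χ * I z χ := fun z =>
    (hhI z).mono (rowFiltration.le k) le_rfl
  have hm2 : ∀ z, Measurable (Ψ z) := fun z => (hΨ z).mono (rowSigma_le k) le_rfl
  have hm3 : ∀ z, AEMeasurable (fun χ => (h χ * I z χ) * Ψ z χ) (offspringLaw g f) := fun z =>
    ((hm1 z).mul (hm2 z)).aemeasurable
  have hm4 : ∀ z, AEMeasurable (fun χ => (h χ * I z χ) *
      (∫⁻ χ', Ψ z χ' ∂(offspringLaw g f))) (offspringLaw g f) := fun z =>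
    ((hm1 z).mul_const _).aemeasurable
  rw [lintegral_congr e1, lintegral_congr e2, lintegral_tsum hm3, lintegral_tsum hm4]
  refine tsum_congr fun z => ?_
  rw [lintegral_mul_eq_lintegral_mul_lintegral_of_independent_measurableSpace (rowFiltration.le k)
    (rowSigma_le k) (indep_rows g f k) (hhI z) (hΨ z), lintegral_mul_const _ (hm1 z)]

/-- The branching property: given the past, the offspring numbers of generation `k` are independent
and identically distributed, so the product integrates to a power. -/
lemma lintegral_mul_prod_offspring {k : ℕ} {h : (ℕ × ℕ → ℕ) → ℝ≥0∞}
    (hh : Measurable[rowFiltration k] h) (φ : ℕ → ℝ≥0∞) :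
    ∫⁻ χ, h χ * ∏ i ∈ Finset.range (genSize χ k), φ (χ (k, i)) ∂(offspringLaw g f) =
      ∫⁻ χ, h χ * (∑' j, rowLaw g f k j * φ j) ^ genSize χ k ∂(offspringLaw g f) := by
  have hφ : ∀ i, Measurable[rowSigma k] fun χ : ℕ × ℕ → ℕ => φ (χ (k, i)) := fun i =>
    (Measurable.of_discrete (f := φ)).comp (measurable_apply_rowSigma rfl)
  rw [lintegral_mul_genSize hh (Ψ := fun z χ => ∏ i ∈ Finset.range z, φ (χ (k, i)))
    fun z => Finset.measurable_fun_prod _ fun i _ => hφ i]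
  refine lintegral_congr fun χ => ?_
  congr 1
  have hind : iIndepFun (fun (i : ℕ) (χ : ℕ × ℕ → ℕ) => φ (χ (k, i))) (offspringLaw g f) :=
    ((iIndepFun_offspring g f).precomp (g := fun i : ℕ => (k, i))
      (fun i j hij => (Prod.mk.inj hij).2)).comp (fun _ => φ) fun _ => Measurable.of_discrete
  rw [lintegral_prod_eq_prod_lintegral_of_indepFun _ _ hind
    fun i => (hφ i).mono (rowSigma_le k) le_rfl]
  simp_rw [lintegral_offspring g f (k, _) φ]
  simp

/-- Wald's identity weighted by a function of the past; it is the source of the means and of the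
martingale property. -/
lemma lintegral_mul_genSize_succ {k : ℕ} {h : (ℕ × ℕ → ℕ) → ℝ≥0∞}
    (hh : Measurable[rowFiltration k] h) :
    ∫⁻ χ, h χ * genSize χ (k + 1) ∂(offspringLaw g f) =
      pmfMean (rowLaw g f k) * ∫⁻ χ, h χ * genSize χ k ∂(offspringLaw g f) := by
  have hφ : ∀ i, Measurable[rowSigma k] fun χ : ℕ × ℕ → ℕ => (χ (k, i) : ℝ≥0∞) := fun i =>
    (Measurable.of_discrete (f := fun j : ℕ => (j : ℝ≥0∞))).comp (measurable_apply_rowSigma rfl)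
  have e : ∀ χ, (genSize χ (k + 1) : ℝ≥0∞) =
      ∑ i ∈ Finset.range (genSize χ k), (χ (k, i) : ℝ≥0∞) := fun χ => by simp [genSize]
  simp_rw [e]
  rw [lintegral_mul_genSize hh (Ψ := fun z χ => ∑ i ∈ Finset.range z, (χ (k, i) : ℝ≥0∞))
    fun z => Finset.measurable_fun_sum _ fun i _ => hφ i, ← lintegral_const_mul]
  · refine lintegral_congr fun χ => ?_
    rw [lintegral_finsetSum _ fun i _ => (hφ i).mono (rowSigma_le k) le_rfl]
    simp_rw [lintegral_offspring g f (k, _) fun j => (j : ℝ≥0∞)]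
    rw [Finset.sum_const, Finset.card_range, nsmul_eq_mul, pmfMean]
    simp_rw [mul_comm (rowLaw g f k _)]
    ring
  · exact (hh.mono (rowFiltration.le k) le_rfl).mul
      ((Measurable.of_discrete (f := fun j : ℕ => (j : ℝ≥0∞))).comp (measurable_genSize k))

/-- The total progeny of the generations `1, …, b`. -/
def progeny (χ : ℕ × ℕ → ℕ) (b : ℕ) : ℕ := ∑ j ∈ Finset.range b, genSize χ (j + 1)

lemma measurable_progeny_rowFiltration (b : ℕ) :
    Measurable[rowFiltration b] fun χ => progeny χ b :=
  Finset.measurable_fun_sum _ fun j hj =>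
    (measurable_genSize_rowFiltration (j + 1)).mono
      (rowFiltration.mono (Nat.succ_le_of_lt (Finset.mem_range.1 hj))) le_rfl

lemma measurable_progeny (b : ℕ) : Measurable fun χ => progeny χ b :=
  (measurable_progeny_rowFiltration b).mono (rowFiltration.le b) le_rfl

/-- Integrating out the last generation turns `q ^ Z_{b+2}` into `F(q) ^ Z_{b+1}`, with `F` the
generating function of `f`. Together with the factor `exp(-s Z_{b+1})` from the progeny this is the
power `Z_{b+1}` of `genStep f s q`, so the induction runs with a changed `q`. -/
lemma lintegral_transform {s : ℝ} (hs : 0 ≤ s) (b : ℕ) {q : ℝ} (hq : q ∈ Set.Icc (0 : ℝ) 1) :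
    ∫⁻ χ, ENNReal.ofReal (q ^ genSize χ (b + 1) * Real.exp (-s * progeny χ b))
      ∂(offspringLaw g f) = ENNReal.ofReal (genFun g ((genStep f s)^[b] q)) := by
  induction b generalizing q with
  | zero =>
    simp only [progeny, Finset.range_zero, Finset.sum_empty, Nat.cast_zero, mul_zero,
      Real.exp_zero, mul_one, Function.iterate_zero, id]
    have e : ∀ χ : ℕ × ℕ → ℕ, genSize χ (0 + 1) = χ (0, 0) := fun χ => by simp [genSize]
    simp_rw [e]
    rw [lintegral_offspring g f (0, 0) fun j => ENNReal.ofReal (q ^ j), ← tsum_ofReal_pow g hq]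
    rfl
  | succ b ih =>
    set h : (ℕ × ℕ → ℕ) → ℝ≥0∞ := fun χ => ENNReal.ofReal (Real.exp (-s * progeny χ (b + 1))) with hh
    have hhm : Measurable[rowFiltration (b + 1)] h :=
      (Measurable.of_discrete (f := fun j : ℕ => ENNReal.ofReal (Real.exp (-s * j)))).comp
        (measurable_progeny_rowFiltration (b + 1))
    have e1 : ∀ χ, ENNReal.ofReal (q ^ genSize χ (b + 1 + 1) *
        Real.exp (-s * progeny χ (b + 1))) =
        h χ * ∏ i ∈ Finset.range (genSize χ (b + 1)), ENNReal.ofReal (q ^ χ (b + 1, i)) := by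
      intro χ
      rw [← ENNReal.ofReal_prod_of_nonneg fun i _ => pow_nonneg hq.1 _, hh,
        ← ENNReal.ofReal_mul (Real.exp_nonneg _), Finset.prod_pow_eq_pow_sum, mul_comm]
      rfl
    simp_rw [e1]
    rw [lintegral_mul_prod_offspring hhm fun j => ENNReal.ofReal (q ^ j)]
    have e2 : ∑' j, rowLaw g f (b + 1) j * ENNReal.ofReal (q ^ j) =
        ENNReal.ofReal (genFun f q) := tsum_ofReal_pow f hq
    rw [e2, Function.iterate_succ_apply, ← ih (genStep_mem f hs hq)]
    refine lintegral_congr fun χ => ?_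
    rw [hh, ← ENNReal.ofReal_pow (genFun_nonneg f hq.1), ← ENNReal.ofReal_mul (Real.exp_nonneg _)]
    congr 1
    have e3 : (progeny χ (b + 1) : ℝ) = progeny χ b + genSize χ (b + 1) := by
      rw [progeny, Finset.sum_range_succ, ← progeny]
      push_cast
      ring
    rw [e3, genStep, mul_pow, ← Real.exp_nat_mul, mul_add, Real.exp_add]
    rw [show (genSize χ (b + 1) : ℝ) * -s = -s * genSize χ (b + 1) by ring]
    ring

/-- The joint transform of the size of a generation and the total progeny before it. -/
theorem integral_transform (g f : PMF ℕ) {s : ℝ} (hs : 0 ≤ s) (b : ℕ) {q : ℝ}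
    (hq : q ∈ Set.Icc (0 : ℝ) 1) :
    ∫ χ, q ^ genSize χ (b + 1) * Real.exp (-s * progeny χ b) ∂(offspringLaw g f) =
      genFun g ((genStep f s)^[b] q) := by
  have hnn : ∀ χ, 0 ≤ q ^ genSize χ (b + 1) * Real.exp (-s * progeny χ b) := fun χ =>
    mul_nonneg (pow_nonneg hq.1 _) (Real.exp_nonneg _)
  have hm : Measurable fun χ : ℕ × ℕ → ℕ =>
      q ^ genSize χ (b + 1) * Real.exp (-s * progeny χ b) :=
    ((Measurable.of_discrete (f := fun j : ℕ => q ^ j)).comp (measurable_genSize (b + 1))).mul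
      ((Measurable.of_discrete (f := fun j : ℕ => Real.exp (-s * j))).comp (measurable_progeny b))
  rw [integral_eq_lintegral_of_nonneg_ae (ae_of_all _ hnn) hm.aestronglyMeasurable,
    lintegral_transform hs b hq,
    ENNReal.toReal_ofReal (genFun_nonneg g (genStep_iterate_mem f hs hq b).1)]

end Branching

/-! ### The martingale limit and the growth of the total progeny -/

section Limits

variable {g f : PMF ℕ} {ν μ : ℝ}

lemma rowLaw_succ (g f : PMF ℕ) (k : ℕ) : rowLaw g f (k + 1) = f := rfl

lemma lintegral_genSize (hμ : 1 < μ) (hg : pmfMean g = ENNReal.ofReal ν)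
    (hf : pmfMean f = ENNReal.ofReal μ) (k : ℕ) :
    ∫⁻ χ, genSize χ (k + 1) ∂(offspringLaw g f) = ENNReal.ofReal (ν * μ ^ k) := by
  have h := fun k => lintegral_mul_genSize_succ (g := g) (f := f) (k := k)
    (h := fun _ => 1) measurable_const
  simp only [one_mul] at h
  induction k with
  | zero =>
    rw [h 0]
    simp [rowLaw, hg, genSize]
  | succ k ih =>
    rw [h, ih, rowLaw_succ, hf, ← ENNReal.ofReal_mul (by linarith)]
    congr 1
    ring

lemma measurable_genSize_real (k : ℕ) : Measurable fun χ => (genSize χ k : ℝ) :=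
  (Measurable.of_discrete (f := fun j : ℕ => (j : ℝ))).comp (measurable_genSize k)

lemma integrable_genSize (hμ : 1 < μ) (hg : pmfMean g = ENNReal.ofReal ν)
    (hf : pmfMean f = ENNReal.ofReal μ) (k : ℕ) :
    Integrable (fun χ => (genSize χ (k + 1) : ℝ)) (offspringLaw g f) := by
  refine ⟨(measurable_genSize_real _).aestronglyMeasurable, ?_⟩
  rw [hasFiniteIntegral_iff_ofReal (ae_of_all _ fun _ => Nat.cast_nonneg _)]
  simp_rw [ENNReal.ofReal_natCast]
  rw [lintegral_genSize hμ hg hf]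
  exact ENNReal.ofReal_lt_top

lemma integral_genSize (hν : 0 < ν) (hμ : 1 < μ) (hg : pmfMean g = ENNReal.ofReal ν)
    (hf : pmfMean f = ENNReal.ofReal μ) (k : ℕ) :
    ∫ χ, (genSize χ (k + 1) : ℝ) ∂(offspringLaw g f) = ν * μ ^ k := by
  have hμ0 : 0 < μ := by linarith
  rw [integral_eq_lintegral_of_nonneg_ae (ae_of_all _ fun _ => Nat.cast_nonneg _)
    (measurable_genSize_real _).aestronglyMeasurable]
  simp_rw [ENNReal.ofReal_natCast]
  rw [lintegral_genSize hμ hg hf, ENNReal.toReal_ofReal (by positivity)]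

lemma setIntegral_genSize {s : Set (ℕ × ℕ → ℕ)} (hs : MeasurableSet s) (k : ℕ) :
    ∫ χ in s, (genSize χ k : ℝ) ∂(offspringLaw g f) =
      (∫⁻ χ, s.indicator 1 χ * genSize χ k ∂(offspringLaw g f)).toReal := by
  rw [integral_eq_lintegral_of_nonneg_ae (ae_of_all _ fun _ => Nat.cast_nonneg _)
    (measurable_genSize_real _).aestronglyMeasurable, ← lintegral_indicator hs]
  congr 1
  refine lintegral_congr fun χ => ?_
  by_cases h : χ ∈ s <;> simp [h]

lemma setIntegral_genSize_succ (hμ : 1 < μ) (hf : pmfMean f = ENNReal.ofReal μ) {k : ℕ}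
    {s : Set (ℕ × ℕ → ℕ)} (hs : MeasurableSet[rowFiltration (k + 1)] s) :
    ∫ χ in s, (genSize χ (k + 2) : ℝ) ∂(offspringLaw g f) =
      μ * ∫ χ in s, (genSize χ (k + 1) : ℝ) ∂(offspringLaw g f) := by
  have hs' := rowFiltration.le (k + 1) s hs
  have hm : Measurable[rowFiltration (k + 1)] (s.indicator fun _ => (1 : ℝ≥0∞)) :=
    Measurable.indicator (m := rowFiltration (k + 1)) measurable_const hs
  rw [setIntegral_genSize hs', setIntegral_genSize hs', Pi.one_def, lintegral_mul_genSize_succ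
    (k := k + 1) hm, rowLaw_succ, hf, ENNReal.toReal_mul,
    ENNReal.toReal_ofReal (by linarith)]

/-- The offspring numbers of the generations up to `k`, to which `gwMartingale` is adapted. -/
def succFiltration : Filtration ℕ (inferInstance : MeasurableSpace (ℕ × ℕ → ℕ)) where
  seq k := rowFiltration (k + 1)
  mono' _ _ hkl := rowFiltration.mono (Nat.succ_le_succ hkl)
  le' k := rowFiltration.le (k + 1)

lemma measurable_gwMartingale (ν μ : ℝ) (k : ℕ) : Measurable fun χ => gwMartingale ν μ χ k :=
  (measurable_genSize_real (k + 1)).div_const _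

lemma integrable_gwMartingale (hμ : 1 < μ) (hg : pmfMean g = ENNReal.ofReal ν)
    (hf : pmfMean f = ENNReal.ofReal μ) (k : ℕ) :
    Integrable (fun χ => gwMartingale ν μ χ k) (offspringLaw g f) :=
  (integrable_genSize hμ hg hf k).div_const _

lemma gwMartingale_nonneg (hν : 0 < ν) (hμ : 1 < μ) (χ : ℕ × ℕ → ℕ) (k : ℕ) :
    0 ≤ gwMartingale ν μ χ k := by
  have hμ0 : 0 < μ := by linarith
  unfold gwMartingale
  positivity

lemma martingale_gwMartingale (hν : 0 < ν) (hμ : 1 < μ) (hg : pmfMean g = ENNReal.ofReal ν)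
    (hf : pmfMean f = ENNReal.ofReal μ) :
    Martingale (fun k χ => gwMartingale ν μ χ k) succFiltration (offspringLaw g f) := by
  have hμ0 : 0 < μ := by linarith
  refine martingale_of_setIntegral_eq_succ (fun k => ?_)
    (integrable_gwMartingale hμ hg hf) fun k s hs => ?_
  · have h : Measurable[rowFiltration (k + 1)] fun χ => gwMartingale ν μ χ k :=
      ((Measurable.of_discrete (f := fun j : ℕ => (j : ℝ))).comp
        (measurable_genSize_rowFiltration (k + 1))).div_const _
    exact h.stronglyMeasurable
  · unfold gwMartingale
    rw [integral_div, integral_div, setIntegral_genSize_succ hμ hf hs]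
    field_simp
    ring

theorem ae_tendsto_gwMartingale (hν : 0 < ν) (hμ : 1 < μ) (hg : pmfMean g = ENNReal.ofReal ν)
    (hf : pmfMean f = ENNReal.ofReal μ) :
    ∀ᵐ χ ∂(offspringLaw g f),
      Tendsto (gwMartingale ν μ χ) atTop (𝓝 (gwLimit ν μ χ)) := by
  have hμ0 : 0 < μ := by linarith
  have h := (martingale_gwMartingale hν hμ hg hf).submartingale.exists_ae_tendsto_of_bdd (R := 1)
    fun k => by
      rw [eLpNorm_one_eq_lintegral_enorm]
      simp_rw [Real.enorm_of_nonneg (gwMartingale_nonneg hν hμ _ _)]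
      rw [← ofReal_integral_eq_lintegral_ofReal (integrable_gwMartingale hμ hg hf k)
        (ae_of_all _ fun χ => gwMartingale_nonneg hν hμ χ k)]
      unfold gwMartingale
      rw [integral_div, integral_genSize hν hμ hg hf, div_self (by positivity)]
      simp
  filter_upwards [h] with χ hχ
  exact tendsto_nhds_limUnder hχ

lemma measurable_gwLimit (ν μ : ℝ) : Measurable (gwLimit ν μ) :=
  (StronglyMeasurable.limUnder fun k =>
    (measurable_gwMartingale ν μ k).stronglyMeasurable).measurable

lemma ae_gwLimit_nonneg (hν : 0 < ν) (hμ : 1 < μ) (hg : pmfMean g = ENNReal.ofReal ν)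
    (hf : pmfMean f = ENNReal.ofReal μ) : ∀ᵐ χ ∂(offspringLaw g f), 0 ≤ gwLimit ν μ χ := by
  filter_upwards [ae_tendsto_gwMartingale hν hμ hg hf] with χ hχ
  exact ge_of_tendsto' hχ (gwMartingale_nonneg hν hμ χ)

lemma integral_progeny_le (hν : 0 < ν) (hμ : 1 < μ) (hg : pmfMean g = ENNReal.ofReal ν)
    (hf : pmfMean f = ENNReal.ofReal μ) (b : ℕ) :
    ∫ χ, (progeny χ b : ℝ) ∂(offspringLaw g f) ≤ ν / (μ - 1) * μ ^ b := by
  have hμ1 : 0 < μ - 1 := by linarith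
  simp only [progeny, Nat.cast_sum]
  rw [integral_finsetSum _ fun j _ => integrable_genSize hμ hg hf j]
  simp_rw [integral_genSize hν hμ hg hf]
  rw [← Finset.mul_sum, geom_sum_eq hμ.ne', div_mul_eq_mul_div, mul_div_assoc]
  gcongr
  linarith

lemma integrable_progeny (hμ : 1 < μ) (hg : pmfMean g = ENNReal.ofReal ν)
    (hf : pmfMean f = ENNReal.ofReal μ) (b : ℕ) :
    Integrable (fun χ => (progeny χ b : ℝ)) (offspringLaw g f) := by
  simp only [progeny, Nat.cast_sum]
  exact integrable_finsetSum _ fun j _ => integrable_genSize hμ hg hf j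

/-- Weighted averages with geometric weights. -/
lemma tendsto_geom_average {μ : ℝ} (hμ : 1 < μ) {u : ℕ → ℝ} {w : ℝ} (hu : Tendsto u atTop (𝓝 w)) :
    Tendsto (fun b : ℕ => (∑ j ∈ Finset.range b, μ ^ j * u j) / μ ^ b) atTop
      (𝓝 (w / (μ - 1))) := by
  have hμ0 : 0 < μ := by linarith
  have hμ1 : 0 < μ - 1 := by linarith
  have hg : Tendsto (fun b => ∑ j ∈ Finset.range b, μ ^ j) atTop atTop := by
    refine tendsto_atTop_mono (fun b => ?_) tendsto_natCast_atTop_atTop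
    calc (b : ℝ) = ∑ _j ∈ Finset.range b, (1 : ℝ) := by simp
      _ ≤ _ := Finset.sum_le_sum fun j _ => one_le_pow₀ hμ.le
  -- Since the sum of the weights diverges, partial sums of a sequence negligible against the
  -- weights are negligible against the sum of the weights.
  have ho : (fun j => μ ^ j * (u j - w)) =o[atTop] fun j => μ ^ j := by
    have h0 : Tendsto (fun j => u j - w) atTop (𝓝 0) := by simpa using hu.sub_const w
    have := (Asymptotics.isBigO_refl (fun j : ℕ => μ ^ j) atTop).mul_isLittleO
      ((Asymptotics.isLittleO_one_iff ℝ).2 h0)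
    simpa using this
  have hs := ho.sum_range (fun j => by positivity) hg
  have e : ∀ b : ℕ, ∑ j ∈ Finset.range b, μ ^ j = (μ ^ b - 1) / (μ - 1) := geom_sum_eq hμ.ne'
  have h1 : Tendsto (fun b : ℕ => (∑ j ∈ Finset.range b, μ ^ j) / μ ^ b) atTop
      (𝓝 (1 / (μ - 1))) := by
    have h2 : Tendsto (fun b : ℕ => (1 - (μ⁻¹) ^ b) / (μ - 1)) atTop (𝓝 ((1 - 0) / (μ - 1))) :=
      ((tendsto_pow_atTop_nhds_zero_of_lt_one (by positivity)
        (inv_lt_one_of_one_lt₀ hμ)).const_sub 1).div_const _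
    rw [sub_zero] at h2
    refine h2.congr fun b => ?_
    rw [e, inv_pow]
    field_simp
  have h3 := hs.tendsto_div_nhds_zero.mul h1
  have h4 := (h3.add (h1.const_mul w))
  rw [zero_mul, zero_add, mul_one_div] at h4
  refine h4.congr' ?_
  filter_upwards [eventually_gt_atTop 0] with b hb
  have hb' : (∑ j ∈ Finset.range b, μ ^ j) ≠ 0 :=
    (Finset.sum_pos (fun j _ => by positivity) ⟨0, by simpa using hb⟩).ne'
  rw [div_mul_div_comm, mul_comm _ (μ ^ b), ← div_mul_div_comm, div_self hb', mul_one,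
    mul_div_assoc', ← add_div]
  congr 1
  rw [Finset.mul_sum, ← Finset.sum_add_distrib]
  exact Finset.sum_congr rfl fun j _ => by ring

/-- The progeny is `ν` times the sum of `μ ^ j` times the martingale at `j`, so it is a
geometrically weighted average of a convergent sequence. -/
lemma tendsto_progeny (hν : 0 < ν) (hμ : 1 < μ) {χ : ℕ × ℕ → ℕ}
    (h : Tendsto (gwMartingale ν μ χ) atTop (𝓝 (gwLimit ν μ χ))) :
    Tendsto (fun b : ℕ => (progeny χ b : ℝ) / μ ^ b) atTop
      (𝓝 (ν / (μ - 1) * gwLimit ν μ χ)) := by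
  have hμ0 : 0 < μ := by linarith
  have h1 := (tendsto_geom_average hμ h).const_mul ν
  rw [mul_div_assoc', mul_comm ν (gwLimit ν μ χ), mul_div_assoc, mul_comm] at h1
  refine h1.congr fun b => ?_
  rw [mul_div_assoc', Finset.mul_sum, progeny]
  push_cast
  congr 1
  refine Finset.sum_congr rfl fun j _ => ?_
  rw [gwMartingale]
  field_simp

end Limits

/-! ### The martingale limit vanishes only on extinction -/

section Extinction

variable {g f : PMF ℕ} {ν μ κ D : ℝ}

/-- For `y ≤ 1` the quadratic remainder is at most `y ^ (1 + κ)`; for `y ≥ 1` the right side is at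
least `1`. -/
lemma exp_neg_le_of_rpow {y : ℝ} (hy : 0 ≤ y) (hκ : 0 < κ) (hκ1 : κ ≤ 1) :
    Real.exp (-y) ≤ 1 - y + y ^ (1 + κ) := by
  rcases le_total y 1 with h | h
  · have h1 : y ^ (2 : ℝ) ≤ y ^ (1 + κ) := by
      rcases hy.eq_or_lt with rfl | hy'
      · rw [Real.zero_rpow two_ne_zero, Real.zero_rpow (by positivity)]
      · exact Real.rpow_le_rpow_of_exponent_ge hy' h (by linarith)
    rw [Real.rpow_two] at h1
    have h2 := (abs_le.1 (Real.abs_exp_sub_one_sub_id_le (x := -y) (by simpa [abs_of_nonneg hy]))).2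
    rw [neg_sq] at h2
    linarith
  · have h1 : y ≤ y ^ (1 + κ) := Real.self_le_rpow_of_one_le h (by linarith)
    have h2 : Real.exp (-y) ≤ 1 := Real.exp_le_one_iff.2 (by linarith)
    linarith

/-- A moment of order `1 + κ` controls the deviation of the generating function from its tangent at
`1`, via `(1 - x) ^ j ≤ exp(-j x) ≤ 1 - j x + (j x) ^ (1 + κ)`. -/
lemma le_one_sub_genFun (hμ : 1 < μ) (hf : pmfMean f = ENNReal.ofReal μ) (hκ : 0 < κ)
    (hκ1 : κ ≤ 1) (hD : ∀ T, ∑ j ∈ Finset.range T, (f j).toReal * (j : ℝ) ^ (1 + κ) ≤ D) {x : ℝ}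
    (hx : x ∈ Set.Icc (0 : ℝ) 1) : μ * x - D * x ^ (1 + κ) ≤ 1 - genFun f (1 - x) := by
  have hs : Summable fun j : ℕ => (f j).toReal * (j : ℝ) ^ (1 + κ) :=
    summable_of_sum_range_le (fun j => by positivity) hD
  have hle : ∑' j : ℕ, (f j).toReal * (j : ℝ) ^ (1 + κ) ≤ D :=
    hs.tsum_le_of_sum_range_le hD
  have hm := hasSum_mean (by linarith) hf
  have hu := ((hasSum_toReal f).sub (hm.mul_right x)).add (hs.hasSum.mul_right (x ^ (1 + κ)))
  have hxκ : 0 ≤ x ^ (1 + κ) := Real.rpow_nonneg hx.1 _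
  have h1 : genFun f (1 - x) ≤
      1 - μ * x + (∑' j : ℕ, (f j).toReal * (j : ℝ) ^ (1 + κ)) * x ^ (1 + κ) := by
    rw [← hu.tsum_eq]
    refine (summable_genFun f (by linarith [hx.2]) (by linarith [hx.1])).tsum_le_tsum (fun j => ?_)
      hu.summable
    have h2 : (1 - x) ^ j ≤ Real.exp (-(j * x)) := by
      have := Real.add_one_le_exp (-x)
      calc (1 - x) ^ j ≤ Real.exp (-x) ^ j :=
            pow_le_pow_left₀ (by linarith [hx.2]) (by linarith) j
        _ = _ := by rw [← Real.exp_nat_mul]; ring_nf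
    have h3 := exp_neg_le_of_rpow (y := j * x) (mul_nonneg (Nat.cast_nonneg j) hx.1) hκ hκ1
    rw [Real.mul_rpow (Nat.cast_nonneg j) hx.1] at h3
    have h4 := mul_le_mul_of_nonneg_left (h2.trans h3) (ENNReal.toReal_nonneg (a := f j))
    refine h4.trans_eq ?_
    ring
  have h2 := mul_le_mul_of_nonneg_right hle hxκ
  linarith

lemma genStep_zero (f : PMF ℕ) : genStep f 0 = genFun f := by
  funext q
  simp [genStep]

/-- The constant `B = D / (μ (μ ^ κ - 1))` solves `B μ ^ (1 + κ) = μ B + D`, which is what the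
induction over generations needs. The point is that `B` does not depend on the number of iterations.
-/
lemma le_one_sub_iterate (hμ : 1 < μ) (hf : pmfMean f = ENNReal.ofReal μ) (hκ : 0 < κ)
    (hκ1 : κ ≤ 1) (hD0 : 0 ≤ D)
    (hD : ∀ T, ∑ j ∈ Finset.range T, (f j).toReal * (j : ℝ) ^ (1 + κ) ≤ D) {x : ℝ}
    (hx : x ∈ Set.Icc (0 : ℝ) 1) (i : ℕ) :
    μ ^ i * x - D / (μ * (μ ^ κ - 1)) * (μ ^ i * x) ^ (1 + κ) ≤
      1 - (genStep f 0)^[i] (1 - x) := by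
  have hμ0 : 0 < μ := by linarith
  have hμκ : 0 < μ ^ κ - 1 := by linarith [Real.one_lt_rpow hμ hκ]
  set B := D / (μ * (μ ^ κ - 1)) with hB
  have hB0 : 0 ≤ B := by positivity
  have hBD : B * μ ^ (1 + κ) = μ * B + D := by
    rw [Real.rpow_add hμ0, Real.rpow_one, hB]
    field_simp
    ring
  have hx' : 1 - x ∈ Set.Icc (0 : ℝ) 1 := ⟨by linarith [hx.2], by linarith [hx.1]⟩
  induction i with
  | zero =>
    have := Real.rpow_nonneg hx.1 (1 + κ)
    simp only [pow_zero, one_mul, Function.iterate_zero, id]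
    nlinarith
  | succ i ih =>
    rw [Function.iterate_succ_apply']
    have hmem := genStep_iterate_mem f le_rfl hx' i
    have hup := one_sub_genStep_iterate_le hμ hf le_rfl hx' i
    set y := 1 - (genStep f 0)^[i] (1 - x) with hy
    have hy01 : y ∈ Set.Icc (0 : ℝ) 1 := ⟨by linarith [hmem.2], by linarith [hmem.1]⟩
    have h1 := le_one_sub_genFun hμ hf hκ hκ1 hD hy01
    have e : (genStep f 0)^[i] (1 - x) = 1 - y := by rw [hy]; ring
    rw [e, genStep_zero]
    set u := μ ^ i * x with hu
    have hyu : y ≤ u := by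
      have : μ ^ i * (1 - (1 - x) + 0 / (μ - 1)) = u := by rw [hu]; ring
      linarith
    have hu0 : 0 ≤ u := hy01.1.trans hyu
    have h2 : y ^ (1 + κ) ≤ u ^ (1 + κ) := Real.rpow_le_rpow hy01.1 hyu (by linarith)
    have h3 : (μ ^ (i + 1) * x) = μ * u := by rw [hu]; ring
    rw [h3, Real.mul_rpow hμ0.le hu0, ← mul_assoc B, hBD]
    have h4 := mul_le_mul_of_nonneg_left ih hμ0.le
    have h5 := mul_le_mul_of_nonneg_left h2 hD0
    nlinarith

/-- The Laplace transforms of the normalized generation sizes stay away from `1`, so the limit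
cannot be zero almost surely. The level `a` is chosen so small that the correction `B u ^ (1 + κ)`
takes at most half of `u` for `u ≤ a`. -/
lemma exists_iterate_le (hν : 0 < ν) (hμ : 1 < μ) (hf : pmfMean f = ENNReal.ofReal μ) (hκ : 0 < κ)
    (hκ1 : κ ≤ 1)
    (hD : ∀ T, ∑ j ∈ Finset.range T, (f j).toReal * (j : ℝ) ^ (1 + κ) ≤ D) :
    ∃ l η : ℝ, 0 < l ∧ 0 < η ∧ η ≤ 1 ∧
      ∀ m : ℕ, (genStep f 0)^[m] (Real.exp (-(l / (ν * μ ^ m)))) ≤ 1 - η := by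
  have hμ0 : 0 < μ := by linarith
  have hD0 : 0 ≤ D := by simpa using hD 0
  have hμκ : 0 < μ ^ κ - 1 := by linarith [Real.one_lt_rpow hμ hκ]
  set B := D / (μ * (μ ^ κ - 1)) with hB
  have hB0 : 0 ≤ B := by positivity
  set a : ℝ := (1 / (2 * (B + 1))) ^ (1 / κ) with ha
  have ha0 : 0 < a := by positivity
  have haκ : a ^ κ = 1 / (2 * (B + 1)) := by
    rw [ha, ← Real.rpow_mul (by positivity), one_div_mul_cancel hκ.ne', Real.rpow_one]
  have ha1 : a ≤ 1 := by
    refine Real.rpow_le_one (by positivity) ?_ (by positivity)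
    rw [div_le_one (by positivity)]
    linarith
  refine ⟨ν * a, a / 4, by positivity, by positivity, by linarith, fun m => ?_⟩
  have hpm : 0 < μ ^ m := by positivity
  have e : ν * a / (ν * μ ^ m) = a / μ ^ m := by field_simp
  rw [e]
  set z := a / μ ^ m with hz
  have hz0 : 0 < z := by positivity
  have hz1 : z ≤ 1 := (div_le_one hpm).2 (ha1.trans (one_le_pow₀ hμ.le))
  set x := 1 - Real.exp (-z) with hx
  have h1 : x ≤ z := by linarith [Real.add_one_le_exp (-z)]
  have h2 : z / 2 ≤ x := by
    have h := (abs_le.1 (Real.abs_exp_sub_one_sub_id_le (x := -z)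
      (by simpa [abs_of_pos hz0]))).2
    have h' := Real.quadratic_le_exp_of_nonneg hz0.le
    have h3 : Real.exp (-z) * Real.exp z = 1 := by rw [← Real.exp_add]; simp
    have h4 : 0 < Real.exp (-z) := Real.exp_pos _
    nlinarith
  have hx01 : x ∈ Set.Icc (0 : ℝ) 1 := ⟨by linarith, by linarith [Real.exp_pos (-z)]⟩
  have h3 := le_one_sub_iterate hμ hf hκ hκ1 hD0 hD hx01 m
  rw [← hB] at h3
  have e2 : Real.exp (-z) = 1 - x := by rw [hx]; ring
  rw [e2]
  set u := μ ^ m * x with hu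
  have hu1 : u ≤ a := by
    calc u ≤ μ ^ m * z := mul_le_mul_of_nonneg_left h1 hpm.le
      _ = a := by rw [hz]; field_simp
  have hu2 : a / 2 ≤ u := by
    calc a / 2 = μ ^ m * (z / 2) := by rw [hz]; field_simp
      _ ≤ u := mul_le_mul_of_nonneg_left h2 hpm.le
  have hu0 : 0 < u := by linarith
  have h4 : B * u ^ (1 + κ) ≤ u / 2 := by
    rw [Real.rpow_add hu0, Real.rpow_one]
    have h5 : u ^ κ ≤ 1 / (2 * (B + 1)) := haκ ▸ Real.rpow_le_rpow hu0.le hu1 hκ.le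
    have h6 : B * (1 / (2 * (B + 1))) ≤ 1 / 2 := by
      rw [mul_one_div, div_le_div_iff₀ (by positivity) (by positivity)]
      linarith
    have h7 := mul_le_mul_of_nonneg_left h5 hB0
    nlinarith
  linarith

lemma exists_two_le_pos (hμ : 1 < μ) (hf : pmfMean f = ENNReal.ofReal μ) :
    ∃ j, 2 ≤ j ∧ 0 < (f j).toReal := by
  by_contra! h
  have hm := hasSum_mean (by linarith) hf
  have h1 : μ ≤ 1 := by
    rw [← hm.tsum_eq, ← (hasSum_toReal f).tsum_eq]
    refine hm.summable.tsum_le_tsum (fun j => ?_) (hasSum_toReal f).summable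
    rcases lt_or_ge j 2 with hj | hj
    · have hj1 : (j : ℝ) ≤ 1 := by exact_mod_cast (by omega : j ≤ 1)
      exact mul_le_of_le_one_right ENNReal.toReal_nonneg hj1
    · have h0 : (f j).toReal = 0 := le_antisymm (h j hj) ENNReal.toReal_nonneg
      simp [h0]
  linarith

/-- Strict convexity: the graph lies below the chord joining the fixed points `q` and `1`. It is
strict because a mean above `1` forces mass on some `j ≥ 2`. -/
lemma genFun_lt_self (hμ : 1 < μ) (hf : pmfMean f = ENNReal.ofReal μ) {q x : ℝ} (hq : 0 ≤ q)
    (hqf : genFun f q = q) (hqx : q < x) (hx : x < 1) : genFun f x < x := by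
  have hq1 : 0 < 1 - q := by linarith
  set a := (1 - x) / (1 - q) with ha
  have ha0 : 0 < a := div_pos (by linarith) hq1
  have ha1 : 0 < 1 - a := by
    have : a < 1 := (div_lt_one hq1).2 (by linarith)
    linarith
  have hxa : a * q + (1 - a) * 1 = x := by
    rw [ha]
    field_simp
    ring
  have hxa' : a * q + (1 - a) = x := by rw [← hxa, mul_one]
  have hle : ∀ j : ℕ, x ^ j ≤ a * q ^ j + (1 - a) := by
    intro j
    have := (convexOn_pow j).2 (Set.mem_Ici.2 hq)
      (Set.mem_Ici.2 zero_le_one) ha0.le ha1.le (by ring)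
    simpa only [smul_eq_mul, hxa', one_pow, mul_one] using this
  obtain ⟨i, hi, hfi⟩ := exists_two_le_pos hμ hf
  have hlt : x ^ i < a * q ^ i + (1 - a) := by
    have := (strictConvexOn_pow hi).2 (Set.mem_Ici.2 hq)
      (Set.mem_Ici.2 zero_le_one) (by linarith) ha0 ha1 (by ring)
    simpa only [smul_eq_mul, hxa', one_pow, mul_one] using this
  have hq' : HasSum (fun j => (f j).toReal * q ^ j) q := by
    have := (summable_genFun f hq (by linarith)).hasSum
    rwa [show ∑' j, (f j).toReal * q ^ j = q from hqf] at this
  have hs : HasSum (fun j => (f j).toReal * (a * q ^ j + (1 - a))) x := by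
    have h := (hq'.mul_left a).add ((hasSum_toReal f).mul_left (1 - a))
    rw [hxa] at h
    have e : (fun j => (f j).toReal * (a * q ^ j + (1 - a))) =
        fun j => a * ((f j).toReal * q ^ j) + (1 - a) * (f j).toReal := by
      funext j
      ring
    rwa [e]
  refine lt_of_lt_of_eq ?_ hs.tsum_eq
  exact Summable.tsum_lt_tsum (fun j => mul_le_mul_of_nonneg_left (hle j) ENNReal.toReal_nonneg)
    (mul_lt_mul_of_pos_left hlt hfi) (summable_genFun f (by linarith) hx.le) hs.summable

lemma tendsto_genFun (hμ : 0 ≤ μ) (hf : pmfMean f = ENNReal.ofReal μ) {u : ℕ → ℝ}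
    {q : ℝ} (hu : ∀ j, u j ∈ Set.Icc (0 : ℝ) 1) (h : Tendsto u atTop (𝓝 q)) :
    Tendsto (fun j => genFun f (u j)) atTop (𝓝 (genFun f q)) := by
  have hq : q ∈ Set.Icc (0 : ℝ) 1 := isClosed_Icc.mem_of_tendsto h (Eventually.of_forall hu)
  rw [tendsto_iff_dist_tendsto_zero] at h ⊢
  refine squeeze_zero (fun j => dist_nonneg)
    (fun j => abs_genFun_sub_le hμ hf (hu j) hq) ?_
  simpa [Real.dist_eq] using h.const_mul μ

lemma monotone_iterate_zero (f : PMF ℕ) : Monotone fun m => (genStep f 0)^[m] 0 := by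
  refine monotone_nat_of_le_succ fun m => ?_
  induction m with
  | zero => exact (genStep_iterate_mem f le_rfl ⟨le_rfl, zero_le_one⟩ 1).1
  | succ m ih =>
    have h0 := genStep_iterate_mem f le_rfl (Set.left_mem_Icc.2 zero_le_one) m
    have h1 := genStep_iterate_mem f le_rfl (Set.left_mem_Icc.2 zero_le_one) (m + 1)
    rw [Function.iterate_succ_apply' _ (m + 1), Function.iterate_succ_apply' _ m]
    rw [Function.iterate_succ_apply'] at ih h1
    rw [genStep_zero] at *
    exact genFun_mono f h0.1 ih h1.2

lemma iterate_mono (f : PMF ℕ) {x y : ℝ} (hx : 0 ≤ x) (hxy : x ≤ y) (hy : y ≤ 1) (m : ℕ) :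
    (genStep f 0)^[m] x ≤ (genStep f 0)^[m] y := by
  induction m with
  | zero => exact hxy
  | succ m ih =>
    have h0 := genStep_iterate_mem f le_rfl (Set.mem_Icc.2 ⟨hx, hxy.trans hy⟩) m
    have h1 := genStep_iterate_mem f le_rfl (Set.mem_Icc.2 ⟨hx.trans hxy, hy⟩) m
    rw [Function.iterate_succ_apply', Function.iterate_succ_apply', genStep_zero] at *
    exact genFun_mono f h0.1 ih h1.2

/-- The iterates of the generating function converge to the extinction probability from every
starting point above it and below `1`. -/
lemma exists_extinction (hμ : 1 < μ) (hf : pmfMean f = ENNReal.ofReal μ) {x : ℝ}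
    (hx : x < 1) (h : ∀ m : ℕ, (genStep f 0)^[m] 0 ≤ x) :
    ∃ q, 0 ≤ q ∧ q < 1 ∧ Tendsto (fun m => (genStep f 0)^[m] 0) atTop (𝓝 q) ∧
      Tendsto (fun m => (genStep f 0)^[m] x) atTop (𝓝 q) := by
  have hx0 : 0 ≤ x := h 0
  have hz := genStep_iterate_mem f le_rfl (Set.left_mem_Icc.2 (zero_le_one (α := ℝ)))
  have hxm := genStep_iterate_mem f le_rfl (Set.mem_Icc.2 ⟨hx0, hx.le⟩)
  obtain ⟨q, hq⟩ : ∃ q, Tendsto (fun m => (genStep f 0)^[m] 0) atTop (𝓝 q) :=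
    ⟨_, tendsto_atTop_ciSup (monotone_iterate_zero f) ⟨x, by rintro _ ⟨m, rfl⟩; exact h m⟩⟩
  have hq0 : 0 ≤ q := ge_of_tendsto' hq fun m => (hz m).1
  have hqx : q ≤ x := le_of_tendsto' hq h
  -- Both orbits are monotone, and their limits are fixed points; there is no fixed point strictly
  -- between `q` and `1`.
  have hfix : ∀ {y r : ℝ}, (∀ m, (genStep f 0)^[m] y ∈ Set.Icc (0 : ℝ) 1) →
      Tendsto (fun m => (genStep f 0)^[m] y) atTop (𝓝 r) → genFun f r = r := by
    intro y r hy hr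
    refine tendsto_nhds_unique (tendsto_genFun (by linarith) hf hy hr) ?_
    have := hr.comp (tendsto_add_atTop_nat 1)
    refine this.congr fun m => ?_
    simp only [Function.comp_apply, Function.iterate_succ_apply', genStep_zero]
  have hqf := hfix hz hq
  have hstep : ∀ y, q ≤ y → y < 1 → genFun f y ≤ y := by
    intro y h1 h2
    rcases h1.eq_or_lt with rfl | h1
    · exact hqf.le
    · exact (genFun_lt_self hμ hf hq0 hqf h1 h2).le
  have hge : ∀ m, q ≤ (genStep f 0)^[m] x := by
    intro m
    refine le_of_tendsto' hq fun k => ?_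
    rcases le_total k m with hk | hk
    · exact (monotone_iterate_zero f hk).trans (iterate_mono f le_rfl hx0 hx.le m)
    · obtain ⟨j, rfl⟩ := Nat.exists_eq_add_of_le hk
      rw [Function.iterate_add_apply]
      exact iterate_mono f (hz j).1 (h j) hx.le m
  have hlt : ∀ m, (genStep f 0)^[m] x ≤ x := by
    intro m
    induction m with
    | zero => exact le_rfl
    | succ m ih =>
      rw [Function.iterate_succ_apply', genStep_zero] at *
      exact (hstep _ (hge m) (ih.trans_lt hx)).trans ih
  have hanti : Antitone fun m => (genStep f 0)^[m] x := antitone_nat_of_succ_le fun m => by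
    rw [Function.iterate_succ_apply', genStep_zero]
    have h1 := hge m
    have h2 := hlt m
    rw [genStep_zero] at h1 h2
    exact hstep _ h1 (h2.trans_lt hx)
  obtain ⟨r, hr⟩ : ∃ r, Tendsto (fun m => (genStep f 0)^[m] x) atTop (𝓝 r) :=
    ⟨_, tendsto_atTop_ciInf hanti ⟨q, by rintro _ ⟨m, rfl⟩; exact hge m⟩⟩
  have hqr : q ≤ r := ge_of_tendsto' hr hge
  have hrx : r ≤ x := le_of_tendsto' hr hlt
  have hrf := hfix hxm hr
  have hrq : q = r := by
    by_contra hne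
    have := genFun_lt_self hμ hf hq0 hqf (lt_of_le_of_ne hqr hne) (hrx.trans_lt hx)
    linarith
  exact ⟨q, hq0, hqx.trans_lt hx, hq, hrq ▸ hr⟩

lemma genFun_lt_one (hν : 0 < ν) (hg : pmfMean g = ENNReal.ofReal ν) {q : ℝ} (hq : 0 ≤ q)
    (hq1 : q < 1) : genFun g q < 1 := by
  obtain ⟨j, hj⟩ : ∃ j : ℕ, 0 < (g j).toReal * (j : ℝ) := by
    by_contra! h
    have := (hasSum_mean hν.le hg).nonpos h
    linarith
  have hj0 : j ≠ 0 := by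
    rintro rfl
    simp at hj
  have hgj : 0 < (g j).toReal := pos_of_mul_pos_left hj (Nat.cast_nonneg j)
  rw [← (hasSum_toReal g).tsum_eq]
  refine Summable.tsum_lt_tsum (i := j)
    (fun j => mul_le_of_le_one_right ENNReal.toReal_nonneg (pow_le_one₀ hq hq1.le))
    ?_ (summable_genFun g hq hq1.le) (hasSum_toReal g).summable
  exact mul_lt_of_lt_one_right hgj (pow_lt_one₀ hq hq1 hj0)

lemma integral_pow_genSize (g f : PMF ℕ) (b : ℕ) {q : ℝ} (hq : q ∈ Set.Icc (0 : ℝ) 1) :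
    ∫ χ, q ^ genSize χ (b + 1) ∂(offspringLaw g f) = genFun g ((genStep f 0)^[b] q) := by
  rw [← integral_transform g f le_rfl b hq]
  simp

lemma genSize_eq_zero_of_le {χ : ℕ × ℕ → ℕ} {k l : ℕ} (hkl : k ≤ l) (h : genSize χ k = 0) :
    genSize χ l = 0 := by
  induction l, hkl using Nat.le_induction with
  | base => exact h
  | succ l _ ih => simp [genSize, ih]

lemma tendsto_genFun_exp (hν : 0 < ν) (hμ : 1 < μ) (hg : pmfMean g = ENNReal.ofReal ν)
    (hf : pmfMean f = ENNReal.ofReal μ) {l : ℝ} (hl : 0 ≤ l) :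
    Tendsto (fun k => genFun g ((genStep f 0)^[k] (Real.exp (-(l / (ν * μ ^ k)))))) atTop
      (𝓝 (∫ χ, Real.exp (-(l * gwLimit ν μ χ)) ∂(offspringLaw g f))) := by
  have hμ0 : 0 < μ := by linarith
  have hmem : ∀ k : ℕ, Real.exp (-(l / (ν * μ ^ k))) ∈ Set.Icc (0 : ℝ) 1 := fun k =>
    ⟨Real.exp_nonneg _, Real.exp_le_one_iff.2 (by
      have : 0 ≤ l / (ν * μ ^ k) := by positivity
      linarith)⟩
  have e : ∀ k, genFun g ((genStep f 0)^[k] (Real.exp (-(l / (ν * μ ^ k))))) =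
      ∫ χ, Real.exp (-(l * gwMartingale ν μ χ k)) ∂(offspringLaw g f) := by
    intro k
    rw [← integral_pow_genSize g f k (hmem k)]
    refine integral_congr_ae (ae_of_all _ fun χ => ?_)
    simp only [gwMartingale]
    rw [← Real.exp_nat_mul]
    congr 1
    ring
  simp_rw [e]
  refine tendsto_integral_of_dominated_convergence (fun _ => 1) (fun k => ?_)
    (integrable_const _) (fun k => ae_of_all _ fun χ => ?_) ?_
  · exact (Real.measurable_exp.comp
      ((measurable_gwMartingale ν μ k).const_mul l).neg).aestronglyMeasurable
  · rw [Real.norm_of_nonneg (Real.exp_nonneg _), Real.exp_le_one_iff]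
    have := mul_nonneg hl (gwMartingale_nonneg hν hμ χ k)
    linarith
  · filter_upwards [ae_tendsto_gwMartingale hν hμ hg hf] with χ hχ
    exact (Real.continuous_exp.tendsto _).comp (hχ.const_mul l).neg

/-- Under a moment condition the martingale limit vanishes only on extinction, up to null sets. -/
theorem tendsto_extinction (hν : 0 < ν) (hμ : 1 < μ) (hg : pmfMean g = ENNReal.ofReal ν)
    (hf : pmfMean f = ENNReal.ofReal μ) (hκ : 0 < κ) (hκ1 : κ ≤ 1)
    (hD : ∀ T, ∑ j ∈ Finset.range T, (f j).toReal * (j : ℝ) ^ (1 + κ) ≤ D) :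
    Tendsto (fun m => genFun g ((genStep f 0)^[m] 0)) atTop
      (𝓝 ((offspringLaw g f).real {χ | ¬ 0 < gwLimit ν μ χ})) ∧
    (offspringLaw g f).real {χ | ¬ 0 < gwLimit ν μ χ} < 1 := by
  have hμ0 : 0 < μ := by linarith
  set P := offspringLaw g f with hP
  have hms : MeasurableSet {χ | ¬ 0 < gwLimit ν μ χ} :=
    (measurableSet_lt measurable_const (measurable_gwLimit ν μ)).compl
  obtain ⟨l, η, hl, hη, hη1, hle⟩ := exists_iterate_le hν hμ hf hκ hκ1 hD
  have hexp : ∀ m : ℕ, Real.exp (-(l / (ν * μ ^ m))) ≤ 1 := fun m =>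
    Real.exp_le_one_iff.2 (by have : 0 ≤ l / (ν * μ ^ m) := by positivity
                              linarith)
  obtain ⟨q, hq0, hq1, hqz, hqx⟩ := exists_extinction hμ hf (x := 1 - η) (by linarith)
    fun m => (iterate_mono f le_rfl (Real.exp_nonneg _) (hexp m) m).trans (hle m)
  have hz := genStep_iterate_mem f le_rfl (Set.left_mem_Icc.2 (zero_le_one (α := ℝ)))
  have hx := genStep_iterate_mem f le_rfl
    (show 1 - η ∈ Set.Icc (0 : ℝ) 1 from ⟨by linarith, by linarith⟩)
  have hG1 := tendsto_genFun hν.le hg hz hqz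
  have hG2 := tendsto_genFun hν.le hg hx hqx
  -- The event `W = 0` has probability at most `E exp(-l μ^j W)` for every `j`, and these transforms
  -- decrease to the extinction probability along the iterates started from `1 - η`.
  have hup : P.real {χ | ¬ 0 < gwLimit ν μ χ} ≤ genFun g q := by
    refine ge_of_tendsto' hG2 fun j => ?_
    have h1 : P.real {χ | ¬ 0 < gwLimit ν μ χ} ≤
        ∫ χ, Real.exp (-(l * μ ^ j * gwLimit ν μ χ)) ∂P := by
      rw [← integral_indicator_one hms]
      refine integral_mono_ae ((integrable_const (1 : ℝ)).indicator hms) ?_ ?_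
      · refine Integrable.of_bound (Real.measurable_exp.comp
          ((measurable_gwLimit ν μ).const_mul _).neg).aestronglyMeasurable 1 ?_
        filter_upwards [ae_gwLimit_nonneg hν hμ hg hf] with χ hχ
        rw [Real.norm_of_nonneg (Real.exp_nonneg _), Real.exp_le_one_iff]
        have : 0 ≤ l * μ ^ j * gwLimit ν μ χ := by positivity
        linarith
      · filter_upwards [ae_gwLimit_nonneg hν hμ hg hf] with χ hχ
        by_cases h : 0 < gwLimit ν μ χ
        · simp [h, Real.exp_nonneg]
        · have : gwLimit ν μ χ = 0 := le_antisymm (not_lt.1 h) hχ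
          simp [this]
    refine h1.trans ?_
    -- Shifting the generation by `j` cancels the factor `μ ^ j`; the first `m` iterations then end
    -- below `1 - η`, and `j` iterations remain.
    have h2 := (tendsto_genFun_exp hν hμ hg hf (l := l * μ ^ j) (by positivity)).comp
      (tendsto_add_atTop_nat j)
    refine le_of_tendsto' h2 fun m => ?_
    have e : l * μ ^ j / (ν * μ ^ (m + j)) = l / (ν * μ ^ m) := by
      rw [pow_add]
      field_simp
    simp only [Function.comp_apply]
    rw [e, add_comm m j, Function.iterate_add_apply]
    have hm := genStep_iterate_mem f le_rfl (Set.mem_Icc.2 ⟨Real.exp_nonneg _, hexp m⟩) m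
    exact genFun_mono g (genStep_iterate_mem f le_rfl hm j).1
      (iterate_mono f hm.1 (hle m) (by linarith) j) (hx j).2
  -- Conversely, a process that has died by generation `m + 1` has limit zero.
  have hlow : genFun g q ≤ P.real {χ | ¬ 0 < gwLimit ν μ χ} := by
    refine le_of_tendsto' hG1 fun m => ?_
    have hmz : MeasurableSet {χ : ℕ × ℕ → ℕ | genSize χ (m + 1) = 0} :=
      measurable_genSize (m + 1) (measurableSet_singleton 0)
    have e : genFun g ((genStep f 0)^[m] 0) = P.real {χ | genSize χ (m + 1) = 0} := by
      rw [← integral_pow_genSize g f m (Set.left_mem_Icc.2 zero_le_one),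
        ← integral_indicator_one hmz]
      refine integral_congr_ae (ae_of_all _ fun χ => ?_)
      by_cases h : genSize χ (m + 1) = 0 <;> simp [h]
    rw [e]
    refine ENNReal.toReal_mono (measure_ne_top _ _) (measure_mono_ae ?_)
    filter_upwards [ae_tendsto_gwMartingale hν hμ hg hf] with χ hχ h
    have h0 : Tendsto (gwMartingale ν μ χ) atTop (𝓝 0) := by
      refine tendsto_const_nhds.congr' ?_
      filter_upwards [eventually_ge_atTop m] with k hk
      simp [gwMartingale, genSize_eq_zero_of_le (Nat.succ_le_succ hk) h]
    have := tendsto_nhds_unique hχ h0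
    exact not_lt.2 this.le
  rw [le_antisymm hup hlow]
  exact ⟨hG1, genFun_lt_one hν hg hq0 hq1⟩

end Extinction

/-! ### The limit laws inherit a moment of order `1 + κ` -/

section Moment

variable {n : ℕ} {d : BiDegree n} {gp gm fp fm : PMF ℕ} {ε κ K μ ν : ℝ}

lemma BiDegree.Regular.reverse (h : d.Regular gp gm fp fm ε κ K) :
    d.reverse.Regular gm gp fm fp ε κ K := by
  refine ⟨?_, ?_⟩
  · have h1 := h.1
    have e : d.reverse.fMinus = d.fPlus := by
      rw [← BiDegree.fPlus_reverse]
      rfl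
    rw [BiDegree.gPlus_reverse, BiDegree.fPlus_reverse, e]
    change max (max _ (d1 (natLaw d.gPlus) _)) _ ≤ _
    rwa [max_comm (d1 (natLaw d.gMinus) _), max_comm (d1 (natLaw d.fMinus) _)]
  · refine le_of_eq_of_le (Finset.sum_congr rfl fun r _ => ?_) h.2
    change ((d.outDeg r : ℝ) ^ κ + (d.inDeg r : ℝ) ^ κ) * (d.inDeg r : ℝ) * (d.outDeg r : ℝ) = _
    ring

/-- The moment condition on the bi-degree sequences passes to the limit. -/
lemma sum_rpow_le (hν : 0 < ν) (hgm : pmfMean gm = ENNReal.ofReal ν) (hε : 0 < ε) (hκ : 0 < κ)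
    (hd : ∀ᶠ n : ℕ in atTop, ∃ d : BiDegree n, d.Regular gp gm fp fm ε κ K) (T : ℕ) :
    ∑ j ∈ Finset.range T, (fp j).toReal * (j : ℝ) ^ (1 + κ) ≤ 2 * K / ν := by
  have hκ' : 0 < 1 + κ := by linarith
  have hlim : Tendsto (fun n : ℕ => 2 * (n : ℝ) ^ (-ε)) atTop (𝓝 0) := by
    simpa using ((tendsto_rpow_neg_atTop hε).comp tendsto_natCast_atTop_atTop).const_mul 2
  have hlim2 : Tendsto (fun n : ℕ => 2 * K / ν + (T : ℝ) ^ (1 + κ) * (2 * (n : ℝ) ^ (-ε))) atTop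
      (𝓝 (2 * K / ν)) := by
    simpa using (hlim.const_mul ((T : ℝ) ^ (1 + κ))).const_add (2 * K / ν)
  refine ge_of_tendsto hlim2 ?_
  filter_upwards [hd, hlim.eventually_le_const (half_pos hν), eventually_gt_atTop 0]
    with n ⟨d, hd⟩ hen hn
  have hn' : (0 : ℝ) < n := by exact_mod_cast hn
  set e := 2 * (n : ℝ) ^ (-ε) with he
  have hpos : 0 < (n : ℝ) ^ (-ε) := Real.rpow_pos_of_pos hn' _
  have hlt : (n : ℝ) ^ (-ε) < e := by linarith
  have hedges : (n : ℝ) * (ν / 2) ≤ d.edges := by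
    have := (abs_le.1 (hd.abs_edges_sub_le hn hν hgm hlt)).1
    nlinarith
  have hedges0 : (0 : ℝ) < d.edges := lt_of_lt_of_le (by positivity) hedges
  obtain ⟨-, -, hc, -⟩ := hd.coupled hn hlt
  -- The truncated power has Lipschitz constant `T ^ (1 + κ)` on the integers, because distinct
  -- integers are at distance at least `1`; so its mean passes to the limit. Under `fPlus` this mean
  -- is at most `K n / L_n`.
  set h : ℕ → ℝ := fun j => if j < T then (j : ℝ) ^ (1 + κ) else 0 with hh
  have h0 : ∀ j, 0 ≤ h j := fun j => by
    simp only [hh]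
    split_ifs <;> positivity
  have hT : ∀ j, h j ≤ (T : ℝ) ^ (1 + κ) := fun j => by
    simp only [hh]
    split_ifs with hj
    · exact Real.rpow_le_rpow (Nat.cast_nonneg _) (by exact_mod_cast hj.le) hκ'.le
    · positivity
  have hle : ∀ j : ℕ, h j ≤ (j : ℝ) ^ (1 + κ) := fun j => by
    simp only [hh]
    split_ifs
    · exact le_rfl
    · positivity
  have key := hc.symm.tsum_le (g := fun j => ENNReal.ofReal (h j))
    (L := ENNReal.ofReal ((T : ℝ) ^ (1 + κ))) fun i j => by
      rcases eq_or_ne i j with rfl | hij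
      · simp
      · have : (1 : ℝ) ≤ |(i : ℝ) - j| := by
          have h1 : (1 : ℤ) ≤ |(i : ℤ) - j| := Int.one_le_abs (by omega)
          exact_mod_cast h1
        refine le_add_left ?_
        rw [← ENNReal.ofReal_mul (by positivity)]
        refine ENNReal.ofReal_le_ofReal ((hT i).trans ?_)
        exact le_mul_of_one_le_right (by positivity) this
  have e1 : ∑' j, fp j * ENNReal.ofReal (h j) =
      ENNReal.ofReal (∑ j ∈ Finset.range T, (fp j).toReal * (j : ℝ) ^ (1 + κ)) := by
    rw [ENNReal.ofReal_sum_of_nonneg fun j _ => by positivity,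
      tsum_eq_sum (s := Finset.range T) fun j hj => by
        simp [hh, Finset.mem_range.not.1 hj]]
    refine Finset.sum_congr rfl fun j hj => ?_
    rw [ENNReal.ofReal_mul ENNReal.toReal_nonneg, ENNReal.ofReal_toReal (fp.apply_ne_top j)]
    simp [hh, Finset.mem_range.1 hj]
  have e2 : ∑' j, d.fPlus j * ENNReal.ofReal (h j) =
      ENNReal.ofReal ((∑ r, (d.inDeg r : ℝ) * h (d.outDeg r)) / d.edges) := by
    have := tsum_empirical d.outDeg d.inDeg (d.edges : ℝ≥0∞) fun j => ENNReal.ofReal (h j)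
    unfold BiDegree.fPlus
    rw [this, ENNReal.ofReal_div_of_pos hedges0, ENNReal.ofReal_natCast,
      ENNReal.ofReal_sum_of_nonneg fun r _ => mul_nonneg (Nat.cast_nonneg _) (h0 _)]
    congr 1
    refine Finset.sum_congr rfl fun r _ => ?_
    rw [ENNReal.ofReal_mul (Nat.cast_nonneg _), ENNReal.ofReal_natCast]
  have hsum : (∑ r, (d.inDeg r : ℝ) * h (d.outDeg r)) ≤ K * n := by
    refine le_trans (Finset.sum_le_sum fun r _ => ?_) hd.2
    have h1 : h (d.outDeg r) ≤ (d.outDeg r : ℝ) ^ κ * d.outDeg r := by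
      refine (hle _).trans_eq ?_
      rcases Nat.eq_zero_or_pos (d.outDeg r) with h0 | h0
      · simp [h0, hκ'.ne']
      · rw [add_comm, Real.rpow_add_one (by exact_mod_cast h0.ne')]
    have h2 : 0 ≤ (d.inDeg r : ℝ) ^ κ := by positivity
    have h3 := mul_le_mul_of_nonneg_left h1 (Nat.cast_nonneg (α := ℝ) (d.inDeg r))
    have h4 : 0 ≤ (d.inDeg r : ℝ) ^ κ * d.outDeg r * d.inDeg r := by positivity
    nlinarith
  have hK : 0 ≤ K * n := le_trans
    (Finset.sum_nonneg fun r _ => mul_nonneg (Nat.cast_nonneg _) (h0 _)) hsum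
  have hfin : (∑ r, (d.inDeg r : ℝ) * h (d.outDeg r)) / d.edges ≤ 2 * K / ν := by
    rw [div_le_div_iff₀ hedges0 hν]
    have hK0 : 0 ≤ K := nonneg_of_mul_nonneg_left hK hn'
    nlinarith
  have hnn : 0 ≤ (∑ r, (d.inDeg r : ℝ) * h (d.outDeg r)) / d.edges :=
    div_nonneg (Finset.sum_nonneg fun r _ => mul_nonneg (Nat.cast_nonneg _) (h0 _)) hedges0.le
  rw [e1, e2, ← ENNReal.ofReal_mul (by positivity), ← ENNReal.ofReal_add hnn (by positivity),
    ENNReal.ofReal_le_ofReal_iff (by positivity)] at key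
  linarith

end Moment

/-! ### From fixed to random bi-degree sequences -/

section Mixture

variable {n : ℕ}

instance : Countable (BiDegree n) := by
  refine Function.Injective.countable
    (f := fun d : BiDegree n => (d.inDeg, d.outDeg)) fun d d' h => ?_
  cases d
  cases d'
  simp_all

instance : DiscreteMeasurableSpace (Graph n) := ⟨fun _ => trivial⟩

variable {Ω : Type*} [MeasurableSpace Ω] {P : Measure Ω}
  {G : Ω → Graph n} {U V : Ω → Fin n}

lemma extensions_empty {α β : Type*} [Fintype α] [Fintype β] [DecidableEq α] [DecidableEq β] :
    extensions (∅ : Finset (α × β)) = Finset.univ := by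
  ext σ
  simp [mem_extensions]

lemma BiDegree.nonempty_equiv (d : BiDegree n) : Nonempty (d.OutStub ≃ d.InStub) :=
  Fintype.card_eq.1 (by rw [BiDegree.card_outStub, BiDegree.card_inStub])

lemma BiDegree.prob_not (d : BiDegree n) (hn : 0 < n) (E : Graph n → Fin n → Fin n → Prop) :
    d.prob (fun G u v => ¬ E G u v) = 1 - d.prob E := by
  have hn' : (n : ℝ) ≠ 0 := by exact_mod_cast hn.ne'
  obtain ⟨σ₀⟩ := d.nonempty_equiv
  have hc : (Fintype.card (d.OutStub ≃ d.InStub) : ℝ) ≠ 0 := by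
    exact_mod_cast (Fintype.card_pos_iff.2 ⟨σ₀⟩).ne'
  rw [eq_sub_iff_add_eq]
  unfold BiDegree.prob
  rw [← add_div, ← add_div, ← Finset.sum_add_distrib]
  rw [Finset.sum_congr rfl (g := fun _ => (n : ℝ)) fun u _ => ?_]
  · simp [hn']
  · rw [← Finset.sum_add_distrib, Finset.sum_congr rfl (g := fun _ => (1 : ℝ)) fun v _ => ?_]
    · simp
    · simp only [condMean, extensions_empty, Finset.card_univ]
      rw [← add_div, ← Finset.sum_add_distrib, div_eq_one_iff_eq hc,
        Finset.sum_congr rfl (g := fun _ => (1 : ℝ)) fun σ _ => ?_]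
      · simp
      · by_cases h : E ⟨d, σ⟩ u v <;> simp [h]

lemma IsDCM.measurableSet (h : IsDCM P G U V) (E : Graph n → Fin n → Fin n → Prop) :
    MeasurableSet {ω | E (G ω) (U ω) (V ω)} := by
  have e : {ω | E (G ω) (U ω) (V ω)} =
      ⋃ u, ⋃ v, G ⁻¹' {x | E x u v} ∩ (U ⁻¹' {u} ∩ V ⁻¹' {v}) := by
    ext ω
    simp
  rw [e]
  exact MeasurableSet.iUnion fun u => MeasurableSet.iUnion fun v =>
    (h.measurable_graph (MeasurableSet.of_discrete)).inter
      ((h.measurable_fst (measurableSet_singleton u)).inter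
        (h.measurable_snd (measurableSet_singleton v)))

variable [IsProbabilityMeasure P]

/-- Given the degrees, matching and nodes are uniform, so the probability is a counting average over
triples. -/
lemma IsDCM.measure_inter_deg (h : IsDCM P G U V) (E : Graph n → Fin n → Fin n → Prop)
    (d : BiDegree n) :
    P.real {ω | E (G ω) (U ω) (V ω) ∧ (G ω).deg = d} =
      P.real {ω | (G ω).deg = d} * d.prob E := by
  classical
  set S : Finset (Fin n × Fin n × (d.OutStub ≃ d.InStub)) :=
    Finset.univ.filter fun x => E ⟨d, x.2.2⟩ x.1 x.2.1 with hS
  have e : {ω | E (G ω) (U ω) (V ω) ∧ (G ω).deg = d} =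
      ⋃ x ∈ S, {ω | G ω = ⟨d, x.2.2⟩ ∧ U ω = x.1 ∧ V ω = x.2.1} := by
    ext ω
    simp only [Set.mem_ofPred_eq, Set.mem_iUnion, hS, Finset.mem_filter, Finset.mem_univ, true_and]
    constructor
    · rintro ⟨hE, rfl⟩
      exact ⟨(U ω, V ω, (G ω).pairing), hE, rfl, rfl, rfl⟩
    · rintro ⟨x, hE, hG, hU, hV⟩
      rw [hG, hU, hV]
      exact ⟨hE, rfl⟩
  have hd : Set.PairwiseDisjoint (S : Set (Fin n × Fin n × (d.OutStub ≃ d.InStub)))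
      fun x => {ω | G ω = ⟨d, x.2.2⟩ ∧ U ω = x.1 ∧ V ω = x.2.1} := by
    intro x _ y _ hxy
    refine Set.disjoint_left.2 ?_
    rintro ω ⟨h1, h2, h3⟩ ⟨h4, h5, h6⟩
    refine hxy (Prod.ext (h2.symm.trans h5) (Prod.ext (h3.symm.trans h6) ?_))
    have := h1.symm.trans h4
    simpa using this
  rw [e, measureReal_biUnion_finset hd fun x _ =>
    h.measurableSet fun g u v => g = ⟨d, x.2.2⟩ ∧ u = x.1 ∧ v = x.2.1]
  have hx : ∀ x : Fin n × Fin n × (d.OutStub ≃ d.InStub),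
      P.real {ω | G ω = ⟨d, x.2.2⟩ ∧ U ω = x.1 ∧ V ω = x.2.1} =
      P.real {ω | (G ω).deg = d} *
        ((Fintype.card (d.OutStub ≃ d.InStub) : ℝ)⁻¹ * ((n : ℝ)⁻¹ * (n : ℝ)⁻¹)) := by
    intro x
    rw [measureReal_def, h.law]
    simp [measureReal_def, ENNReal.toReal_mul, Nat.card_eq_fintype_card]
  simp_rw [hx]
  rw [Finset.sum_const, nsmul_eq_mul]
  have e2 : d.prob E =
      S.card * ((Fintype.card (d.OutStub ≃ d.InStub) : ℝ)⁻¹ * ((n : ℝ)⁻¹ * (n : ℝ)⁻¹)) := by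
    have e3 : (S.card : ℝ) =
        ∑ u, ∑ v, ∑ σ : d.OutStub ≃ d.InStub, if E ⟨d, σ⟩ u v then (1 : ℝ) else 0 := by
      rw [hS, Finset.card_filter]
      push_cast
      rw [Fintype.sum_prod_type]
      simp_rw [Fintype.sum_prod_type]
    unfold BiDegree.prob
    simp only [condMean, extensions_empty, Finset.card_univ]
    rw [e3]
    simp_rw [← Finset.sum_div]
    rw [div_eq_mul_inv, div_eq_mul_inv, div_eq_mul_inv]
    simp only [mul_assoc]
  rw [e2]
  ring

/-- Total probability over the countably many bi-degree sequences: a bound that is uniform over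
those satisfying `R` survives, up to the probability that `R` fails. -/
lemma IsDCM.measure_le (h : IsDCM P G U V) (E : Graph n → Fin n → Fin n → Prop)
    {R : BiDegree n → Prop} {b : ℝ} (hb : 0 ≤ b) (hR : ∀ d, R d → d.prob E ≤ b) :
    P.real {ω | E (G ω) (U ω) (V ω)} ≤ b + P.real {ω | ¬ R (G ω).deg} := by
  have h1 : P {ω | E (G ω) (U ω) (V ω) ∧ R (G ω).deg} ≤ ENNReal.ofReal b := by
    have e : {ω | E (G ω) (U ω) (V ω) ∧ R (G ω).deg} =
        ⋃ d, {ω | (E (G ω) (U ω) (V ω) ∧ R (G ω).deg) ∧ (G ω).deg = d} := by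
      ext ω
      simp
    have e2 : (Set.univ : Set Ω) = ⋃ d, {ω | (G ω).deg = d} := by
      ext ω
      simp
    have hdisj : Pairwise (Function.onFun Disjoint fun d => {ω | (G ω).deg = d}) := by
      intro d d' hdd
      refine Set.disjoint_left.2 ?_
      rintro ω rfl h2
      exact hdd h2
    have hm : ∀ d, MeasurableSet {ω | (G ω).deg = d} := fun d =>
      h.measurableSet fun g _ _ => g.deg = d
    have hle : ∀ d, P {ω | (E (G ω) (U ω) (V ω) ∧ R (G ω).deg) ∧ (G ω).deg = d} ≤
        ENNReal.ofReal b * P {ω | (G ω).deg = d} := by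
      intro d
      by_cases hd : R d
      · have h2 := h.measure_inter_deg E d
        have h3 : P {ω | (E (G ω) (U ω) (V ω) ∧ R (G ω).deg) ∧ (G ω).deg = d} ≤
            P {ω | E (G ω) (U ω) (V ω) ∧ (G ω).deg = d} :=
          measure_mono fun ω hω => ⟨hω.1.1, hω.2⟩
        refine h3.trans ?_
        rw [← ofReal_measureReal, ← ofReal_measureReal (s := {ω | (G ω).deg = d}),
          ← ENNReal.ofReal_mul hb, h2, mul_comm b]
        exact ENNReal.ofReal_le_ofReal (mul_le_mul_of_nonneg_left (hR d hd) measureReal_nonneg)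
      · have : {ω | (E (G ω) (U ω) (V ω) ∧ R (G ω).deg) ∧ (G ω).deg = d} = ∅ := by
          ext ω
          simp only [Set.mem_ofPred_eq, Set.mem_empty_iff_false, iff_false]
          rintro ⟨⟨-, h1⟩, rfl⟩
          exact hd h1
        rw [this]
        simp
    calc P {ω | E (G ω) (U ω) (V ω) ∧ R (G ω).deg}
        ≤ ∑' d, P {ω | (E (G ω) (U ω) (V ω) ∧ R (G ω).deg) ∧ (G ω).deg = d} := by
          conv_lhs => rw [e]
          exact measure_iUnion_le _
      _ ≤ ∑' d, ENNReal.ofReal b * P {ω | (G ω).deg = d} := ENNReal.tsum_le_tsum hle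
      _ = ENNReal.ofReal b := by
          rw [ENNReal.tsum_mul_left, ← measure_iUnion hdisj hm, ← e2, measure_univ, mul_one]
  have h2 : P.real {ω | E (G ω) (U ω) (V ω) ∧ R (G ω).deg} ≤ b :=
    ENNReal.toReal_le_of_le_ofReal hb h1
  refine le_trans ?_ (add_le_add_left h2 _)
  refine (measureReal_mono ?_).trans (measureReal_union_le _ _)
  intro ω hω
  by_cases hR' : R (G ω).deg
  · exact Or.inl ⟨hω, hR'⟩
  · exact Or.inr hR'

lemma IsDCM.le_measure (h : IsDCM P G U V) (hn : 0 < n) (E : Graph n → Fin n → Fin n → Prop)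
    {R : BiDegree n → Prop} {b : ℝ} (hb : b ≤ 1) (hR : ∀ d, R d → b ≤ d.prob E) :
    b - P.real {ω | ¬ R (G ω).deg} ≤ P.real {ω | E (G ω) (U ω) (V ω)} := by
  have h1 := h.measure_le (fun g u v => ¬ E g u v) (R := R) (b := 1 - b) (by linarith)
    fun d hd => by
      rw [BiDegree.prob_not d hn]
      linarith [hR d hd]
  have h2 := probReal_compl_eq_one_sub (μ := P) (h.measurableSet E)
  change P.real {ω | ¬ E (G ω) (U ω) (V ω)} = _ at h2
  linarith

end Mixture

/-! ### The accumulated errors vanish -/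

section Errors

variable {μ ν δ t R : ℝ}

/-- The error is monotone in the powers, the depths and `1 / N`, so all of them may be replaced by
explicit bounds. -/
lemma error_le {N ψ x₀ x₁ pA pH gA gH i n : ℝ} {A H : ℕ} (hμ : 1 < μ) (hδ : 0 ≤ δ) (ht : 0 < t)
    (hR : 0 ≤ R) (hN : 0 ≤ N) (hψ : 0 ≤ ψ) (hx₀ : 0 ≤ x₀) (hx₁ : 0 ≤ x₁)
    (hpA : (μ + (3 * μ + 4) * δ) ^ A ≤ pA) (hpH : (μ + (3 * μ + 4) * δ) ^ H ≤ pH)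
    (hA : (A : ℝ) ≤ gA) (hH : (H : ℝ) ≤ gH) (hi : 1 / N ≤ i) :
    R * slope μ δ (t / 2) 0 (ψ + 1 / (N * δ) + R * slopeRate μ δ N H) x₀ A +
      (R * slope μ δ t 0 0 x₁ H + 1 / n + 2 * δ) ≤
    R * (pA * (ψ + i / δ + R * (pH * (gH * ((3 * μ + 4) * δ * (i * (1 + 1 / (μ - 1)))))) +
      gA * ((3 * μ + 4) * δ * x₀ + 2 / t))) +
      (R * (pH * (gH * ((3 * μ + 4) * δ * x₁ + 1 / t))) + 1 / n + 2 * δ) := by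
  have hμ1 : 0 < μ - 1 := by linarith
  have hgH : 0 ≤ gH := (Nat.cast_nonneg _).trans hH
  have hgA : 0 ≤ gA := (Nat.cast_nonneg _).trans hA
  have hpH0 : 0 ≤ pH := le_trans (by positivity) hpH
  have hpA0 : 0 ≤ pA := le_trans (by positivity) hpA
  have hi0 : 0 ≤ i := le_trans (by positivity) hi
  have h1 : 1 / (N * δ) ≤ i / δ := by
    rw [← div_div]
    exact div_le_div_of_nonneg_right hi hδ
  have h2 : 1 / (t / 2) = 2 / t := by field_simp
  unfold slope slopeRate
  simp only [zero_mul, add_zero, zero_add, h2]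
  gcongr

/-- The perturbed growth rate is at most `μ exp((3 μ + 4) δ)`, and over `G` generations the
exponential factor is at most `e < 3`. -/
lemma pow_le_three_mul {G : ℕ} (hμ : 1 < μ) (hδ : 0 ≤ δ) (h : (3 * μ + 4) * δ * G ≤ 1) :
    (μ + (3 * μ + 4) * δ) ^ G ≤ 3 * μ ^ G := by
  have h0 : 0 ≤ (3 * μ + 4) * δ := by nlinarith
  have h1 : μ + (3 * μ + 4) * δ ≤ μ * Real.exp ((3 * μ + 4) * δ) := by
    nlinarith [Real.add_one_le_exp ((3 * μ + 4) * δ)]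
  have h2 : Real.exp ((3 * μ + 4) * δ) ^ G ≤ 3 := by
    rw [← Real.exp_nat_mul]
    calc Real.exp (G * ((3 * μ + 4) * δ)) ≤ Real.exp 1 := Real.exp_le_exp.2 (by linarith)
      _ ≤ 3 := by linarith [Real.exp_one_lt_d9]
  calc (μ + (3 * μ + 4) * δ) ^ G ≤ (μ * Real.exp ((3 * μ + 4) * δ)) ^ G :=
        pow_le_pow_left₀ (by linarith) h1 G
    _ = μ ^ G * Real.exp ((3 * μ + 4) * δ) ^ G := mul_pow _ _ _
    _ ≤ μ ^ G * 3 := mul_le_mul_of_nonneg_left h2 (by positivity)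
    _ = _ := mul_comm _ _

lemma tendsto_natCast_rpow_neg {a : ℝ} (ha : a < 0) :
    Tendsto (fun n : ℕ => (n : ℝ) ^ a) atTop (𝓝 0) := by
  have := (tendsto_rpow_neg_atTop (y := -a) (by linarith)).comp tendsto_natCast_atTop_atTop
  simpa only [neg_neg, Function.comp_def] using this

/-- The error in the comparison vanishes as long as both explorations have size of order `√n`. -/
lemma eventually_error_le (hμ : 1 < μ) (hν : 0 < ν) (hR : 0 ≤ R) {c C C₁ : ℝ} (hc : 0 < c)
    (hc8 : c ≤ 1 / 8) (hC : 0 < C) (hC₁ : 0 < C₁) {η : ℝ} (hη : 0 < η) :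
    ∀ᶠ n : ℕ in atTop, ∀ (A H : ℕ) (N : ℝ), μ ^ A ≤ C₁ * (n : ℝ) ^ (1 / 2 : ℝ) →
      μ ^ H ≤ C₁ * (n : ℝ) ^ (1 / 2 : ℝ) → (A : ℝ) ≤ (n : ℝ) ^ (c / 2) →
      (H : ℝ) ≤ (n : ℝ) ^ (c / 2) → ν / 2 * n ≤ N →
      R * slope μ (C * (n : ℝ) ^ (-c)) ((n : ℝ) ^ (5 / 8 : ℝ) / 2) 0
        (1 / (N * (C * (n : ℝ) ^ (-c))) + R * slopeRate μ (C * (n : ℝ) ^ (-c)) N H)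
        (C₁ * (n : ℝ) ^ (-(1 / 2) : ℝ)) A +
      (R * slope μ (C * (n : ℝ) ^ (-c)) ((n : ℝ) ^ (5 / 8 : ℝ)) 0 0 0 H + 1 / n +
        2 * (C * (n : ℝ) ^ (-c))) ≤ η := by
  have hμ1 : 0 < μ - 1 := by linarith
  set L := 3 * μ + 4 with hL
  have hL0 : 0 < L := by linarith
  set P := 3 * C₁ with hP
  have l1 : Tendsto (fun n : ℕ => (n : ℝ) ^ (c - 1 / 2)) atTop (𝓝 0) :=
    tendsto_natCast_rpow_neg (by linarith)
  have l2 : Tendsto (fun n : ℕ => (n : ℝ) ^ (-(c / 2))) atTop (𝓝 0) :=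
    tendsto_natCast_rpow_neg (by linarith)
  have l3 : Tendsto (fun n : ℕ => (n : ℝ) ^ (c / 2 - 1 / 8)) atTop (𝓝 0) :=
    tendsto_natCast_rpow_neg (by linarith)
  have l4 : Tendsto (fun n : ℕ => 1 / (n : ℝ)) atTop (𝓝 0) := tendsto_one_div_atTop_nhds_zero_nat
  -- In terms of `y = n ^ (c/2)`, `z = √n` and `w = n ^ (1/8)` the whole bound is a polynomial,
  -- without constant term, in `y² / z`, `1 / y`, `y / w` and `1 / n`, all of which tend to zero.
  set Φ : ℝ × ℝ × ℝ × ℝ → ℝ := fun x =>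
    R * P * (2 / (ν * C)) * x.1 + R ^ 2 * P ^ 2 * L * C * (2 / ν) * (1 + 1 / (μ - 1)) * x.2.1 +
      R * P * L * C * C₁ * x.2.1 + 3 * R * P * x.2.2.1 + x.2.2.2 + 2 * C * x.2.1 ^ 2 with hΦ
  have hΦc : Continuous Φ := by
    rw [hΦ]
    fun_prop
  have hlim := (hΦc.tendsto (0, 0, 0, 0)).comp
    (l1.prodMk_nhds (l2.prodMk_nhds (l3.prodMk_nhds l4)))
  have hΦ0 : Φ (0, 0, 0, 0) = 0 := by simp [hΦ]
  rw [hΦ0] at hlim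
  have hsmall : ∀ᶠ n : ℕ in atTop, L * C * (n : ℝ) ^ (-(c / 2)) ≤ 1 := by
    have := l2.const_mul (L * C)
    rw [mul_zero] at this
    exact this.eventually_le_const one_pos
  filter_upwards [hlim.eventually_le_const hη, hsmall, eventually_gt_atTop 0] with n hn1 hn2 hn3
    A H N hA hH hA' hH' hN
  have hn : (0 : ℝ) < n := by exact_mod_cast hn3
  set y := (n : ℝ) ^ (c / 2) with hy
  set z := (n : ℝ) ^ (1 / 2 : ℝ) with hz
  set w := (n : ℝ) ^ (1 / 8 : ℝ) with hw
  have hy0 : 0 < y := Real.rpow_pos_of_pos hn _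
  have hz0 : 0 < z := Real.rpow_pos_of_pos hn _
  have hw0 : 0 < w := Real.rpow_pos_of_pos hn _
  have e1 : (n : ℝ) ^ (-c) = 1 / y ^ 2 := by
    rw [Real.rpow_neg hn.le, hy, ← Real.rpow_natCast, ← Real.rpow_mul hn.le, one_div]
    norm_num
  have e2 : (n : ℝ) ^ (5 / 8 : ℝ) = z * w := by
    rw [hz, hw, ← Real.rpow_add hn]
    norm_num
  have e3 : (n : ℝ) ^ (-(1 / 2) : ℝ) = 1 / z := by
    rw [Real.rpow_neg hn.le, ← hz, one_div]
  have e4 : (n : ℝ) = z ^ 2 := by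
    rw [hz, ← Real.rpow_natCast, ← Real.rpow_mul hn.le]
    norm_num
  have e5 : (n : ℝ) ^ (c - 1 / 2) = y ^ 2 / z := by
    rw [Real.rpow_sub hn, ← hz, hy, ← Real.rpow_natCast, ← Real.rpow_mul hn.le]
    norm_num
  have e6 : (n : ℝ) ^ (-(c / 2)) = 1 / y := by rw [Real.rpow_neg hn.le, one_div]
  have e7 : (n : ℝ) ^ (c / 2 - 1 / 8) = y / w := by rw [Real.rpow_sub hn]
  rw [e6] at hn2
  simp only [Function.comp_apply, e5, e6, e7] at hn1
  rw [e1, e2, e3]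
  set δ := C * (1 / y ^ 2) with hδ
  have hδ0 : 0 < δ := by positivity
  have hpow : ∀ G : ℕ, μ ^ G ≤ C₁ * z → (G : ℝ) ≤ y → (μ + (3 * μ + 4) * δ) ^ G ≤ P * z := by
    intro G h1 h2
    refine (pow_le_three_mul hμ hδ0.le ?_).trans ?_
    · have : L * δ * G ≤ L * δ * y := mul_le_mul_of_nonneg_left h2 (by positivity)
      refine this.trans (le_of_eq_of_le ?_ hn2)
      rw [hδ]
      field_simp
    · rw [hP, mul_assoc]
      linarith
  have hN0 : 0 < N := lt_of_lt_of_le (by positivity) hN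
  have hi : 1 / N ≤ 2 / (ν * z ^ 2) := by
    rw [div_le_div_iff₀ hN0 (by positivity), ← e4]
    linarith
  have key := error_le (n := n) (ψ := 0) (x₁ := 0) (x₀ := C₁ * (1 / z)) hμ hδ0.le
    (by positivity : 0 < z * w) hR hN0.le
    le_rfl (by positivity) le_rfl (hpow A hA hA') (hpow H hH hH') hA' hH' hi
  rw [zero_add] at key
  refine key.trans (le_of_eq_of_le ?_ hn1)
  simp only [hΦ, ← hL]
  rw [hδ]
  field_simp
  ring

/-- The error in the comparison vanishes for a fixed number of generations. -/
lemma eventually_error_le_of_fixed (hμ : 1 < μ) (hν : 0 < ν) (hR : 0 ≤ R) {c C C₁ : ℝ} (hc : 0 < c)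
    (hc8 : c ≤ 1 / 8) (hC : 0 < C) (hC₁ : 0 ≤ C₁) (m : ℕ) {η : ℝ} (hη : 0 < η) :
    ∀ᶠ n : ℕ in atTop, ∀ N : ℝ, ν / 2 * n ≤ N →
      R * slope μ (C * (n : ℝ) ^ (-c)) ((n : ℝ) ^ (5 / 8 : ℝ) / 2) 0
        (C₁ / N + 1 / (N * (C * (n : ℝ) ^ (-c))) + R * slopeRate μ (C * (n : ℝ) ^ (-c)) N m) 1 m +
      (R * slope μ (C * (n : ℝ) ^ (-c)) ((n : ℝ) ^ (5 / 8 : ℝ)) 0 0 1 m + 1 / n +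
        2 * (C * (n : ℝ) ^ (-c))) ≤ η := by
  have hμ1 : 0 < μ - 1 := by linarith
  set L := 3 * μ + 4 with hL
  have hL0 : 0 < L := by linarith
  have l1 : Tendsto (fun n : ℕ => (n : ℝ) ^ (c - 1)) atTop (𝓝 0) :=
    tendsto_natCast_rpow_neg (by linarith)
  have l2 : Tendsto (fun n : ℕ => (n : ℝ) ^ (-c)) atTop (𝓝 0) :=
    tendsto_natCast_rpow_neg (by linarith)
  have l3 : Tendsto (fun n : ℕ => (n : ℝ) ^ (-(5 / 8) : ℝ)) atTop (𝓝 0) :=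
    tendsto_natCast_rpow_neg (by norm_num)
  have l4 : Tendsto (fun n : ℕ => 1 / (n : ℝ)) atTop (𝓝 0) := tendsto_one_div_atTop_nhds_zero_nat
  set p := 3 * μ ^ m with hp
  set Φ : ℝ × ℝ × ℝ × ℝ → ℝ := fun x =>
    R * (p * (C₁ * (2 / ν * x.2.2.2) + 2 / (ν * C) * x.1 +
      R * (p * (m * (L * (C * x.2.1) * (2 / ν * x.2.2.2 * (1 + 1 / (μ - 1)))))) +
      m * (L * (C * x.2.1) * 1 + 2 * x.2.2.1))) +
      (R * (p * (m * (L * (C * x.2.1) * 1 + x.2.2.1))) + x.2.2.2 + 2 * (C * x.2.1)) with hΦ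
  have hΦc : Continuous Φ := by
    rw [hΦ]
    fun_prop
  have hlim := (hΦc.tendsto (0, 0, 0, 0)).comp
    (l1.prodMk_nhds (l2.prodMk_nhds (l3.prodMk_nhds l4)))
  have hΦ0 : Φ (0, 0, 0, 0) = 0 := by simp [hΦ]
  rw [hΦ0] at hlim
  have hsmall : ∀ᶠ n : ℕ in atTop, L * C * m * (n : ℝ) ^ (-c) ≤ 1 := by
    have := l2.const_mul (L * C * m)
    rw [mul_zero] at this
    exact this.eventually_le_const one_pos
  filter_upwards [hlim.eventually_le_const hη, hsmall, eventually_gt_atTop 0] with n hn1 hn2 hn3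
    N hN
  have hn : (0 : ℝ) < n := by exact_mod_cast hn3
  set x := (n : ℝ) ^ (-c) with hx
  have hx0 : 0 < x := Real.rpow_pos_of_pos hn _
  have ht0 : 0 < (n : ℝ) ^ (5 / 8 : ℝ) := Real.rpow_pos_of_pos hn _
  have hN0 : 0 < N := lt_of_lt_of_le (by positivity) hN
  have hi : 1 / N ≤ 2 / (ν * n) := by
    rw [div_le_div_iff₀ hN0 (by positivity)]
    linarith
  have hpow := pow_le_three_mul (G := m) (δ := C * x) hμ (by positivity) (by linarith)
  have key := error_le (n := n) (ψ := C₁ / N) (x₁ := 1) (x₀ := 1) hμ (by positivity : 0 ≤ C * x)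
    ht0 hR hN0.le (by positivity) zero_le_one zero_le_one hpow hpow le_rfl le_rfl hi
  refine key.trans ?_
  have h1 : C₁ / N ≤ C₁ * (2 / ν * (1 / n)) := by
    rw [div_eq_mul_one_div]
    refine mul_le_mul_of_nonneg_left (hi.trans_eq ?_) hC₁
    field_simp
  refine le_trans ?_ hn1
  have e1 : (n : ℝ) ^ (c - 1) = 1 / (x * n) := by
    rw [hx, Real.rpow_sub hn, Real.rpow_neg hn.le, Real.rpow_one]
    field_simp
  have e2 : (n : ℝ) ^ (-(5 / 8) : ℝ) = 1 / (n : ℝ) ^ (5 / 8 : ℝ) := by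
    rw [Real.rpow_neg hn.le, one_div]
  simp only [Function.comp_apply, hΦ, e1, e2]
  have e3 : 2 / (ν * n) / (C * x) = 2 / (ν * C) * (1 / (x * n)) := by field_simp
  have e4 : 2 / (ν * (n : ℝ)) = 2 / ν * (1 / n) := by field_simp
  have e5 : 2 / (n : ℝ) ^ (5 / 8 : ℝ) = 2 * (1 / (n : ℝ) ^ (5 / 8 : ℝ)) := by field_simp
  rw [e3, e4, e5]
  gcongr

end Errors

/-! ### Replacing the branching processes by their martingale limits -/

section HopcountLimit

variable {gp gm fp fm : PMF ℕ} {ν μ ε κ K : ℝ}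

lemma abs_exp_neg_sub_le {x y : ℝ} (hx : 0 ≤ x) (hy : 0 ≤ y) :
    |Real.exp (-x) - Real.exp (-y)| ≤ min 1 |x - y| := by
  have hx1 := Real.exp_le_one_iff.2 (neg_nonpos.2 hx)
  have hy1 := Real.exp_le_one_iff.2 (neg_nonpos.2 hy)
  have hx0 := Real.exp_pos (-x)
  have hy0 := Real.exp_pos (-y)
  refine le_min (by rw [abs_le]; constructor <;> linarith) ?_
  have key : ∀ {a b : ℝ}, 0 ≤ a → a ≤ b → Real.exp (-a) - Real.exp (-b) ≤ b - a := by
    intro a b ha hab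
    have h1 : Real.exp (-b) = Real.exp (-a) * Real.exp (-(b - a)) := by
      rw [← Real.exp_add]
      ring_nf
    have h2 := Real.add_one_le_exp (-(b - a))
    have h3 := Real.exp_le_one_iff.2 (neg_nonpos.2 ha)
    have h4 := Real.exp_pos (-a)
    rw [h1]
    nlinarith
  rcases le_total x y with h | h
  · rw [abs_sub_comm x, abs_of_nonneg (sub_nonneg.2 h), abs_of_nonneg
      (sub_nonneg.2 (Real.exp_le_exp.2 (neg_le_neg h)))]
    exact key hx h
  · rw [abs_sub_comm, abs_of_nonneg (sub_nonneg.2 h), abs_of_nonneg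
      (sub_nonneg.2 (Real.exp_le_exp.2 (neg_le_neg h)))]
    exact key hy h

lemma ae_prod_tendsto (hν : 0 < ν) (hμ : 1 < μ) (hgp : pmfMean gp = ENNReal.ofReal ν)
    (hgm : pmfMean gm = ENNReal.ofReal ν) (hfp : pmfMean fp = ENNReal.ofReal μ)
    (hfm : pmfMean fm = ENNReal.ofReal μ) :
    ∀ᵐ χ ∂((offspringLaw gp fp).prod (offspringLaw gm fm)),
      Tendsto (gwMartingale ν μ χ.1) atTop (𝓝 (gwLimit ν μ χ.1)) ∧
      Tendsto (gwMartingale ν μ χ.2) atTop (𝓝 (gwLimit ν μ χ.2)) :=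
  (Measure.quasiMeasurePreserving_fst.ae (ae_tendsto_gwMartingale hν hμ hgp hfp)).and
    (Measure.quasiMeasurePreserving_snd.ae (ae_tendsto_gwMartingale hν hμ hgm hfm))

lemma gwLimit_nonneg_of_tendsto (hν : 0 < ν) (hμ : 1 < μ) {χ : ℕ × ℕ → ℕ}
    (h : Tendsto (gwMartingale ν μ χ) atTop (𝓝 (gwLimit ν μ χ))) : 0 ≤ gwLimit ν μ χ :=
  ge_of_tendsto' h (gwMartingale_nonneg hν hμ χ)

/-- The distance between the exponents of the transform of the hopcount and of its limit. -/
noncomputable def exponentGap (ν μ β : ℝ) (A H : ℕ) (χ : (ℕ × ℕ → ℕ) × (ℕ × ℕ → ℕ)) : ℝ :=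
  |gwMartingale ν μ χ.1 A * (progeny χ.2 H / μ ^ H) -
      gwLimit ν μ χ.1 * (ν / (μ - 1) * gwLimit ν μ χ.2)| +
    β * (gwMartingale ν μ χ.1 A * (progeny χ.2 H / μ ^ H))

lemma measurable_exponentGap (ν μ β : ℝ) (A H : ℕ) : Measurable (exponentGap ν μ β A H) := by
  have h1 : Measurable fun χ : (ℕ × ℕ → ℕ) × (ℕ × ℕ → ℕ) => gwMartingale ν μ χ.1 A :=
    (measurable_gwMartingale ν μ A).comp measurable_fst
  have h2 : Measurable fun χ : (ℕ × ℕ → ℕ) × (ℕ × ℕ → ℕ) => (progeny χ.2 H : ℝ) / μ ^ H :=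
    (((Measurable.of_discrete (f := fun j : ℕ => (j : ℝ))).comp
      (measurable_progeny H)).comp measurable_snd).div_const _
  have h3 : Measurable fun χ : (ℕ × ℕ → ℕ) × (ℕ × ℕ → ℕ) => gwLimit ν μ χ.1 :=
    (measurable_gwLimit ν μ).comp measurable_fst
  have h4 : Measurable fun χ : (ℕ × ℕ → ℕ) × (ℕ × ℕ → ℕ) => gwLimit ν μ χ.2 :=
    (measurable_gwLimit ν μ).comp measurable_snd
  unfold exponentGap
  exact (((h1.mul h2).sub (h3.mul (h4.const_mul _))).abs).add ((h1.mul h2).const_mul β)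

lemma exponentGap_nonneg (hν : 0 < ν) (hμ : 1 < μ) {β : ℝ} (hβ : 0 ≤ β) (A H : ℕ)
    (χ : (ℕ × ℕ → ℕ) × (ℕ × ℕ → ℕ)) : 0 ≤ exponentGap ν μ β A H χ := by
  have hμ0 : 0 < μ := by linarith
  have := gwMartingale_nonneg hν hμ χ.1 A
  unfold exponentGap
  positivity

/-- The gap tends to zero almost surely. The minimum with `1` provides domination, so convergence in
mean of the martingales is not required. -/
lemma tendsto_integral_exponentGap (hν : 0 < ν) (hμ : 1 < μ) (hgp : pmfMean gp = ENNReal.ofReal ν)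
    (hgm : pmfMean gm = ENNReal.ofReal ν) (hfp : pmfMean fp = ENNReal.ofReal μ)
    (hfm : pmfMean fm = ENNReal.ofReal μ) {A H : ℕ → ℕ} (hA : Tendsto A atTop atTop)
    (hH : Tendsto H atTop atTop) {β : ℕ → ℝ} (hβ0 : ∀ n, 0 ≤ β n) (hβ : Tendsto β atTop (𝓝 0))
    {a : ℝ} (ha : 0 ≤ a) :
    Tendsto (fun n => ∫ χ, min 1 (a * exponentGap ν μ (β n) (A n) (H n) χ)
      ∂((offspringLaw gp fp).prod (offspringLaw gm fm))) atTop (𝓝 0) := by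
  have h0 : (0 : ℝ) = ∫ _, 0 ∂((offspringLaw gp fp).prod (offspringLaw gm fm)) := by simp
  rw [h0]
  refine tendsto_integral_of_dominated_convergence (fun _ => 1) (fun n => ?_)
    (integrable_const _) (fun n => ae_of_all _ fun χ => ?_) ?_
  · exact (measurable_const.min ((measurable_exponentGap _ _ _ _ _).const_mul a)).aestronglyMeasurable
  · rw [Real.norm_of_nonneg (le_min zero_le_one
      (mul_nonneg ha (exponentGap_nonneg hν hμ (hβ0 n) _ _ χ)))]
    exact min_le_left _ _
  · filter_upwards [ae_prod_tendsto hν hμ hgp hgm hfp hfm] with χ ⟨h1, h2⟩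
    have h3 := (h1.comp hA).mul ((tendsto_progeny hν hμ h2).comp hH)
    have h4 := (h3.sub_const (gwLimit ν μ χ.1 * (ν / (μ - 1) * gwLimit ν μ χ.2))).abs
    have h5 := (tendsto_const_nhds (x := (1 : ℝ))).min ((h4.add (hβ.mul h3)).const_mul a)
    simp only [sub_self, abs_zero, zero_mul, add_zero, mul_zero] at h5
    rw [min_eq_right zero_le_one] at h5
    exact h5

/-- The transform that describes the hopcount, with the size of a generation of one branching
process and the total progeny of the other one. -/
lemma integral_genFun_progeny (A H : ℕ) {N : ℝ} (hN : 0 < N) :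
    ∫ i, genFun gp ((genStep fp 0)^[A] (Real.exp (-((i : ℕ) / N))))
      ∂((offspringLaw gm fm).map fun χ => progeny χ H) =
    ∫ χ, Real.exp (-((genSize χ.1 (A + 1) : ℝ) * progeny χ.2 H / N))
      ∂((offspringLaw gp fp).prod (offspringLaw gm fm)) := by
  have hm : Measurable fun χ : (ℕ × ℕ → ℕ) × (ℕ × ℕ → ℕ) =>
      Real.exp (-((genSize χ.1 (A + 1) : ℝ) * progeny χ.2 H / N)) := by
    refine Real.measurable_exp.comp (Measurable.neg (Measurable.div_const ?_ _))
    exact ((measurable_genSize_real (A + 1)).comp measurable_fst).mul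
      (((Measurable.of_discrete (f := fun j : ℕ => (j : ℝ))).comp
        (measurable_progeny H)).comp measurable_snd)
  have hint : Integrable (fun χ : (ℕ × ℕ → ℕ) × (ℕ × ℕ → ℕ) =>
      Real.exp (-((genSize χ.1 (A + 1) : ℝ) * progeny χ.2 H / N)))
      ((offspringLaw gp fp).prod (offspringLaw gm fm)) := by
    refine Integrable.of_bound hm.aestronglyMeasurable 1 (ae_of_all _ fun χ => ?_)
    rw [Real.norm_of_nonneg (Real.exp_nonneg _), Real.exp_le_one_iff, neg_nonpos]
    positivity
  rw [integral_prod_symm _ hint, integral_map (measurable_progeny H).aemeasurable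
    (Measurable.of_discrete).aestronglyMeasurable]
  refine integral_congr_ae (ae_of_all _ fun χ' => ?_)
  have hq : Real.exp (-((progeny χ' H : ℕ) / N)) ∈ Set.Icc (0 : ℝ) 1 :=
    ⟨Real.exp_nonneg _, Real.exp_le_one_iff.2 (neg_nonpos.2 (by positivity))⟩
  simp only
  rw [← integral_pow_genSize gp fp A hq]
  refine integral_congr_ae (ae_of_all _ fun χ => ?_)
  simp only
  rw [← Real.exp_nat_mul]
  congr 1
  ring

/-- Both exponents have the common factor `μ ^ (A + H) / n`, which stays bounded by `a`. The rest
differs through the convergence of the two processes and through the ratio `ν n / N`, whence the two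
parts of `exponentGap`. -/
lemma abs_integral_sub_le (hν : 0 < ν) (hμ : 1 < μ) (hgp : pmfMean gp = ENNReal.ofReal ν)
    (hgm : pmfMean gm = ENNReal.ofReal ν) (hfp : pmfMean fp = ENNReal.ofReal μ)
    (hfm : pmfMean fm = ENNReal.ofReal μ) (A H : ℕ) {N n β a : ℝ} (hN : 0 < N) (hn : 0 < n)
    (hβ : |ν * n / N - 1| ≤ β) (ha : μ ^ (A + H) / n ≤ a) :
    |∫ χ, Real.exp (-(ν / (μ - 1) * (μ ^ (A + H) / n) * (gwLimit ν μ χ.1 * gwLimit ν μ χ.2)))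
        ∂((offspringLaw gp fp).prod (offspringLaw gm fm)) -
      ∫ χ, Real.exp (-((genSize χ.1 (A + 1) : ℝ) * progeny χ.2 H / N))
        ∂((offspringLaw gp fp).prod (offspringLaw gm fm))| ≤
    ∫ χ, min 1 (a * exponentGap ν μ β A H χ)
      ∂((offspringLaw gp fp).prod (offspringLaw gm fm)) := by
  have hμ0 : 0 < μ := by linarith
  have hμ1 : 0 < μ - 1 := by linarith
  have hβ0 : 0 ≤ β := (abs_nonneg _).trans hβ
  have ha0 : 0 ≤ a := le_trans (by positivity) ha
  have hm1 : Measurable fun χ : (ℕ × ℕ → ℕ) × (ℕ × ℕ → ℕ) =>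
      Real.exp (-(ν / (μ - 1) * (μ ^ (A + H) / n) * (gwLimit ν μ χ.1 * gwLimit ν μ χ.2))) :=
    Real.measurable_exp.comp ((((measurable_gwLimit ν μ).comp measurable_fst).mul
      ((measurable_gwLimit ν μ).comp measurable_snd)).const_mul _).neg
  have hm2 : Measurable fun χ : (ℕ × ℕ → ℕ) × (ℕ × ℕ → ℕ) =>
      Real.exp (-((genSize χ.1 (A + 1) : ℝ) * progeny χ.2 H / N)) := by
    refine Real.measurable_exp.comp (Measurable.neg (Measurable.div_const ?_ _))
    exact ((measurable_genSize_real (A + 1)).comp measurable_fst).mul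
      (((Measurable.of_discrete (f := fun j : ℕ => (j : ℝ))).comp
        (measurable_progeny H)).comp measurable_snd)
  have hi1 : Integrable (fun χ : (ℕ × ℕ → ℕ) × (ℕ × ℕ → ℕ) =>
      Real.exp (-(ν / (μ - 1) * (μ ^ (A + H) / n) * (gwLimit ν μ χ.1 * gwLimit ν μ χ.2))))
      ((offspringLaw gp fp).prod (offspringLaw gm fm)) := by
    refine Integrable.of_bound hm1.aestronglyMeasurable 1 ?_
    filter_upwards [ae_prod_tendsto hν hμ hgp hgm hfp hfm] with χ ⟨h1, h2⟩
    have h1' := gwLimit_nonneg_of_tendsto hν hμ h1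
    have h2' := gwLimit_nonneg_of_tendsto hν hμ h2
    rw [Real.norm_of_nonneg (Real.exp_nonneg _), Real.exp_le_one_iff, neg_nonpos]
    positivity
  have hi2 : Integrable (fun χ : (ℕ × ℕ → ℕ) × (ℕ × ℕ → ℕ) =>
      Real.exp (-((genSize χ.1 (A + 1) : ℝ) * progeny χ.2 H / N)))
      ((offspringLaw gp fp).prod (offspringLaw gm fm)) := by
    refine Integrable.of_bound hm2.aestronglyMeasurable 1 (ae_of_all _ fun χ => ?_)
    rw [Real.norm_of_nonneg (Real.exp_nonneg _), Real.exp_le_one_iff, neg_nonpos]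
    positivity
  have hi3 : Integrable (fun χ => min 1 (a * exponentGap ν μ β A H χ))
      ((offspringLaw gp fp).prod (offspringLaw gm fm)) := by
    refine Integrable.of_bound (measurable_const.min
      ((measurable_exponentGap _ _ _ _ _).const_mul a)).aestronglyMeasurable 1
      (ae_of_all _ fun χ => ?_)
    rw [Real.norm_of_nonneg (le_min zero_le_one
      (mul_nonneg ha0 (exponentGap_nonneg hν hμ hβ0 _ _ χ)))]
    exact min_le_left _ _
  rw [← integral_sub hi1 hi2]
  refine (abs_integral_le_integral_abs).trans (integral_mono_ae (hi1.sub hi2).abs hi3 ?_)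
  filter_upwards [ae_prod_tendsto hν hμ hgp hgm hfp hfm] with χ ⟨h1, h2⟩
  have h1' := gwLimit_nonneg_of_tendsto hν hμ h1
  have h2' := gwLimit_nonneg_of_tendsto hν hμ h2
  rw [abs_sub_comm]
  refine (abs_exp_neg_sub_le (by positivity) (by positivity)).trans (min_le_min le_rfl ?_)
  set X := gwMartingale ν μ χ.1 A with hX
  set Y := (progeny χ.2 H : ℝ) / μ ^ H with hY
  have hX0 : 0 ≤ X := gwMartingale_nonneg hν hμ _ _
  have hY0 : 0 ≤ Y := by positivity
  set W := gwLimit ν μ χ.1 * (ν / (μ - 1) * gwLimit ν μ χ.2) with hW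
  set r := ν * n / N with hr
  have e : (genSize χ.1 (A + 1) : ℝ) * progeny χ.2 H / N -
      ν / (μ - 1) * (μ ^ (A + H) / n) * (gwLimit ν μ χ.1 * gwLimit ν μ χ.2) =
      μ ^ (A + H) / n * ((X * Y - W) + (r - 1) * (X * Y)) := by
    rw [hX, hY, hW, hr, gwMartingale, pow_add]
    field_simp
    ring
  rw [e, abs_mul, abs_of_nonneg (by positivity)]
  refine mul_le_mul ha ?_ (abs_nonneg _) ha0
  refine (abs_add_le _ _).trans ?_
  unfold exponentGap
  rw [abs_mul, abs_of_nonneg (mul_nonneg hX0 hY0)]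
  exact add_le_add le_rfl (mul_le_mul_of_nonneg_right hβ (mul_nonneg hX0 hY0))

end HopcountLimit

/-! ### The tail and the absence of a path, uniformly over regular sequences -/

section Uniform

variable {gp gm fp fm : PMF ℕ} {ν μ ε κ K : ℝ}

lemma zpow_floor_logb_le (hμ : 1 < μ) {x : ℝ} (hx : 0 < x) : μ ^ ⌊Real.logb μ x⌋ ≤ x := by
  have hμ0 : 0 < μ := by linarith
  rw [← Real.rpow_intCast]
  calc μ ^ ((⌊Real.logb μ x⌋ : ℤ) : ℝ) ≤ μ ^ Real.logb μ x :=
        Real.rpow_le_rpow_of_exponent_le hμ.le (Int.floor_le _)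
    _ = x := Real.rpow_logb hμ0 hμ.ne' hx

lemma tendsto_floor_logb_add (hμ : 1 < μ) (t : ℤ) :
    Tendsto (fun n : ℕ => ⌊Real.logb μ n⌋ + t) atTop atTop :=
  tendsto_atTop_add_const_right _ t (tendsto_floor_atTop.comp
    ((Real.tendsto_logb_atTop hμ).comp tendsto_natCast_atTop_atTop))

lemma tendsto_toNat_floor_logb (hμ : 1 < μ) (t : ℤ) :
    Tendsto (fun n : ℕ => (⌊Real.logb μ n⌋ + t).toNat) atTop atTop := by
  refine tendsto_atTop.2 fun b => ?_
  filter_upwards [(tendsto_floor_logb_add hμ t).eventually_ge_atTop (b : ℤ)] with n hn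
  omega

lemma eventually_toNat_le (hμ : 1 < μ) (t : ℤ) {a : ℝ} (ha : 0 < a) :
    ∀ᶠ n : ℕ in atTop, ((⌊Real.logb μ n⌋ + t).toNat : ℝ) ≤ (n : ℝ) ^ a := by
  have h1 : Tendsto (fun n : ℕ => Real.log n / (n : ℝ) ^ a) atTop (𝓝 0) :=
    (isLittleO_log_rpow_atTop ha).tendsto_div_nhds_zero.comp tendsto_natCast_atTop_atTop
  have h2 : Tendsto (fun n : ℕ => (n : ℝ) ^ (-a)) atTop (𝓝 0) :=
    tendsto_natCast_rpow_neg (by linarith)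
  have h3 := (h1.div_const (Real.log μ)).add (h2.const_mul |(t : ℝ)|)
  simp only [zero_div, mul_zero, add_zero] at h3
  filter_upwards [h3.eventually_le_const one_pos, eventually_gt_atTop 0,
    (tendsto_floor_logb_add hμ t).eventually_ge_atTop 0] with n hn hn0 hn1
  have hn' : (0 : ℝ) < n := by exact_mod_cast hn0
  have hpos : 0 < (n : ℝ) ^ a := Real.rpow_pos_of_pos hn' _
  have e : ((⌊Real.logb μ n⌋ + t).toNat : ℝ) = (⌊Real.logb μ n⌋ : ℝ) + t := by
    have : (((⌊Real.logb μ n⌋ + t).toNat : ℤ) : ℝ) = ((⌊Real.logb μ n⌋ + t : ℤ) : ℝ) := by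
      rw [Int.toNat_of_nonneg hn1]
    push_cast at this
    exact this
  rw [e]
  have h4 := Int.floor_le (Real.logb μ n)
  have h5 := le_abs_self (t : ℝ)
  rw [Real.rpow_neg hn'.le] at hn
  have h6 : Real.logb μ n + |(t : ℝ)| ≤ (n : ℝ) ^ a := by
    rw [Real.logb]
    have := mul_le_mul_of_nonneg_right hn hpos.le
    rw [one_mul] at this
    refine le_of_eq_of_le ?_ this
    have : Real.log μ ≠ 0 := (Real.log_pos hμ).ne'
    field_simp
  linarith

/-- Half of the total depth costs the square root of the total growth; the `+ 1` allows for an odd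
depth, where one search is one generation longer. -/
lemma pow_le_sqrt_mul (hμ : 1 < μ) {G M : ℕ} (hG : 2 * G ≤ M + 1) {b x : ℝ} (hb : 0 ≤ b)
    (hM : μ ^ M ≤ b * x) : μ ^ G ≤ √(μ * b) * x ^ (1 / 2 : ℝ) := by
  have hμ0 : 0 < μ := by linarith
  rw [← Real.sqrt_eq_rpow, ← Real.sqrt_mul (by positivity)]
  refine Real.le_sqrt_of_sq_le ?_
  calc (μ ^ G) ^ 2 = μ ^ (2 * G) := by rw [← pow_mul, mul_comm]
    _ ≤ μ ^ (M + 1) := pow_le_pow_right₀ hμ.le hG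
    _ = μ * μ ^ M := pow_succ' _ _
    _ ≤ μ * (b * x) := mul_le_mul_of_nonneg_left hM hμ0.le
    _ = μ * b * x := by ring

/-- The tail of the hopcount, uniformly over the regular bi-degree sequences. -/
theorem eventually_abs_prob_gt_le (hν : 0 < ν) (hμ : 1 < μ) (hgp : pmfMean gp = ENNReal.ofReal ν)
    (hgm : pmfMean gm = ENNReal.ofReal ν) (hfp : pmfMean fp = ENNReal.ofReal μ)
    (hfm : pmfMean fm = ENNReal.ofReal μ) (hε : 0 < ε) (hκ : 0 < κ) (hκ1 : κ ≤ 1) (t : ℤ) {η : ℝ}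
    (hη : 0 < η) :
    ∀ᶠ n : ℕ in atTop, ∀ d : BiDegree n, d.Regular gp gm fp fm ε κ K →
      |∫ χ, Real.exp (-(ν / (μ - 1) * (μ ^ (⌊Real.logb μ n⌋ + t) / n) *
          (gwLimit ν μ χ.1 * gwLimit ν μ χ.2)))
          ∂((offspringLaw gp fp).prod (offspringLaw gm fm)) -
        d.prob fun G u v => (((⌊Real.logb μ n⌋ + t).toNat : ℕ) : ℕ∞) < G.hopcount u v| ≤ η := by
  have hμ0 : 0 < μ := by linarith
  have hμ1 : 0 < μ - 1 := by linarith
  obtain ⟨c, C, hc, hc8, hC, hnear⟩ := eventually_near (K := K) hν hμ hgm hfp hfm hε hκ hκ1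
  set M : ℕ → ℕ := fun n => (⌊Real.logb μ n⌋ + t).toNat with hM
  have hMtop : Tendsto M atTop atTop := tendsto_toNat_floor_logb hμ t
  have hHtop : Tendsto (fun n => M n / 2) atTop atTop :=
    (Nat.tendsto_div_const_atTop two_ne_zero).comp hMtop
  have hAtop : Tendsto (fun n => M n - M n / 2) atTop atTop :=
    tendsto_atTop_mono (fun n => by omega) hHtop
  set b : ℝ := μ ^ t with hb
  have hb0 : 0 < b := zpow_pos hμ0 t
  set C₀ := √(μ * b) with hC₀
  have hC₀0 : 0 < C₀ := Real.sqrt_pos.2 (by positivity)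
  set C₁ := C₀ * (1 + 2 / (μ - 1)) with hC₁
  have hC₁0 : 0 < C₁ := by positivity
  have hC₀₁ : C₀ ≤ C₁ := by
    rw [hC₁]
    have : 0 ≤ 2 / (μ - 1) := by positivity
    nlinarith
  set β : ℕ → ℝ := fun n => 4 / ν * (n : ℝ) ^ (-c) with hβ
  have hclim := tendsto_natCast_rpow_neg (a := -c) (by linarith)
  have hβlim : Tendsto β atTop (𝓝 0) := by simpa using hclim.const_mul (4 / ν)
  have hgap := tendsto_integral_exponentGap hν hμ hgp hgm hfp hfm hAtop hHtop
    (fun n => (by positivity : 0 ≤ β n)) hβlim hb0.le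
  filter_upwards [hnear, eventually_error_le hμ hν (by linarith : 0 ≤ 2 * ν) hc hc8 hC hC₁0
      (half_pos hη), eventually_toNat_le hμ t (half_pos hc), hgap.eventually_le_const (half_pos hη),
    hclim.eventually_le_const (by positivity : 0 < ν / 4), eventually_gt_atTop 0,
    (tendsto_floor_logb_add hμ t).eventually_ge_atTop 0]
    with n hnear herr hMle hgap hcle hn0 hfloor d hd
  obtain ⟨hd1, hd2⟩ := hnear d hd
  have hn : (0 : ℝ) < n := by exact_mod_cast hn0
  have hMz : (M n : ℤ) = ⌊Real.logb μ n⌋ + t := Int.toNat_of_nonneg hfloor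
  have hpowM : μ ^ (⌊Real.logb μ n⌋ + t) = μ ^ M n := by rw [← hMz, zpow_natCast]
  have hMb : μ ^ M n ≤ b * n := by
    rw [← hpowM, zpow_add₀ hμ0.ne', mul_comm]
    exact mul_le_mul_of_nonneg_left (zpow_floor_logb_le hμ hn) hb0.le
  set H := M n / 2 with hH
  set A := M n - M n / 2 with hA
  have hAH : A + H = M n := by omega
  have hA2 := pow_le_sqrt_mul hμ (by omega : 2 * A ≤ M n + 1) hb0.le hMb
  have hH2 := pow_le_sqrt_mul hμ (by omega : 2 * H ≤ M n + 1) hb0.le hMb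
  have hz0 : 0 < (n : ℝ) ^ (1 / 2 : ℝ) := Real.rpow_pos_of_pos hn _
  have hA3 : (A : ℝ) ≤ M n := by exact_mod_cast (by omega : A ≤ M n)
  have hH3 : (H : ℝ) ≤ M n := by exact_mod_cast (by omega : H ≤ M n)
  set N : ℝ := (d.edges : ℝ) with hN
  have hcn := mul_le_mul_of_nonneg_right hcle hn.le
  have hNlow : ν / 2 * n ≤ N := by
    have := (abs_le.1 hd2).1
    nlinarith
  have hNpos : 0 < N := lt_of_lt_of_le (by positivity) hNlow
  have herr' := herr A H N (hA2.trans (mul_le_mul_of_nonneg_right hC₀₁ hz0.le))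
    (hH2.trans (mul_le_mul_of_nonneg_right hC₀₁ hz0.le)) (hA3.trans hMle) (hH3.trans hMle) hNlow
  set ρ := (offspringLaw gm fm).map fun χ => progeny χ H with hρ
  have : IsProbabilityMeasure ρ := Measure.isProbabilityMeasure_map
    (measurable_progeny H).aemeasurable
  set q : ℕ → ℝ := fun i => Real.exp (-((i : ℕ) / N)) with hq
  have hqm : ∀ i, q i ∈ Set.Icc (0 : ℝ) 1 := fun i =>
    ⟨Real.exp_nonneg _, Real.exp_le_one_iff.2 (neg_nonpos.2 (by positivity))⟩
  -- By `1 - exp(-y) ≤ y` this is the mean progeny divided by `N`, of order `√n / n`.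
  have hx₀ : ∫ i, (1 - q i) ∂ρ ≤ C₁ * (n : ℝ) ^ (-(1 / 2) : ℝ) := by
    rw [hρ, integral_map (measurable_progeny H).aemeasurable
      (Measurable.of_discrete).aestronglyMeasurable]
    calc ∫ χ, (1 - q (progeny χ H)) ∂(offspringLaw gm fm)
        ≤ ∫ χ, (progeny χ H : ℝ) / N ∂(offspringLaw gm fm) := by
          refine integral_mono ?_ ((integrable_progeny hμ hgm hfm H).div_const N) fun χ => ?_
          · refine Integrable.of_bound ((Measurable.of_discrete (f := fun i => 1 - q i)).comp
              (measurable_progeny H)).aestronglyMeasurable 1 (ae_of_all _ fun χ => ?_)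
            rw [Real.norm_eq_abs, abs_le]
            have := hqm (progeny χ H)
            exact ⟨by linarith [this.2], by linarith [this.1]⟩
          · have := Real.add_one_le_exp (-((progeny χ H : ℕ) / N))
            simp only [hq]
            linarith
      _ ≤ ν / (μ - 1) * μ ^ H / N := by
          rw [integral_div]
          exact div_le_div_of_nonneg_right (integral_progeny_le hν hμ hgm hfm H) hNpos.le
      _ ≤ ν / (μ - 1) * (C₀ * (n : ℝ) ^ (1 / 2 : ℝ)) / (ν / 2 * n) := by gcongr
      _ = C₀ * (2 / (μ - 1)) * (n : ℝ) ^ (-(1 / 2) : ℝ) := by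
          have e : (n : ℝ) ^ (-(1 / 2) : ℝ) = (n : ℝ) ^ (1 / 2 : ℝ) / n := by
            rw [← Real.rpow_sub_one hn.ne']
            norm_num
          rw [e]
          field_simp
      _ ≤ C₁ * (n : ℝ) ^ (-(1 / 2) : ℝ) := by
          refine mul_le_mul_of_nonneg_right ?_ (Real.rpow_nonneg hn.le _)
          rw [hC₁]
          exact mul_le_mul_of_nonneg_left (by linarith) hC₀0.le
  have hψ : ∀ k : ℕ, genFun gm ((genStep fm (k / d.edges))^[H] 1) = ∫ i, q i ^ k ∂ρ := by
    intro k
    rw [← integral_transform gm fm (by positivity) H (Set.right_mem_Icc.2 zero_le_one), hρ,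
      integral_map (measurable_progeny H).aemeasurable (Measurable.of_discrete).aestronglyMeasurable]
    refine integral_congr_ae (ae_of_all _ fun χ => ?_)
    simp only [one_pow, one_mul, hq]
    rw [← Real.exp_nat_mul]
    congr 1
    ring
  have h1 := hd1.prob_hopcount_gt hμ hfp hfm A H ρ hqm hx₀ hψ
  have h2 := abs_integral_sub_le (gp := gp) (gm := gm) (fp := fp) (fm := fm) hν hμ hgp hgm hfp hfm
    A H hNpos hn (β := β n) (a := b) (by
      rw [div_sub_one hNpos.ne', abs_div, abs_of_pos hNpos, div_le_iff₀ hNpos, abs_sub_comm,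
        mul_comm ν]
      refine hd2.trans ?_
      have : β n * (ν / 2 * n) ≤ β n * N :=
        mul_le_mul_of_nonneg_left hNlow (by positivity)
      refine le_trans (le_of_eq ?_) this
      simp only [hβ]
      field_simp
      norm_num) (by
      rw [hAH, div_le_iff₀ hn]
      exact hMb)
  rw [integral_genFun_progeny A H hNpos] at h1
  rw [hAH] at h2 h1
  rw [hpowM]
  have h3 := h1.trans herr'
  have h4 := h2.trans hgap
  exact (abs_sub_le _ _ _).trans (by linarith)

/-- Each generation adds an error `s`, and earlier errors are multiplied by at most `μ`. For a fixed
depth and `s = k / N` the collisions of the two searches are thus negligible. -/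
lemma abs_genStep_iterate_sub_le {f : PMF ℕ} (hμ : 1 < μ) (hf : pmfMean f = ENNReal.ofReal μ)
    {s : ℝ} (hs : 0 ≤ s) {q : ℝ} (hq : q ∈ Set.Icc (0 : ℝ) 1) (m : ℕ) :
    |(genStep f s)^[m] q - (genStep f 0)^[m] q| ≤ s * (m * μ ^ m) := by
  induction m with
  | zero => simp
  | succ m ih =>
    rw [Function.iterate_succ_apply', Function.iterate_succ_apply']
    set x := (genStep f s)^[m] q
    set y := (genStep f 0)^[m] q
    have hx : x ∈ Set.Icc (0 : ℝ) 1 := genStep_iterate_mem f hs hq m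
    have hy : y ∈ Set.Icc (0 : ℝ) 1 := genStep_iterate_mem f le_rfl hq m
    have h1 := abs_genFun_sub_le (by linarith) hf hx hy
    have hF0 := genFun_nonneg f hx.1
    have hF1 := genFun_le_one f hx.1 hx.2
    have h2 : |genStep f s x - genFun f x| ≤ s := by
      unfold genStep
      have h3 := Real.add_one_le_exp (-s)
      have h4 : Real.exp (-s) ≤ 1 := Real.exp_le_one_iff.2 (by linarith)
      rw [abs_le]
      constructor <;> nlinarith
    rw [genStep_zero]
    have hμm : 1 ≤ μ ^ (m + 1) := one_le_pow₀ hμ.le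
    calc |genStep f s x - genFun f y| ≤ |genStep f s x - genFun f x| + |genFun f x - genFun f y| :=
          abs_sub_le _ _ _
      _ ≤ s + μ * (s * (m * μ ^ m)) := by
          refine add_le_add h2 (h1.trans (mul_le_mul_of_nonneg_left ih (by linarith)))
      _ ≤ s * μ ^ (m + 1) + μ * (s * (m * μ ^ m)) := by
          have := mul_le_mul_of_nonneg_left hμm hs
          linarith
      _ = s * (((m + 1 : ℕ) : ℝ) * μ ^ (m + 1)) := by
          push_cast
          ring

/-- The probability that there is no path, uniformly over the regular bi-degree sequences. -/
theorem eventually_le_prob_eq_top (hν : 0 < ν) (hμ : 1 < μ)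
    (hgm : pmfMean gm = ENNReal.ofReal ν) (hfp : pmfMean fp = ENNReal.ofReal μ)
    (hfm : pmfMean fm = ENNReal.ofReal μ) (hε : 0 < ε) (hκ : 0 < κ) (hκ1 : κ ≤ 1) (m : ℕ) {η : ℝ}
    (hη : 0 < η) :
    ∀ᶠ n : ℕ in atTop, ∀ d : BiDegree n, d.Regular gp gm fp fm ε κ K →
      1 - (1 - genFun gp ((genStep fp 0)^[m] 0)) * (1 - genFun gm ((genStep fm 0)^[m] 0)) - η ≤
        d.prob fun G u v => G.hopcount u v = ⊤ := by
  have hμ0 : 0 < μ := by linarith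
  obtain ⟨c, C, hc, hc8, hC, hnear⟩ := eventually_near (K := K) hν hμ hgm hfp hfm hε hκ hκ1
  have hclim := tendsto_natCast_rpow_neg (a := -c) (by linarith)
  have hC₁ : 0 ≤ ν * (m * μ ^ m) := by positivity
  filter_upwards [hnear, eventually_error_le_of_fixed hμ hν (by linarith : 0 ≤ 2 * ν) hc hc8 hC hC₁
      m hη, hclim.eventually_le_const (by positivity : 0 < ν / 4), eventually_gt_atTop 0]
    with n hnear herr hcle hn0 d hd
  obtain ⟨hd1, hd2⟩ := hnear d hd
  have hn : (0 : ℝ) < n := by exact_mod_cast hn0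
  set N : ℝ := (d.edges : ℝ) with hN
  have hcn := mul_le_mul_of_nonneg_right hcle hn.le
  have hNlow : ν / 2 * n ≤ N := by
    have := (abs_le.1 hd2).1
    nlinarith
  have hNpos : 0 < N := lt_of_lt_of_le (by positivity) hNlow
  set ρ := (offspringLaw gm fm).map fun χ => genSize χ (m + 1) with hρ
  have : IsProbabilityMeasure ρ := Measure.isProbabilityMeasure_map
    (measurable_genSize (m + 1)).aemeasurable
  have hpow : ∀ k : ℕ, (0 : ℝ) ^ k ∈ Set.Icc (0 : ℝ) 1 := fun k =>
    ⟨by positivity, pow_le_one₀ le_rfl zero_le_one⟩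
  have hint : ∀ k : ℕ, ∫ i : ℕ, ((0 : ℝ) ^ i) ^ k ∂ρ = genFun gm ((genStep fm 0)^[m] (0 ^ k)) := by
    intro k
    rw [← integral_pow_genSize gm fm m (hpow k), hρ,
      integral_map (measurable_genSize (m + 1)).aemeasurable
        (Measurable.of_discrete).aestronglyMeasurable]
    refine integral_congr_ae (ae_of_all _ fun χ => ?_)
    simp only
    rw [← pow_mul, ← pow_mul, mul_comm]
  have hψ : ∀ k : ℕ, |genFun gm ((genStep fm (k / d.edges))^[m] (0 ^ k)) -
      ∫ i : ℕ, ((0 : ℝ) ^ i) ^ k ∂ρ| ≤ ν * (m * μ ^ m) / N * k := by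
    intro k
    have hs : (0 : ℝ) ≤ k / d.edges := by positivity
    rw [hint k]
    refine (abs_genFun_sub_le hν.le hgm (genStep_iterate_mem fm hs (hpow k) m)
      (genStep_iterate_mem fm le_rfl (hpow k) m)).trans ?_
    refine (mul_le_mul_of_nonneg_left (abs_genStep_iterate_sub_le hμ hfm hs (hpow k) m)
      hν.le).trans_eq ?_
    rw [← hN]
    ring
  have h1 := hd1.prob_hopcount_eq_top hμ hfp hfm m m ρ (by positivity) hψ
  have h2 : ∫ i : ℕ, genFun gp ((genStep fp 0)^[m] (0 ^ i)) ∂ρ =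
      1 - (1 - genFun gp ((genStep fp 0)^[m] 0)) * (1 - genFun gm ((genStep fm 0)^[m] 0)) := by
    -- For `i = 0` the backward process is dead and the value is `1`; for `i > 0` it is the
    -- extinction probability of the forward process. Hence the integral is the probability that at
    -- least one of them is dead.
    have e : ∀ i : ℕ, genFun gp ((genStep fp 0)^[m] (0 ^ i)) =
        genFun gp ((genStep fp 0)^[m] 0) +
          (1 - genFun gp ((genStep fp 0)^[m] 0)) * ((0 : ℝ) ^ i) ^ 1 := by
      intro i
      rcases Nat.eq_zero_or_pos i with rfl | hi
      · have h1 : ∀ m : ℕ, (genStep fp 0)^[m] 1 = 1 := fun m =>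
          Function.iterate_fixed (by rw [genStep_zero, genFun_one]) m
        rw [pow_zero, h1, genFun_one]
        ring
      · simp [zero_pow hi.ne']
    simp_rw [e]
    rw [integral_add (integrable_const _) ((integrable_of_mem_Icc fun i => by
      rw [pow_one]; exact hpow i).const_mul _), integral_const_mul, hint 1]
    simp only [integral_const, probReal_univ, one_smul, pow_one]
    ring
  rw [h2] at h1
  have h3 := herr N hNlow
  linarith

end Uniform

/-! ### Construction of the limiting variables -/

section LimitVariables

/-- Random variables on the integers with the tails `E exp(-w μ ^ (l n + x) / n)`, obtained from a
standard exponential variable that is independent of `w`. -/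
theorem exists_gumbel_variables {T : Type} [MeasurableSpace T] (ρ : Measure T)
    [IsProbabilityMeasure ρ] {w : T → ℝ} (hw : Measurable w) (hpos : ∀ᵐ χ ∂ρ, 0 < w χ) {μ : ℝ}
    (hμ : 1 < μ) (l : ℕ+ → ℤ) :
    ∃ (S : Type) (_ : MeasurableSpace S) (Q : Measure S) (_ : IsProbabilityMeasure Q)
      (X : ℕ+ → S → ℝ), (∀ n, Measurable (X n)) ∧ (∀ n s, ∃ z : ℤ, X n s = z) ∧
      ∀ (n : ℕ+) (x : ℝ), Q.real {s | X n s ≤ x} =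
        1 - ∫ χ, Real.exp (-(w χ * (μ ^ (l n + ⌊x⌋) / n))) ∂ρ := by
  have hμ0 : 0 < μ := by linarith
  have hE := isProbabilityMeasure_expMeasure one_pos
  refine ⟨T × ℝ, inferInstance, ρ.prod (expMeasure 1), inferInstance,
    fun n s => ((⌈Real.logb μ (s.2 * n / w s.1)⌉ - l n : ℤ) : ℝ), fun n => ?_,
    fun n s => ⟨_, rfl⟩, fun n x => ?_⟩
  · have h1 : Measurable fun s : T × ℝ => Real.logb μ (s.2 * n / w s.1) :=
      (Real.measurable_log.comp ((measurable_snd.mul_const _).div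
        (hw.comp measurable_fst))).div_const _
    exact (Measurable.of_discrete (f := fun z : ℤ => ((z - l n : ℤ) : ℝ))).comp
      (Int.measurable_ceil.comp h1)
  · have hn : (0 : ℝ) < (n : ℕ) := by exact_mod_cast n.pos
    set a : T → ℝ := fun χ => w χ * (μ ^ (l n + ⌊x⌋) / n) with ha
    have ham : Measurable a := hw.mul_const _
    -- Positivity keeps the logarithm away from its default values. Then `⌈log_μ (e n / w)⌉ - l n ≤
    -- x` says `e ≤ w μ ^ (l n + ⌊x⌋) / n`, an event for the exponential variable `e` given `w`.
    have hsnd : ∀ᵐ s ∂(ρ.prod (expMeasure 1)), 0 < s.2 := by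
      refine Measure.quasiMeasurePreserving_snd.ae (p := fun y : ℝ => 0 < y) ?_
      rw [ae_iff]
      have h := cdf_expMeasure_eq one_pos (0 : ℝ)
      rw [cdf_eq_real] at h
      have h2 : (expMeasure 1) (Set.Iic (0 : ℝ)) = 0 := by
        have : (expMeasure 1).real (Set.Iic (0 : ℝ)) = 0 := by rw [h]; simp
        rwa [measureReal_def, ENNReal.toReal_eq_zero_iff, or_iff_left (measure_ne_top _ _)] at this
      have e : {y : ℝ | ¬ 0 < y} = Set.Iic 0 := by
        ext y
        exact not_lt
      rw [e, h2]
    have hae : {s : T × ℝ | ((⌈Real.logb μ (s.2 * n / w s.1)⌉ - l n : ℤ) : ℝ) ≤ x}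
        =ᵐ[ρ.prod (expMeasure 1)] {s : T × ℝ | s.2 ≤ a s.1} := by
      filter_upwards [hsnd, Measure.quasiMeasurePreserving_fst.ae hpos] with s h1 h2
      refine propext ?_
      change ((⌈Real.logb μ (s.2 * n / w s.1)⌉ - l n : ℤ) : ℝ) ≤ x ↔
        s.2 ≤ w s.1 * (μ ^ (l n + ⌊x⌋) / n)
      rw [← Int.le_floor, sub_le_iff_le_add', Int.ceil_le, Real.logb_le_iff_le_rpow hμ
        (by positivity), Real.rpow_intCast, div_le_iff₀ h2, mul_div_assoc', le_div_iff₀ hn,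
        mul_comm (w s.1)]
    have hms : MeasurableSet {s : T × ℝ | s.2 ≤ a s.1} :=
      measurableSet_le measurable_snd (ham.comp measurable_fst)
    have hexp : Integrable (fun χ => Real.exp (-a χ)) ρ := by
      refine Integrable.of_bound (Real.measurable_exp.comp ham.neg).aestronglyMeasurable 1 ?_
      filter_upwards [hpos] with χ hχ
      rw [Real.norm_of_nonneg (Real.exp_nonneg _), Real.exp_le_one_iff, neg_nonpos]
      positivity
    have hone : ∫ χ, (1 - Real.exp (-a χ)) ∂ρ = 1 - ∫ χ, Real.exp (-a χ) ∂ρ := by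
      rw [integral_sub (integrable_const _) hexp]
      simp
    have hint : Integrable (fun χ => 1 - Real.exp (-a χ)) ρ := (integrable_const 1).sub hexp
    rw [measureReal_congr hae, ← hone, measureReal_def, Measure.prod_apply hms,
      integral_eq_lintegral_of_nonneg_ae ?_ hint.aestronglyMeasurable]
    · congr 1
      refine lintegral_congr_ae ?_
      filter_upwards [hpos] with χ hχ
      have h0 : 0 ≤ a χ := by positivity
      have h := cdf_expMeasure_eq one_pos (a χ)
      rw [cdf_eq_real, if_pos h0, one_mul] at h
      rw [← h, ofReal_measureReal]
      rfl
    · filter_upwards [hpos] with χ hχ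
      have h0 : 0 ≤ a χ := by positivity
      exact sub_nonneg.2 (Real.exp_le_one_iff.2 (neg_nonpos.2 h0))

lemma measureReal_eq_intCast {S : Type*} [MeasurableSpace S] {Q : Measure S}
    [IsProbabilityMeasure Q] {X : S → ℝ} (hX : Measurable X) (hz : ∀ s, ∃ z : ℤ, X s = z) (t : ℤ) :
    Q.real {s | X s = t} = Q.real {s | X s ≤ t} - Q.real {s | X s ≤ ((t - 1 : ℤ) : ℝ)} := by
  have e : {s | X s = t} = {s | X s ≤ t} \ {s | X s ≤ ((t - 1 : ℤ) : ℝ)} := by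
    ext s
    obtain ⟨z, hz⟩ := hz s
    change X s = t ↔ X s ≤ t ∧ ¬ X s ≤ ((t - 1 : ℤ) : ℝ)
    rw [hz, Int.cast_le, Int.cast_le, Int.cast_inj]
    omega
  rw [e, measureReal_sdiff ?_ (measurableSet_le hX measurable_const)]
  intro s (hs : X s ≤ ((t - 1 : ℤ) : ℝ))
  refine hs.trans ?_
  exact_mod_cast (by omega : t - 1 ≤ t)

end LimitVariables

/-! ### Joint survival of the two branching processes -/

section Survival

variable {gp gm fp fm : PMF ℕ} {ν μ : ℝ}

/-- The martingale limits of both branching processes are positive. -/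
def survival (ν μ : ℝ) : Set ((ℕ × ℕ → ℕ) × (ℕ × ℕ → ℕ)) :=
  {χ | 0 < gwLimit ν μ χ.1 * gwLimit ν μ χ.2}

lemma measurable_gwLimit_mul (ν μ : ℝ) :
    Measurable fun χ : (ℕ × ℕ → ℕ) × (ℕ × ℕ → ℕ) => gwLimit ν μ χ.1 * gwLimit ν μ χ.2 :=
  ((measurable_gwLimit ν μ).comp measurable_fst).mul ((measurable_gwLimit ν μ).comp measurable_snd)

lemma measurableSet_survival (ν μ : ℝ) : MeasurableSet (survival ν μ) :=
  measurableSet_lt measurable_const (measurable_gwLimit_mul ν μ)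

lemma ae_gwLimit_mul_nonneg (hν : 0 < ν) (hμ : 1 < μ) (hgp : pmfMean gp = ENNReal.ofReal ν)
    (hgm : pmfMean gm = ENNReal.ofReal ν) (hfp : pmfMean fp = ENNReal.ofReal μ)
    (hfm : pmfMean fm = ENNReal.ofReal μ) :
    ∀ᵐ χ ∂((offspringLaw gp fp).prod (offspringLaw gm fm)),
      0 ≤ gwLimit ν μ χ.1 * gwLimit ν μ χ.2 := by
  filter_upwards [ae_prod_tendsto hν hμ hgp hgm hfp hfm] with χ ⟨h1, h2⟩
  exact mul_nonneg (gwLimit_nonneg_of_tendsto hν hμ h1) (gwLimit_nonneg_of_tendsto hν hμ h2)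

lemma measureReal_survival (hν : 0 < ν) (hμ : 1 < μ) (hgp : pmfMean gp = ENNReal.ofReal ν)
    (hgm : pmfMean gm = ENNReal.ofReal ν) (hfp : pmfMean fp = ENNReal.ofReal μ)
    (hfm : pmfMean fm = ENNReal.ofReal μ) :
    ((offspringLaw gp fp).prod (offspringLaw gm fm)).real (survival ν μ) =
      (1 - (offspringLaw gp fp).real {χ | ¬ 0 < gwLimit ν μ χ}) *
        (1 - (offspringLaw gm fm).real {χ | ¬ 0 < gwLimit ν μ χ}) := by
  have hm : MeasurableSet {χ | 0 < gwLimit ν μ χ} :=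
    measurableSet_lt measurable_const (measurable_gwLimit ν μ)
  have e : ∀ P : Measure (ℕ × ℕ → ℕ), [IsProbabilityMeasure P] →
      1 - P.real {χ | ¬ 0 < gwLimit ν μ χ} = P.real {χ | 0 < gwLimit ν μ χ} := by
    intro P _
    have := probReal_compl_eq_one_sub (μ := P) hm
    change P.real {χ | ¬ 0 < gwLimit ν μ χ} = _ at this
    rw [this]
    ring
  rw [e, e, ← measureReal_prod_prod]
  refine measureReal_congr ?_
  filter_upwards [ae_prod_tendsto hν hμ hgp hgm hfp hfm] with χ ⟨h1, h2⟩
  refine propext ?_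
  change 0 < gwLimit ν μ χ.1 * gwLimit ν μ χ.2 ↔ 0 < gwLimit ν μ χ.1 ∧ 0 < gwLimit ν μ χ.2
  have h1' := gwLimit_nonneg_of_tendsto hν hμ h1
  have h2' := gwLimit_nonneg_of_tendsto hν hμ h2
  refine ⟨fun h => ⟨?_, ?_⟩, fun h => mul_pos h.1 h.2⟩
  · exact pos_of_mul_pos_left h h2'
  · exact pos_of_mul_pos_right h h1'

lemma integrable_exp_neg_mul (hν : 0 < ν) (hμ : 1 < μ) (hgp : pmfMean gp = ENNReal.ofReal ν)
    (hgm : pmfMean gm = ENNReal.ofReal ν) (hfp : pmfMean fp = ENNReal.ofReal μ)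
    (hfm : pmfMean fm = ENNReal.ofReal μ) {a : ℝ} (ha : 0 ≤ a) :
    Integrable (fun χ => Real.exp (-(a * (gwLimit ν μ χ.1 * gwLimit ν μ χ.2))))
      ((offspringLaw gp fp).prod (offspringLaw gm fm)) := by
  refine Integrable.of_bound (Real.measurable_exp.comp
    ((measurable_gwLimit_mul ν μ).const_mul a).neg).aestronglyMeasurable 1 ?_
  filter_upwards [ae_gwLimit_mul_nonneg hν hμ hgp hgm hfp hfm] with χ hχ
  rw [Real.norm_of_nonneg (Real.exp_nonneg _), Real.exp_le_one_iff, neg_nonpos]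
  exact mul_nonneg ha hχ

/-- The transform of the product of the limits, split according to survival. -/
lemma integral_exp_eq (hν : 0 < ν) (hμ : 1 < μ) (hgp : pmfMean gp = ENNReal.ofReal ν)
    (hgm : pmfMean gm = ENNReal.ofReal ν) (hfp : pmfMean fp = ENNReal.ofReal μ)
    (hfm : pmfMean fm = ENNReal.ofReal μ) {a : ℝ} (ha : 0 ≤ a)
    (hpos : ((offspringLaw gp fp).prod (offspringLaw gm fm)).real (survival ν μ) ≠ 0) :
    ∫ χ, Real.exp (-(a * (gwLimit ν μ χ.1 * gwLimit ν μ χ.2)))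
        ∂((offspringLaw gp fp).prod (offspringLaw gm fm)) =
      1 - ((offspringLaw gp fp).prod (offspringLaw gm fm)).real (survival ν μ) +
      ((offspringLaw gp fp).prod (offspringLaw gm fm)).real (survival ν μ) *
        ∫ χ, Real.exp (-(a * (gwLimit ν μ χ.1 * gwLimit ν μ χ.2)))
          ∂(ProbabilityTheory.cond ((offspringLaw gp fp).prod (offspringLaw gm fm)) (survival ν μ)) := by
  set P := (offspringLaw gp fp).prod (offspringLaw gm fm) with hP
  have hms := measurableSet_survival ν μ
  have hint := integrable_exp_neg_mul hν hμ hgp hgm hfp hfm ha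
  rw [← integral_add_compl hms hint]
  have h1 : ∫ χ in (survival ν μ)ᶜ, Real.exp (-(a * (gwLimit ν μ χ.1 * gwLimit ν μ χ.2))) ∂P =
      1 - P.real (survival ν μ) := by
    rw [← probReal_compl_eq_one_sub hms, ← setIntegral_one_eq_measureReal]
    refine setIntegral_congr_ae hms.compl ?_
    filter_upwards [ae_gwLimit_mul_nonneg hν hμ hgp hgm hfp hfm] with χ hχ h
    have : gwLimit ν μ χ.1 * gwLimit ν μ χ.2 = 0 := le_antisymm (not_lt.1 h) hχ
    simp [this]
  have h2 : P.real (survival ν μ) * ∫ χ, Real.exp (-(a * (gwLimit ν μ χ.1 * gwLimit ν μ χ.2)))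
      ∂(ProbabilityTheory.cond P (survival ν μ)) =
      ∫ χ in survival ν μ, Real.exp (-(a * (gwLimit ν μ χ.1 * gwLimit ν μ χ.2))) ∂P := by
    rw [ProbabilityTheory.cond, integral_smul_measure, ENNReal.toReal_inv, smul_eq_mul, ← measureReal_def,
      mul_inv_cancel_left₀ hpos]
  rw [h1, h2]
  ring

/-- The transform tends to the probability of extinction. -/
lemma tendsto_integral_exp (hν : 0 < ν) (hμ : 1 < μ) (hgp : pmfMean gp = ENNReal.ofReal ν)
    (hgm : pmfMean gm = ENNReal.ofReal ν) (hfp : pmfMean fp = ENNReal.ofReal μ)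
    (hfm : pmfMean fm = ENNReal.ofReal μ) {a : ℕ → ℝ} (ha0 : ∀ k, 0 ≤ a k)
    (ha : Tendsto a atTop atTop) :
    Tendsto (fun k => ∫ χ, Real.exp (-(a k * (gwLimit ν μ χ.1 * gwLimit ν μ χ.2)))
        ∂((offspringLaw gp fp).prod (offspringLaw gm fm))) atTop
      (𝓝 (1 - ((offspringLaw gp fp).prod (offspringLaw gm fm)).real (survival ν μ))) := by
  have hms := measurableSet_survival ν μ
  rw [← probReal_compl_eq_one_sub hms, ← integral_indicator_one hms.compl]
  refine tendsto_integral_of_dominated_convergence (fun _ => 1)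
    (fun k => (integrable_exp_neg_mul hν hμ hgp hgm hfp hfm (ha0 k)).aestronglyMeasurable)
    (integrable_const _) (fun k => ?_) ?_
  · filter_upwards [ae_gwLimit_mul_nonneg hν hμ hgp hgm hfp hfm] with χ hχ
    rw [Real.norm_of_nonneg (Real.exp_nonneg _), Real.exp_le_one_iff, neg_nonpos]
    exact mul_nonneg (ha0 k) hχ
  · filter_upwards [ae_gwLimit_mul_nonneg hν hμ hgp hgm hfp hfm] with χ hχ
    by_cases h : χ ∈ survival ν μ
    · rw [Set.indicator_of_notMem (by simpa using h)]
      exact Real.tendsto_exp_atBot.comp (tendsto_neg_atTop_atBot.comp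
        (ha.atTop_mul_const h))
    · rw [Set.indicator_of_mem (by simpa using h)]
      have : gwLimit ν μ χ.1 * gwLimit ν μ χ.2 = 0 := le_antisymm (not_lt.1 h) hχ
      simp [this]

end Survival

/-! ### Limits for the random graphs -/

section Conclusion

variable {gp gm fp fm : PMF ℕ} {ν μ ε κ K : ℝ}

lemma eventually_pnat {p : ℕ → Prop} (h : ∀ᶠ n : ℕ in atTop, p n) : ∀ᶠ n : ℕ+ in atTop, p n :=
  tendsto_PNat_val_atTop_atTop.eventually h

lemma eventually_nat_of_pnat {p : ℕ → Prop} (h : ∀ᶠ n : ℕ+ in atTop, p n) :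
    ∀ᶠ n : ℕ in atTop, p n := by
  obtain ⟨N, hN⟩ := eventually_atTop.1 h
  filter_upwards [eventually_ge_atTop (N : ℕ)] with n hn
  exact hN ⟨n, N.pos.trans_le hn⟩ hn

/-- The limit of the tail of the hopcount. -/
noncomputable def tailTransform (gp gm fp fm : PMF ℕ) (ν μ : ℝ) (n : ℕ) (t : ℤ) : ℝ :=
  ∫ χ, Real.exp (-(ν / (μ - 1) * (μ ^ (⌊Real.logb μ n⌋ + t) / n) *
    (gwLimit ν μ χ.1 * gwLimit ν μ χ.2))) ∂((offspringLaw gp fp).prod (offspringLaw gm fm))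

lemma tailTransform_mem (hν : 0 < ν) (hμ : 1 < μ) (hgp : pmfMean gp = ENNReal.ofReal ν)
    (hgm : pmfMean gm = ENNReal.ofReal ν) (hfp : pmfMean fp = ENNReal.ofReal μ)
    (hfm : pmfMean fm = ENNReal.ofReal μ) (n : ℕ) (t : ℤ) :
    tailTransform gp gm fp fm ν μ n t ∈ Set.Icc (0 : ℝ) 1 := by
  have hμ0 : 0 < μ := by linarith
  have hμ1 : 0 < μ - 1 := by linarith
  refine ⟨integral_nonneg fun _ => Real.exp_nonneg _, ?_⟩
  have ha : 0 ≤ ν / (μ - 1) * (μ ^ (⌊Real.logb μ n⌋ + t) / n) := by positivity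
  have := integral_mono_ae (integrable_exp_neg_mul hν hμ hgp hgm hfp hfm ha)
    (integrable_const (1 : ℝ)) (by
      filter_upwards [ae_gwLimit_mul_nonneg hν hμ hgp hgm hfp hfm] with χ hχ
      rw [Real.exp_le_one_iff, neg_nonpos]
      exact mul_nonneg ha hχ)
  simpa [tailTransform] using this

variable {Ω : ℕ+ → Type*} [∀ n, MeasurableSpace (Ω n)] {P : ∀ n, Measure (Ω n)}
    {G : ∀ n : ℕ+, Ω n → Graph n} {U V : ∀ n : ℕ+, Ω n → Fin n}

lemma eventually_exists_regular
    (hreg : Tendsto (fun n : ℕ+ => P n {ω | (G n ω).deg.Regular gp gm fp fm ε κ K}) atTop (𝓝 1)) :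
    ∀ᶠ n : ℕ in atTop, ∃ d : BiDegree n, d.Regular gp gm fp fm ε κ K := by
  refine eventually_nat_of_pnat ?_
  filter_upwards [hreg.eventually_const_lt zero_lt_one] with n hn
  obtain ⟨ω, hω⟩ := nonempty_of_measure_ne_zero hn.ne'
  exact ⟨_, hω⟩

variable [∀ n, IsProbabilityMeasure (P n)]

lemma tendsto_measureReal_not_regular (hG : ∀ n, IsDCM (P n) (G n) (U n) (V n))
    (hreg : Tendsto (fun n : ℕ+ => P n {ω | (G n ω).deg.Regular gp gm fp fm ε κ K}) atTop (𝓝 1)) :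
    Tendsto (fun n : ℕ+ => (P n).real {ω | ¬ (G n ω).deg.Regular gp gm fp fm ε κ K}) atTop
      (𝓝 0) := by
  have h1 := (ENNReal.tendsto_toReal ENNReal.one_ne_top).comp hreg
  have h2 := h1.const_sub 1
  rw [ENNReal.toReal_one, sub_self] at h2
  refine h2.congr fun n => ?_
  have := probReal_compl_eq_one_sub (μ := P n)
    ((hG n).measurableSet fun g _ _ => g.deg.Regular gp gm fp fm ε κ K)
  exact this.symm

theorem tendsto_tail_sub (hν : 0 < ν) (hμ : 1 < μ) (hgp : pmfMean gp = ENNReal.ofReal ν)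
    (hgm : pmfMean gm = ENNReal.ofReal ν) (hfp : pmfMean fp = ENNReal.ofReal μ)
    (hfm : pmfMean fm = ENNReal.ofReal μ) (hε : 0 < ε) (hκ : 0 < κ) (hκ1 : κ ≤ 1)
    (hG : ∀ n, IsDCM (P n) (G n) (U n) (V n))
    (hreg : Tendsto (fun n : ℕ+ => P n {ω | (G n ω).deg.Regular gp gm fp fm ε κ K}) atTop (𝓝 1))
    (t : ℤ) :
    Tendsto (fun n : ℕ+ => (P n).real {ω | (((⌊Real.logb μ (n : ℕ)⌋ + t).toNat : ℕ) : ℕ∞) <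
        (G n ω).hopcount (U n ω) (V n ω)} - tailTransform gp gm fp fm ν μ n t) atTop (𝓝 0) := by
  rw [tendsto_zero_iff_abs_tendsto_zero]
  refine tendsto_order.2 ⟨fun a ha => Eventually.of_forall fun n => ha.trans_le (abs_nonneg _),
    fun a ha => ?_⟩
  filter_upwards [eventually_pnat (eventually_abs_prob_gt_le (K := K) hν hμ hgp hgm hfp hfm hε hκ
      hκ1 t (half_pos ha)),
    (tendsto_measureReal_not_regular hG hreg).eventually_lt_const (half_pos ha)] with n h1 h2
  have hmem := tailTransform_mem hν hμ hgp hgm hfp hfm n t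
  have h1' : ∀ d : BiDegree n, d.Regular gp gm fp fm ε κ K →
      |tailTransform gp gm fp fm ν μ n t -
        d.prob fun G u v => (((⌊Real.logb μ (n : ℕ)⌋ + t).toNat : ℕ) : ℕ∞) < G.hopcount u v| ≤
        a / 2 := h1
  have hu := (hG n).measure_le
    (fun G u v => (((⌊Real.logb μ (n : ℕ)⌋ + t).toNat : ℕ) : ℕ∞) < G.hopcount u v)
    (R := fun d => d.Regular gp gm fp fm ε κ K) (b := tailTransform gp gm fp fm ν μ n t + a / 2)
    (by linarith [hmem.1]) fun d hd => by linarith [(abs_le.1 (h1' d hd)).1]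
  have hl := (hG n).le_measure n.pos
    (fun G u v => (((⌊Real.logb μ (n : ℕ)⌋ + t).toNat : ℕ) : ℕ∞) < G.hopcount u v)
    (R := fun d => d.Regular gp gm fp fm ε κ K) (b := tailTransform gp gm fp fm ν μ n t - a / 2)
    (by linarith [hmem.2]) fun d hd => by linarith [(abs_le.1 (h1' d hd)).2]
  change |_| < a
  rw [abs_lt]
  constructor <;> linarith

/-- Survival has positive probability, and it is approximated by survival of finitely many
generations. -/
theorem survival_pos (hν : 0 < ν) (hμ : 1 < μ) (hgp : pmfMean gp = ENNReal.ofReal ν)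
    (hgm : pmfMean gm = ENNReal.ofReal ν) (hfp : pmfMean fp = ENNReal.ofReal μ)
    (hfm : pmfMean fm = ENNReal.ofReal μ) (hε : 0 < ε) (hκ : 0 < κ) (hκ1 : κ ≤ 1)
    (hd : ∀ᶠ n : ℕ in atTop, ∃ d : BiDegree n, d.Regular gp gm fp fm ε κ K) :
    0 < ((offspringLaw gp fp).prod (offspringLaw gm fm)).real (survival ν μ) ∧
    Tendsto (fun m => (1 - genFun gp ((genStep fp 0)^[m] 0)) *
      (1 - genFun gm ((genStep fm 0)^[m] 0))) atTop
      (𝓝 (((offspringLaw gp fp).prod (offspringLaw gm fm)).real (survival ν μ))) := by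
  obtain ⟨h1, h2⟩ := tendsto_extinction hν hμ hgp hfp hκ hκ1 (sum_rpow_le hν hgm hε hκ hd)
  obtain ⟨h3, h4⟩ := tendsto_extinction hν hμ hgm hfm hκ hκ1
    (sum_rpow_le (gp := gm) (gm := gp) (fp := fm) (fm := fp) hν hgp hε hκ
      (hd.mono fun n ⟨d, hd⟩ => ⟨d.reverse, hd.reverse⟩))
  rw [measureReal_survival hν hμ hgp hgm hfp hfm]
  exact ⟨mul_pos (by linarith) (by linarith), (h1.const_sub 1).mul (h3.const_sub 1)⟩

theorem tendsto_measureReal_eq_top (hν : 0 < ν) (hμ : 1 < μ) (hgp : pmfMean gp = ENNReal.ofReal ν)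
    (hgm : pmfMean gm = ENNReal.ofReal ν) (hfp : pmfMean fp = ENNReal.ofReal μ)
    (hfm : pmfMean fm = ENNReal.ofReal μ) (hε : 0 < ε) (hκ : 0 < κ) (hκ1 : κ ≤ 1)
    (hG : ∀ n, IsDCM (P n) (G n) (U n) (V n))
    (hreg : Tendsto (fun n : ℕ+ => P n {ω | (G n ω).deg.Regular gp gm fp fm ε κ K}) atTop (𝓝 1)) :
    Tendsto (fun n : ℕ+ => (P n).real {ω | (G n ω).hopcount (U n ω) (V n ω) = ⊤}) atTop
      (𝓝 (1 - ((offspringLaw gp fp).prod (offspringLaw gm fm)).real (survival ν μ))) := by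
  have hμ0 : 0 < μ := by linarith
  have hμ1 : 0 < μ - 1 := by linarith
  obtain ⟨-, hsurv⟩ := survival_pos hν hμ hgp hgm hfp hfm hε hκ hκ1
    (eventually_exists_regular hreg)
  set π := ((offspringLaw gp fp).prod (offspringLaw gm fm)).real (survival ν μ) with hπ
  have hnr := tendsto_measureReal_not_regular hG hreg
  refine tendsto_order.2 ⟨fun a ha => ?_, fun a ha => ?_⟩
  -- One third each for stopping after `m` generations, for the comparison error, and for irregular
  -- degree sequences.
  · set η := (1 - π - a) / 3 with hη
    have hη0 : 0 < η := by rw [hη]; linarith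
    obtain ⟨m, hm⟩ := (hsurv.eventually_lt_const (by linarith : π < π + η)).exists
    filter_upwards [eventually_pnat (eventually_le_prob_eq_top (K := K) (gp := gp) hν hμ hgm hfp hfm
      hε hκ hκ1 m hη0), hnr.eventually_lt_const hη0] with n h1 h2
    have hz1 := genStep_iterate_mem fp le_rfl (Set.left_mem_Icc.2 (zero_le_one (α := ℝ))) m
    have hz2 := genStep_iterate_mem fm le_rfl (Set.left_mem_Icc.2 (zero_le_one (α := ℝ))) m
    have hnn := mul_nonneg (sub_nonneg.2 (genFun_le_one gp hz1.1 hz1.2))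
      (sub_nonneg.2 (genFun_le_one gm hz2.1 hz2.2))
    have h3 := (hG n).le_measure n.pos (fun G u v => G.hopcount u v = ⊤)
      (R := fun d => d.Regular gp gm fp fm ε κ K) (by linarith) h1
    have h4 : 3 * η = 1 - π - a := by rw [hη]; ring
    linarith
  -- An infinite hopcount exceeds `⌊log_μ n⌋ + k`. Since `⌊log_μ n⌋ > log_μ n - 1`, the exponent
  -- there is at least the one with `μ ^ k / μ`, uniformly in `n`.
  · have hlim := tendsto_integral_exp hν hμ hgp hgm hfp hfm
      (a := fun k : ℕ => ν / (μ - 1) * (μ ^ k / μ)) (fun k => by positivity)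
      (((tendsto_pow_atTop_atTop_of_one_lt hμ).atTop_div_const hμ0).const_mul_atTop
        (by positivity))
    obtain ⟨k, hk⟩ := (hlim.eventually_lt_const ha).exists
    set b := ∫ χ, Real.exp (-(ν / (μ - 1) * (μ ^ k / μ) * (gwLimit ν μ χ.1 * gwLimit ν μ χ.2)))
        ∂((offspringLaw gp fp).prod (offspringLaw gm fm)) with hb
    have htail := tendsto_tail_sub hν hμ hgp hgm hfp hfm hε hκ hκ1 hG hreg k
    filter_upwards [htail.eventually_lt_const (by linarith : 0 < a - b)] with n h1
    have hn : (0 : ℝ) < (n : ℕ) := by exact_mod_cast n.pos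
    have h2 : tailTransform gp gm fp fm ν μ n k ≤ b := by
      have hle : μ ^ k / μ ≤ μ ^ (⌊Real.logb μ (n : ℕ)⌋ + (k : ℤ)) / (n : ℕ) := by
        rw [div_le_div_iff₀ hμ0 hn, zpow_add₀ hμ0.ne', zpow_natCast]
        have h3 : ((n : ℕ) : ℝ) ≤ μ ^ ⌊Real.logb μ (n : ℕ)⌋ * μ := by
          rw [← zpow_add_one₀ hμ0.ne', ← Real.rpow_intCast]
          calc ((n : ℕ) : ℝ) = μ ^ Real.logb μ (n : ℕ) := (Real.rpow_logb hμ0 hμ.ne' hn).symm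
            _ ≤ _ := Real.rpow_le_rpow_of_exponent_le hμ.le (by
              push_cast
              exact (Int.lt_floor_add_one _).le)
        have := mul_le_mul_of_nonneg_left h3 (pow_nonneg hμ0.le k)
        linarith
      have ha1 : 0 ≤ ν / (μ - 1) * (μ ^ k / μ) := by positivity
      have ha2 := mul_le_mul_of_nonneg_left hle (by positivity : 0 ≤ ν / (μ - 1))
      refine integral_mono_ae (integrable_exp_neg_mul hν hμ hgp hgm hfp hfm (ha1.trans ha2))
        (integrable_exp_neg_mul hν hμ hgp hgm hfp hfm ha1) ?_
      filter_upwards [ae_gwLimit_mul_nonneg hν hμ hgp hgm hfp hfm] with χ hχ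
      exact Real.exp_le_exp.2 (neg_le_neg (mul_le_mul_of_nonneg_right ha2 hχ))
    have h3 : (P n).real {ω | (G n ω).hopcount (U n ω) (V n ω) = ⊤} ≤
        (P n).real {ω | (((⌊Real.logb μ (n : ℕ)⌋ + k).toNat : ℕ) : ℕ∞) <
        (G n ω).hopcount (U n ω) (V n ω)} := by
      refine measureReal_mono fun ω hω => ?_
      have hω' : (G n ω).hopcount (U n ω) (V n ω) = ⊤ := hω
      change _ < (G n ω).hopcount (U n ω) (V n ω)
      rw [hω']
      exact ENat.natCast_lt_top _
    linarith

/-- The conditional distribution of the hopcount in terms of its tail. -/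
lemma cond_hopcount_eq {n : ℕ} {Ω : Type*} [MeasurableSpace Ω] {P : Measure Ω}
    [IsProbabilityMeasure P] {G : Ω → Graph n} {U V : Ω → Fin n} (hG : IsDCM P G U V) {l t : ℤ}
    (h : 0 ≤ l + (t - 1)) :
    (ProbabilityTheory.cond P {ω | (G ω).hopcount (U ω) (V ω) < ⊤}).real
        {ω | ∃ k : ℕ, (G ω).hopcount (U ω) (V ω) = (k : ℕ∞) ∧ (k : ℤ) - l = t} =
      (P.real {ω | (((l + (t - 1)).toNat : ℕ) : ℕ∞) < (G ω).hopcount (U ω) (V ω)} -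
        P.real {ω | (((l + t).toNat : ℕ) : ℕ∞) < (G ω).hopcount (U ω) (V ω)}) /
      (1 - P.real {ω | (G ω).hopcount (U ω) (V ω) = ⊤}) := by
  have hm := hG.measurableSet fun g u v => g.hopcount u v < ⊤
  have h1 : P.real {ω | (G ω).hopcount (U ω) (V ω) < ⊤} =
      1 - P.real {ω | (G ω).hopcount (U ω) (V ω) = ⊤} := by
    rw [← probReal_compl_eq_one_sub (hG.measurableSet fun g u v => g.hopcount u v = ⊤)]
    congr 1
    ext ω
    change (G ω).hopcount (U ω) (V ω) < ⊤ ↔ (G ω).hopcount (U ω) (V ω) ≠ ⊤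
    exact lt_top_iff_ne_top
  -- This is where `0 ≤ l + (t - 1)` matters: truncation at zero would make the two tails coincide.
  have e1 : (l + t).toNat = (l + (t - 1)).toNat + 1 := by omega
  have h2 : {ω | (G ω).hopcount (U ω) (V ω) < ⊤} ∩
      {ω | ∃ k : ℕ, (G ω).hopcount (U ω) (V ω) = (k : ℕ∞) ∧ (k : ℤ) - l = t} =
      {ω | (((l + (t - 1)).toNat : ℕ) : ℕ∞) < (G ω).hopcount (U ω) (V ω)} \
        {ω | (((l + t).toNat : ℕ) : ℕ∞) < (G ω).hopcount (U ω) (V ω)} := by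
    ext ω
    change ((G ω).hopcount (U ω) (V ω) < ⊤ ∧
      ∃ k : ℕ, (G ω).hopcount (U ω) (V ω) = (k : ℕ∞) ∧ (k : ℤ) - l = t) ↔
      (((l + (t - 1)).toNat : ℕ) : ℕ∞) < (G ω).hopcount (U ω) (V ω) ∧
      ¬ (((l + t).toNat : ℕ) : ℕ∞) < (G ω).hopcount (U ω) (V ω)
    generalize (G ω).hopcount (U ω) (V ω) = x
    induction x using ENat.recTopCoe with
    | top => simp
    | coe x =>
      simp only [ENat.natCast_lt_top, true_and, Nat.cast_lt, Nat.cast_inj]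
      constructor
      · rintro ⟨k, rfl, hk⟩
        omega
      · intro hx
        exact ⟨x, rfl, by omega⟩
  rw [measureReal_def, cond_apply hm, ENNReal.toReal_mul, ENNReal.toReal_inv, ← measureReal_def,
    ← measureReal_def, h1, h2, measureReal_sdiff ?_
      (hG.measurableSet fun g u v => (((l + t).toNat : ℕ) : ℕ∞) < g.hopcount u v), inv_mul_eq_div]
  intro ω hω
  refine lt_trans ?_ (show (((l + t).toNat : ℕ) : ℕ∞) < (G ω).hopcount (U ω) (V ω) from hω)
  exact_mod_cast (by omega : (l + (t - 1)).toNat < (l + t).toNat)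

end Conclusion

end DCM

/-! ### The main theorem -/

theorem theorem2p1
    -- the limiting degree and size-biased degree distributions, with their means
    (gp gm fp fm : PMF ℕ) (ν μ : ℝ) (hν : 0 < ν) (hμ : 1 < μ)
    (hgp : DCM.pmfMean gp = ENNReal.ofReal ν) (hgm : DCM.pmfMean gm = ENNReal.ofReal ν)
    (hfp : DCM.pmfMean fp = ENNReal.ofReal μ) (hfm : DCM.pmfMean fm = ENNReal.ofReal μ)
    (ε κ K : ℝ) (hε : 0 < ε) (hκ0 : 0 < κ) (hκ1 : κ ≤ 1)
    -- the random graphs and the two randomly chosen nodes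
    {Ω : ℕ+ → Type*} [∀ n, MeasurableSpace (Ω n)] (P : ∀ n, Measure (Ω n))
    [∀ n, IsProbabilityMeasure (P n)]
    (G : ∀ n : ℕ+, Ω n → DCM.Graph n) (U V : ∀ n : ℕ+, Ω n → Fin n)
    (hG : ∀ n, DCM.IsDCM (P n) (G n) (U n) (V n))
    -- the bi-degree sequences are regular with probability tending to one
    (hreg : Tendsto
      (fun n : ℕ+ => P n {ω | (G n ω).deg.Regular gp gm fp fm ε κ K}) atTop (𝓝 1)) :
    -- the martingale limits exist almost surely, and the conditioning is on a non-null event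
    (∀ᵐ χ ∂(DCM.offspringLaw gp fp),
      Tendsto (DCM.gwMartingale ν μ χ) atTop (𝓝 (DCM.gwLimit ν μ χ))) ∧
    (∀ᵐ χ ∂(DCM.offspringLaw gm fm),
      Tendsto (DCM.gwMartingale ν μ χ) atTop (𝓝 (DCM.gwLimit ν μ χ))) ∧
    0 < ((DCM.offspringLaw gp fp).prod (DCM.offspringLaw gm fm))
      {χ | 0 < DCM.gwLimit ν μ χ.1 * DCM.gwLimit ν μ χ.2} ∧
    -- the limiting random variables
    ∃ (S : Type) (_ : MeasurableSpace S) (Q : Measure S) (_ : IsProbabilityMeasure Q)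
      (X : ℕ+ → S → ℝ),
      (∀ n, Measurable (X n)) ∧
      (∀ (n : ℕ+) (x : ℝ), Q.real {s | X n s ≤ x} =
        1 - ∫ χ, Real.exp (-(ν / (μ - 1) *
              (μ ^ (⌊Real.logb μ (n : ℝ)⌋ + ⌊x⌋) / (n : ℝ)) *
              (DCM.gwLimit ν μ χ.1 * DCM.gwLimit ν μ χ.2)))
            ∂(ProbabilityTheory.cond
              ((DCM.offspringLaw gp fp).prod (DCM.offspringLaw gm fm))
              {χ | 0 < DCM.gwLimit ν μ χ.1 * DCM.gwLimit ν μ χ.2})) ∧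
      ∀ t : ℤ, Tendsto
        (fun n : ℕ+ =>
          |(ProbabilityTheory.cond (P n)
              {ω | (G n ω).hopcount (U n ω) (V n ω) < ⊤}).real
              {ω | ∃ k : ℕ, (G n ω).hopcount (U n ω) (V n ω) = (k : ℕ∞) ∧
                (k : ℤ) - ⌊Real.logb μ (n : ℝ)⌋ = t}
            - Q.real {s | X n s = (t : ℝ)}|)
        atTop (𝓝 0) := by
  have hμ0 : 0 < μ := by linarith
  have hμ1 : 0 < μ - 1 := by linarith
  obtain ⟨hpos, -⟩ := DCM.survival_pos hν hμ hgp hgm hfp hfm hε hκ0 hκ1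
    (DCM.eventually_exists_regular hreg)
  set R := (DCM.offspringLaw gp fp).prod (DCM.offspringLaw gm fm) with hR
  set A : Set ((ℕ × ℕ → ℕ) × (ℕ × ℕ → ℕ)) :=
    {χ | 0 < DCM.gwLimit ν μ χ.1 * DCM.gwLimit ν μ χ.2} with hA
  have hposA : 0 < R.real A := hpos
  have hA0 : R A ≠ 0 := fun h => by
    rw [measureReal_def, h] at hposA
    simp at hposA
  have hcondp : IsProbabilityMeasure (ProbabilityTheory.cond R A) :=
    cond_isProbabilityMeasure hA0
  have hw : ∀ᵐ χ ∂(ProbabilityTheory.cond R A),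
      0 < ν / (μ - 1) * (DCM.gwLimit ν μ χ.1 * DCM.gwLimit ν μ χ.2) := by
    filter_upwards [ae_cond_mem (DCM.measurableSet_survival ν μ)] with χ hχ
    exact mul_pos (by positivity) hχ
  obtain ⟨S, mS, Q, hQ, X, hXm, hXz, hX⟩ := DCM.exists_gumbel_variables
    (ProbabilityTheory.cond R A) ((DCM.measurable_gwLimit_mul ν μ).const_mul (ν / (μ - 1))) hw hμ
    fun n => ⌊Real.logb μ (n : ℝ)⌋
  have hX' : ∀ (n : ℕ+) (x : ℝ), Q.real {s | X n s ≤ x} =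
      1 - ∫ χ, Real.exp (-(ν / (μ - 1) * (μ ^ (⌊Real.logb μ (n : ℝ)⌋ + ⌊x⌋) / (n : ℝ)) *
        (DCM.gwLimit ν μ χ.1 * DCM.gwLimit ν μ χ.2))) ∂(ProbabilityTheory.cond R A) := by
    intro n x
    rw [hX n x]
    congr 2
    funext χ
    congr 1
    ring
  refine ⟨DCM.ae_tendsto_gwMartingale hν hμ hgp hfp, DCM.ae_tendsto_gwMartingale hν hμ hgm hfm,
    pos_iff_ne_zero.2 hA0, S, mS, Q, hQ, X, hXm, hX', fun t => ?_⟩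
  -- Off the survival event the exponential equals `1` almost surely, so the conditional transform
  -- is recovered from the unconditional one by subtracting `1 - R.real A` and dividing by `R.real
  -- A`.
  have hsplit : ∀ (n : ℕ+) (t : ℤ), Q.real {s | X n s ≤ (t : ℝ)} =
      1 - (DCM.tailTransform gp gm fp fm ν μ n t - (1 - R.real A)) / R.real A := by
    intro n t
    have hn : (0 : ℝ) < (n : ℕ) := by exact_mod_cast n.pos
    rw [hX' n t, Int.floor_intCast, DCM.tailTransform, DCM.integral_exp_eq hν hμ hgp hgm hfp hfm
      (by positivity) hpos.ne']
    change _ = 1 - (1 - R.real A + R.real A * _ - (1 - R.real A)) / R.real A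
    rw [add_sub_cancel_left, mul_div_cancel_left₀ _ hposA.ne']
    rfl
  have hQt : ∀ n : ℕ+, Q.real {s | X n s = (t : ℝ)} =
      (DCM.tailTransform gp gm fp fm ν μ n (t - 1) - DCM.tailTransform gp gm fp fm ν μ n t) /
        R.real A := by
    intro n
    rw [DCM.measureReal_eq_intCast (hXm n) (hXz n) t, hsplit n t, hsplit n (t - 1)]
    ring
  have h1 := DCM.tendsto_tail_sub hν hμ hgp hgm hfp hfm hε hκ0 hκ1 hG hreg (t - 1)
  have h2 := DCM.tendsto_tail_sub hν hμ hgp hgm hfp hfm hε hκ0 hκ1 hG hreg t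
  have h3 := (DCM.tendsto_measureReal_eq_top hν hμ hgp hgm hfp hfm hε hκ0 hκ1 hG hreg).const_sub 1
  rw [sub_sub_cancel] at h3
  have h4 := h3.inv₀ hpos.ne'
  have h5 : Tendsto (fun n : ℕ+ => (1 - (P n).real {ω | (G n ω).hopcount (U n ω) (V n ω) = ⊤})⁻¹ -
      (R.real A)⁻¹) atTop (𝓝 0) := by
    have := h4.sub_const (R.real A)⁻¹
    rwa [show (R.real (DCM.survival ν μ))⁻¹ - (R.real A)⁻¹ = 0 from sub_self _] at this
  -- The tail differences need not converge, as `μ ^ ⌊log_μ n⌋ / n` oscillates; they are bounded,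
  -- which suffices to exchange the normalizations `P(H_n < ∞)` and `R.real A`.
  have h6 : Tendsto (fun n : ℕ+ => (DCM.tailTransform gp gm fp fm ν μ n (t - 1) -
      DCM.tailTransform gp gm fp fm ν μ n t) *
      ((1 - (P n).real {ω | (G n ω).hopcount (U n ω) (V n ω) = ⊤})⁻¹ - (R.real A)⁻¹)) atTop
      (𝓝 0) := by
    refine bdd_le_mul_tendsto_zero' 1 (Eventually.of_forall fun n => ?_) h5
    have m1 := DCM.tailTransform_mem hν hμ hgp hgm hfp hfm n (t - 1)
    have m2 := DCM.tailTransform_mem hν hμ hgp hgm hfp hfm n t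
    rw [abs_le]
    constructor <;> linarith [m1.1, m1.2, m2.1, m2.2]
  have h7 := ((h1.sub h2).mul h4).add h6
  rw [sub_self, zero_mul, zero_add] at h7
  refine (tendsto_zero_iff_abs_tendsto_zero _).1 ?_
  refine h7.congr' ?_
  filter_upwards [DCM.eventually_pnat
    ((DCM.tendsto_floor_logb_add hμ (t - 1)).eventually_ge_atTop 0)] with n hn
  rw [hQt n, DCM.cond_hopcount_eq (hG n) hn]
  ring
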